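/- **Setting.** Let $\gamma\in(-1,1)$. Let $R,L,d,Q>0$ and $D=(D_1,D_2,D_3)\in\mathbb R^{3\times 3}$, $D_k=(D_{k,1},D_{k,2},D_{k,3})$, be functions of a parameter $\eta>0$ (small). Put $\rho=d/\sqrt Q$ and assume $\eta=R/\rho$ and, as $\eta\to0^+$, $$\frac{\rho}{L}\to0,\qquad \frac{\rho L}{d^2}\to0,\qquad \frac{\rho}{d^2}D_{1,1}\to-2\gamma,$$ $$\frac{\rho}{d^2}\big(|D_{1,2}|+|D_{1,3}|+|D_{2,1}|+|D_{3,1}|\big)\to0,\qquad \frac{\sqrt{\rho L}}{d^2}\big(|D_{2,2}|+|D_{2,3}|+|D_{3,2}|+|D_{3,3}|\big)\to0.$$ Let $B_1\subset\mathbb R^2$ be the open unit disk, $\Sigma=\mathbb R\times B_1$ and $\Sigma_\eta=(-L/\rho,L/\rho)\times B_1$. Write $m'=(m_2,m_3)$, $\nabla'=(\partial_2,\partial_3)$, $\nabla_\eta=(\partial_1,\frac1\eta\nabla')$ and $\Phi(m)=m_2^2+m_3^2$; derivatives are weak derivatives. For weakly differentiable $m:\Sigma\to\mathbb R^3$ let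 $\|m\|_{\mathcal H^1(\Sigma)}=\|\nabla m\|_{L^2(\Sigma)}+\|m'\|_{L^2(\Sigma)}$, and let $$\mathcal M_\eta=\{m:\Sigma\to\mathbb S^2:\ \|m\|_{\mathcal H^1(\Sigma)}<\infty,\ m'=0\text{ if }|x_1|\ge L/\rho\},$$ $$\mathcal M_0=\{m:\Sigma\to\mathbb S^2:\ m=m(x_1),\ \|m\|_{\mathcal H^1(\Sigma)}<\infty\}.$$ We say that $m_k\rightharpoonup m_0$ weakly in $\mathcal H^1(\Sigma)$ if $\nabla m_k\rightharpoonup\nabla m_0$ and $m_k'\rightharpoonup m_0'$ weakly in $L^2(\Sigma)$. For $m\in\mathcal M_\eta$ let $E_\eta(m)=\int_\Sigma e_\eta(m)\,dX+S_\eta(m)$ with $$e_\eta(m)=|\partial_1m|^2+\big|\tfrac1\eta\nabla'm\big|^2+\Phi(m)+\frac{\rho}{d^2}\Big(D_1\cdot\partial_1m\wedge m+\sum_{k=2}^3D_k\cdot\big(\tfrac1\eta\partial_km\big)\wedge m\Big),\qquad S_\eta(m)=\frac{R^2}{d^2}\int_{\mathbb R^3}|\nabla_\eta U|^2\,dX.$$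 Here $U\in\dot H^1(\mathbb R^3)$ (the completion of $C_c^\infty(\mathbb R^3)$ for $\|\nabla\cdot\|_{L^2}$, regarded as a space of $L^6$ functions) is the stray-field potential of $m$, that is, the solution of $$\int_{\mathbb R^3}\nabla_\eta U\cdot\nabla_\eta\zeta\,dX=\frac1\eta\int_{\Sigma_\eta}m\cdot\nabla_\eta\zeta\,dX\qquad\text{for all }\zeta\in C_c^\infty(\mathbb R^3).$$ For $m\in\mathcal M_0$ let $E_0(m)=\int_\Sigma e_0(m)\,dX$ with $e_0(m)=|\partial_1m|^2+\Phi(m)-2\gamma\,e_1\cdot\partial_1m\wedge m$. **Theorem ($\Gamma$-convergence).** The energies are well defined: for all sufficiently small $\eta>0$ and all $m\in\mathcal M_\eta$, $e_\eta(m)\in L^1(\Sigma)$ and the potential $U$ exists and is unique; and $e_0(m)\in L^1(\Sigma)$ for all $m\in\mathcal M_0$. Moreover, $E_\eta$ $\Gamma$-converges to $E_0$ as $\eta\to0$ in the weak $\mathcal H^1(\Sigma)$ topology, in the following sense. 1. *Compactness.* If $\eta_k\to0^+$ and $m_k\in\mathcal M_{\eta_k}$ satisfy $\limsup_kE_{\eta_k}(m_k)<\infty$,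 then a subsequence of $(m_k)$ converges weakly in $\mathcal H^1(\Sigma)$ to some $m_0\in\mathcal M_0$. 2. *Lower bound.* If $\eta_k\to0^+$, $m_k\in\mathcal M_{\eta_k}$, $m_0\in\mathcal M_0$ and $m_k\rightharpoonup m_0$ weakly in $\mathcal H^1(\Sigma)$, then $\liminf_kE_{\eta_k}(m_k)\ge E_0(m_0)$. 3. *Upper bound.* For every $m_0\in\mathcal M_0$ there is a family $m_\eta\in\mathcal M_\eta$ $(\eta>0)$ with $\|m_\eta-m_0\|_{\mathcal H^1(\Sigma)}\to0$ and $E_\eta(m_\eta)\to E_0(m_0)$ as $\eta\to0$. Finally, the stray-field energy vanishes in the limit: $\sup_{m\in\mathcal M_\eta}S_\eta(m)\to0$ as $\eta\to0$. -/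

import Mathlib

open Set Filter Topology MeasureTheory
open scoped ENNReal ContDiff Matrix

noncomputable section

namespace Nanowire

/-- Euclidean three-space. The coordinates `x 0`, `x 1`, `x 2` are the usual first, second and third
coordinates; `e₁` is the direction of the wire. -/
abbrev E3 : Type := EuclideanSpace ℝ (Fin 3)

/-- Classical partial derivative in the `i`-th coordinate direction. -/
def partialD (i : Fin 3) (φ : E3 → ℝ) (x : E3) : ℝ :=
  fderiv ℝ φ x (EuclideanSpace.single i 1)

/-- `φ ∈ C_c^∞(Ω)`. -/
def IsTest (Ω : Set E3) (φ : E3 → ℝ) : Prop :=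
  ContDiff ℝ ∞ φ ∧ HasCompactSupport φ ∧ tsupport φ ⊆ Ω

/-- `v` is the weak `i`-th partial derivative of `u` in the open set `Ω`. -/
def HasWeakPartial (Ω : Set E3) (i : Fin 3) (u v : E3 → ℝ) : Prop :=
  LocallyIntegrableOn u Ω ∧ LocallyIntegrableOn v Ω ∧
    ∀ φ : E3 → ℝ, IsTest Ω φ →
      ∫ x in Ω, u x * partialD i φ x = - ∫ x in Ω, v x * φ x

open Classical in
/-- The weak partial derivative (determined a.e. in `Ω`), and `0` if there is none. -/
def weakPartial (Ω : Set E3) (i : Fin 3) (u : E3 → ℝ) : E3 → ℝ :=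
  if h : ∃ v, HasWeakPartial Ω i u v then h.choose else 0

/-- The infinite cylinder `Σ = ℝ × B₁`, with `B₁` the open unit disk. -/
def cyl : Set E3 := {x | x 1 ^ 2 + x 2 ^ 2 < 1}

/-- The finite cylinder `(-a, a) × B₁`. -/
def cylFin (a : ℝ) : Set E3 := {x | x ∈ cyl ∧ |x 0| < a}

/-- The weak derivative `∂ᵢ m` of a map `m : Σ → ℝ³`, taken componentwise. -/
def dm (i : Fin 3) (m : E3 → E3) (x : E3) : Fin 3 → ℝ :=
  fun j => weakPartial cyl i (fun y => m y j) x

/-- Weak differentiability of a map `Σ → ℝ³`. -/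
def WeaklyDiff (m : E3 → E3) : Prop :=
  ∀ i j : Fin 3, ∃ v, HasWeakPartial cyl i (fun x => m x j) v

/-- The seminorm `‖∇m‖_{L²(Σ)} + ‖m'‖_{L²(Σ)}` of a weakly differentiable map, where
`m'` stands for the last two components; it may be infinite. -/
def hSeminorm (m : E3 → E3) : ℝ≥0∞ :=
  (∫⁻ x in cyl, ENNReal.ofReal (∑ i, ∑ j, dm i m x j ^ 2)) ^ (1 / 2 : ℝ) +
    (∫⁻ x in cyl, ENNReal.ofReal (m x 1 ^ 2 + m x 2 ^ 2)) ^ (1 / 2 : ℝ)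

/-- Maps `m : Σ → 𝕊²` (defined a.e.) with finite seminorm. -/
def FiniteMaps : Set (E3 → E3) :=
  {m | (∀ᵐ x ∂volume.restrict cyl, ‖m x‖ = 1) ∧ WeaklyDiff m ∧ hSeminorm m < ⊤}

/-- Weak convergence: `∇mₖ ⇀ ∇m` and `mₖ' ⇀ m'` weakly in `L²(Σ)`. -/
def WeakConv (m : ℕ → E3 → E3) (m₀ : E3 → E3) : Prop :=
  ∀ g : E3 → ℝ, MemLp g 2 (volume.restrict cyl) →
    (∀ i j : Fin 3, Tendsto (fun k => ∫ x in cyl, dm i (m k) x j * g x) atTop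
      (𝓝 (∫ x in cyl, dm i m₀ x j * g x))) ∧
    (∀ j : Fin 3, j ≠ 0 → Tendsto (fun k => ∫ x in cyl, m k x j * g x) atTop
      (𝓝 (∫ x in cyl, m₀ x j * g x)))

/-- The physical parameters: radius `R` and half-length `L` of the wire, exchange length `d`,
quality factor `Q`, and the tensor `D = (D₁, D₂, D₃)`, where `D k j` is the `j`-th component
of the `k`-th vector. -/
structure WireParams where
  R : ℝ
  L : ℝ
  d : ℝ
  Q : ℝ
  D : Fin 3 → Fin 3 → ℝ

/-- The length scale `ρ = d / √Q`. -/
def WireParams.rho (p : WireParams) : ℝ := p.d / √p.Q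

/-- The small parameter `η = R / ρ`. -/
def WireParams.eta (p : WireParams) : ℝ := p.R / p.rho

/-- The rescaled half-length `L / ρ`. -/
def WireParams.len (p : WireParams) : ℝ := p.L / p.rho

/-- The weights of the anisotropic gradient `(∂₁, η⁻¹∂₂, η⁻¹∂₃)`. -/
def WireParams.sc (p : WireParams) (i : Fin 3) : ℝ := if i = 0 then 1 else 1 / p.eta

/-- The asymptotic regime. All parameters are functions of `η = R / ρ`, which tends to `0` through
positive values. -/
structure Regime (γ : ℝ) (p : ℝ → WireParams) : Prop where
  pos : ∀ᶠ η in 𝓝[>] 0, 0 < (p η).R ∧ 0 < (p η).L ∧ 0 < (p η).d ∧ 0 < (p η).Q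
  eta_eq : ∀ᶠ η in 𝓝[>] 0, (p η).eta = η
  rho_L : Tendsto (fun η => (p η).rho / (p η).L) (𝓝[>] 0) (𝓝 0)
  rhoL_d : Tendsto (fun η => (p η).rho * (p η).L / (p η).d ^ 2) (𝓝[>] 0) (𝓝 0)
  D_11 : Tendsto (fun η => (p η).rho / (p η).d ^ 2 * (p η).D 0 0) (𝓝[>] 0) (𝓝 (-2 * γ))
  D_mixed : Tendsto (fun η => (p η).rho / (p η).d ^ 2 *
    (|(p η).D 0 1| + |(p η).D 0 2| + |(p η).D 1 0| + |(p η).D 2 0|)) (𝓝[>] 0) (𝓝 0)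
  D_cross : Tendsto (fun η => √((p η).rho * (p η).L) / (p η).d ^ 2 *
    (|(p η).D 1 1| + |(p η).D 1 2| + |(p η).D 2 1| + |(p η).D 2 2|)) (𝓝[>] 0) (𝓝 0)

/-- The set `𝓜_η`: finite-seminorm maps into the sphere with `m' = 0` where `|x₁| ≥ L / ρ`. -/
def Adm (p : WireParams) : Set (E3 → E3) :=
  {m | m ∈ FiniteMaps ∧
    ∀ᵐ x ∂volume.restrict cyl, p.len ≤ |x 0| → m x 1 = 0 ∧ m x 2 = 0}

/-- The set `𝓜₀`: finite-seminorm maps into the sphere depending only on the first variable. -/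
def AdmLimit : Set (E3 → E3) :=
  {m | m ∈ FiniteMaps ∧ ∃ f : ℝ → E3, ∀ᵐ x ∂volume.restrict cyl, m x = f (x 0)}

/-- The homogeneous Sobolev space `Ḣ¹(ℝ³)`: the completion of `C_c^∞(ℝ³)` in the norm
`‖∇ζ‖_{L²}`, which by the Sobolev inequality is a space of `L⁶` functions that have a weak
gradient in `L²`. -/
def MemHomSobolev (U : E3 → ℝ) : Prop :=
  MemLp U 6 volume ∧
  ∃ ζ : ℕ → E3 → ℝ, (∀ n, IsTest univ (ζ n)) ∧
    Tendsto (fun n => eLpNorm (ζ n - U) 6 volume) atTop (𝓝 0) ∧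
    ∀ i : Fin 3, ∃ v : E3 → ℝ, HasWeakPartial univ i U v ∧ MemLp v 2 volume ∧
      Tendsto (fun n => eLpNorm (partialD i (ζ n) - v) 2 volume) atTop (𝓝 0)

/-- `U ∈ Ḣ¹(ℝ³)` is the stray-field potential of `m`, i.e. it solves
`∂₁₁ U + η⁻² Δ' U = η⁻¹ (∂₁, η⁻¹∇')·(m 1_{Σ_η})` in `ℝ³`, tested against `C_c^∞(ℝ³)`. -/
def IsStrayPotential (p : WireParams) (m : E3 → E3) (U : E3 → ℝ) : Prop :=
  MemHomSobolev U ∧ ∀ ζ : E3 → ℝ, IsTest univ ζ →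
    ∫ x, ∑ i, (p.sc i * weakPartial univ i U x) * (p.sc i * partialD i ζ x) =
      1 / p.eta * ∫ x in cylFin p.len, ∑ i, m x i * (p.sc i * partialD i ζ x)

open Classical in
/-- The stray-field potential of `m`. -/
def strayPotential (p : WireParams) (m : E3 → E3) : E3 → ℝ :=
  if h : ∃ U, IsStrayPotential p m U then h.choose else 0

/-- The stray-field energy `(R²/d²) ∫_{ℝ³} |∂₁U|² + |η⁻¹∇'U|² dX`. -/
def strayEnergy (p : WireParams) (m : E3 → E3) : ℝ :=
  p.R ^ 2 / p.d ^ 2 *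
    ∫ x, ∑ i, (p.sc i * weakPartial univ i (strayPotential p m) x) ^ 2

/-- The local energy density of the rescaled three-dimensional energy: exchange, anisotropy
`Φ(m) = m₂² + m₃²`, and DMI. -/
def density (p : WireParams) (m : E3 → E3) (x : E3) : ℝ :=
  (∑ i, ∑ j, (p.sc i * dm i m x j) ^ 2) + (m x 1 ^ 2 + m x 2 ^ 2) +
    p.rho / p.d ^ 2 * ∑ k, p.D k ⬝ᵥ ((p.sc k • dm k m x) ⨯₃ (fun j => m x j))

/-- The rescaled energy `E_η`. -/
def energy (p : WireParams) (m : E3 → E3) : ℝ :=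
  (∫ x in cyl, density p m x) + strayEnergy p m

/-- The density `|∂₁m|² + Φ(m) - 2γ e₁·(∂₁m ∧ m)` of the limit energy. -/
def densityLimit (γ : ℝ) (m : E3 → E3) (x : E3) : ℝ :=
  (∑ j, dm 0 m x j ^ 2) + (m x 1 ^ 2 + m x 2 ^ 2) -
    2 * γ * (![1, 0, 0] ⬝ᵥ (dm 0 m x ⨯₃ (fun j => m x j)))

/-- The limit energy `E₀`. -/
def energyLimit (γ : ℝ) (m : E3 → E3) : ℝ := ∫ x in cyl, densityLimit γ m x

end Nanowire

end

open Nanowire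

/-! The energy is a quadratic form plus a relatively small perturbation. Write N for `axialEnergy`,
G for `transversalEnergy` and X for `chirality`. Then `abs_energy_sub_le` shows that the full energy
differs from N + G - 2γX by at most δ(1 + N + G), where δ = `energyError` depends on the parameters
only and tends to 0. The scaling assumptions of the regime are exactly what makes each contribution
to δ vanish: the stray field gradient is an orthogonal projection of its source, so its energy is at
most 2·area·ρL/d² (`strayEnergy_le`); the chirality terms that involve only m' are controlled by
Young's inequality; those with an axial derivative and m₁, which is bounded but not square
integrable, are integrated by parts along the axis, where m' = 0 beyond the ends of the wire
(`abs_crossEnergy_zero_le`); the remaining ones are estimated on the finite cylinder, whose volume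
is proportional to L/ρ, at the price of a factor √(L/ρ) (`abs_crossEnergy_le`).

For |γ| < 1 the form q = N - 2γX satisfies (1 - |γ|) N ≤ q, so the error can be absorbed
(`energy_lower_bound`). Since q depends only on ∂₁m and m' and is positive semidefinite, it is
weakly lower semicontinuous. This is expressed by 2B(m, m₀) - q(m₀) ≤ q(m) with B the polarisation
of q, and gives the lower bound.

For compactness, bounded energy bounds N and G, and the factor 1/η in G forces the cross-sectional
derivatives to 0 in L². Weak limits of the derivatives and of m then define a map of x₁ alone. That
it takes values in the sphere needs local strong compactness, which is derived by hand:
mollifications of weakly converging functions converge pointwise, and the mollification error in L¹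
is at most the radius times the L¹ norm of the gradient (`setIntegral_abs_sub_moll_le`,
`sum_sq_eq_one_of_tendsto_moll`).

For the upper bound, a limit map is an absolutely continuous profile with m' in H¹(ℝ), so m' tends
to 0 at ±∞. Cutting off m' and renormalising to unit length gives profiles that are admissible for
the finite wire, coincide with the given one away from the ends, and have one common L² majorant
(`exists_truncated_profile`). Their cross-sectional energy is 0, so dominated convergence and the
error estimate finish the argument. -/

noncomputable section

namespace Nanowire

/-! ### Weak partial derivatives -/

theorem IsTest.integrable_mul {Ω : Set E3} {φ u : E3 → ℝ} (hφ : Continuous φ)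
    (hc : HasCompactSupport φ) (hs : tsupport φ ⊆ Ω) (hu : LocallyIntegrableOn u Ω) :
    Integrable (fun x => u x * φ x) := by
  have h1 : IntegrableOn (fun x => u x * φ x) (tsupport φ) :=
    (hu.integrableOn_compact_subset hs hc).mul_continuousOn hφ.continuousOn hc
  rw [← integrableOn_iff_integrable_of_support_subset (s := tsupport φ)]
  · exact h1
  · intro x hx
    by_contra h
    exact hx (by simp [image_eq_zero_of_notMem_tsupport h])

theorem setIntegral_mul_eq_integral {Ω : Set E3} {φ : E3 → ℝ} (u : E3 → ℝ)
    (hs : tsupport φ ⊆ Ω) : ∫ x in Ω, u x * φ x = ∫ x, u x * φ x := by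
  apply setIntegral_eq_integral_of_forall_compl_eq_zero
  intro x hx
  have : x ∉ tsupport φ := fun h => hx (hs h)
  simp [image_eq_zero_of_notMem_tsupport this]

theorem tsupport_partialD_subset (i : Fin 3) (φ : E3 → ℝ) : tsupport (partialD i φ) ⊆ tsupport φ :=
  tsupport_fderiv_apply_subset ℝ _

theorem IsTest.continuous_partialD {Ω : Set E3} {φ : E3 → ℝ} (h : IsTest Ω φ) (i : Fin 3) :
    Continuous (partialD i φ) :=
  (h.1.continuous_fderiv (by simp)).clm_apply continuous_const

theorem IsTest.hasCompactSupport_partialD {Ω : Set E3} {φ : E3 → ℝ} (h : IsTest Ω φ) (i : Fin 3) :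
    HasCompactSupport (partialD i φ) :=
  h.2.1.fderiv_apply ℝ _

theorem IsTest.isTest_partialD {Ω : Set E3} {φ : E3 → ℝ} (h : IsTest Ω φ) (i : Fin 3) :
    IsTest Ω (partialD i φ) :=
  ⟨(h.1.fderiv_right (m := ∞) (by simp)).clm_apply contDiff_const, h.hasCompactSupport_partialD i,
    (tsupport_partialD_subset i φ).trans h.2.2⟩

theorem IsTest.mono {Ω Ω' : Set E3} {φ : E3 → ℝ} (h : IsTest Ω φ) (hs : Ω ⊆ Ω') : IsTest Ω' φ :=
  ⟨h.1, h.2.1, h.2.2.trans hs⟩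

theorem IsTest.mul_left {Ω : Set E3} {φ g : E3 → ℝ} (h : IsTest Ω φ) (hg : ContDiff ℝ ∞ g) :
    IsTest Ω (fun x => g x * φ x) :=
  ⟨hg.mul h.1, h.2.1.mul_left, (closure_mono (Function.support_mul_subset_right _ _)).trans h.2.2⟩

theorem HasWeakPartial.unique {Ω : Set E3} (hΩ : IsOpen Ω) {i : Fin 3} {u v w : E3 → ℝ}
    (hv : HasWeakPartial Ω i u v) (hw : HasWeakPartial Ω i u w) :
    v =ᵐ[volume.restrict Ω] w := by
  have h := hΩ.ae_eq_zero_of_integral_contDiff_smul_eq_zero (μ := volume) (hv.2.1.sub hw.2.1) ?_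
  · rw [EventuallyEq, ae_restrict_iff' hΩ.measurableSet]
    filter_upwards [h] with x hx hxΩ
    have := hx hxΩ
    simp only [Pi.sub_apply] at this
    linarith
  · intro g hg hgc hgs
    have e1 := hv.2.2 g ⟨hg, hgc, hgs⟩
    have e2 := hw.2.2 g ⟨hg, hgc, hgs⟩
    rw [setIntegral_mul_eq_integral v hgs] at e1
    rw [setIntegral_mul_eq_integral w hgs] at e2
    have i1 := IsTest.integrable_mul hg.continuous hgc hgs hv.2.1
    have i2 := IsTest.integrable_mul hg.continuous hgc hgs hw.2.1
    have : ∀ x, g x • (v - w) x = v x * g x - w x * g x := by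
      intro x; simp only [Pi.sub_apply, smul_eq_mul]; ring
    simp_rw [this]
    rw [integral_sub i1 i2]
    linarith

theorem hasWeakPartial_weakPartial {Ω : Set E3} {i : Fin 3} {u : E3 → ℝ}
    (h : ∃ v, HasWeakPartial Ω i u v) : HasWeakPartial Ω i u (weakPartial Ω i u) := by
  rw [weakPartial, dif_pos h]
  exact h.choose_spec

/-- `weakPartial` is an arbitrary choice, so it is accessible only through uniqueness. Every
computation of `dm` for an explicit map goes through this statement. -/
theorem HasWeakPartial.weakPartial_ae_eq {Ω : Set E3} (hΩ : IsOpen Ω) {i : Fin 3} {u v : E3 → ℝ}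
    (h : HasWeakPartial Ω i u v) : weakPartial Ω i u =ᵐ[volume.restrict Ω] v :=
  (hasWeakPartial_weakPartial ⟨v, h⟩).unique hΩ h

theorem locallyIntegrableOn_congr_ae {Ω : Set E3} {u v : E3 → ℝ}
    (hu : LocallyIntegrableOn u Ω) (h : u =ᵐ[volume.restrict Ω] v) : LocallyIntegrableOn v Ω := by
  intro x hx
  obtain ⟨t, ht, hti⟩ := hu x hx
  have : t ∩ Ω ∈ 𝓝[Ω] x := inter_mem ht self_mem_nhdsWithin
  refine ⟨t ∩ Ω, this, (hti.mono_set inter_subset_left).congr ?_⟩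
  exact ae_restrict_of_ae_restrict_of_subset inter_subset_right h

theorem HasWeakPartial.congr {Ω : Set E3} {i : Fin 3} {u u' v v' : E3 → ℝ}
    (h : HasWeakPartial Ω i u v) (hu : u =ᵐ[volume.restrict Ω] u')
    (hv : v =ᵐ[volume.restrict Ω] v') : HasWeakPartial Ω i u' v' := by
  refine ⟨locallyIntegrableOn_congr_ae h.1 hu,
    locallyIntegrableOn_congr_ae h.2.1 hv, fun φ hφ => ?_⟩
  have e := h.2.2 φ hφ
  have e1 : ∫ x in Ω, u x * partialD i φ x = ∫ x in Ω, u' x * partialD i φ x :=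
    integral_congr_ae (hu.mono fun x hx => by simp only [hx])
  have e2 : ∫ x in Ω, v x * φ x = ∫ x in Ω, v' x * φ x :=
    integral_congr_ae (hv.mono fun x hx => by simp only [hx])
  rw [← e1, ← e2, e]

theorem weakPartial_congr {Ω : Set E3} (hΩ : IsOpen Ω) {i : Fin 3} {u u' : E3 → ℝ}
    (hu : u =ᵐ[volume.restrict Ω] u') (h : ∃ v, HasWeakPartial Ω i u v) :
    weakPartial Ω i u =ᵐ[volume.restrict Ω] weakPartial Ω i u' := by
  obtain ⟨v, hv⟩ := h
  exact (hv.weakPartial_ae_eq hΩ).trans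
    ((hv.congr hu EventuallyEq.rfl).weakPartial_ae_eq hΩ).symm

theorem HasWeakPartial.add {Ω : Set E3} {i : Fin 3} {u u' v v' : E3 → ℝ}
    (h : HasWeakPartial Ω i u v) (h' : HasWeakPartial Ω i u' v') :
    HasWeakPartial Ω i (fun x => u x + u' x) (fun x => v x + v' x) := by
  refine ⟨h.1.add h'.1, h.2.1.add h'.2.1, fun φ hφ => ?_⟩
  have e1 := h.2.2 φ hφ
  have e2 := h'.2.2 φ hφ
  have hs := (tsupport_partialD_subset i φ).trans hφ.2.2
  have a1 := IsTest.integrable_mul (hφ.continuous_partialD i) (hφ.hasCompactSupport_partialD i) hs h.1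
  have a2 := IsTest.integrable_mul (hφ.continuous_partialD i) (hφ.hasCompactSupport_partialD i) hs h'.1
  have b1 := IsTest.integrable_mul hφ.1.continuous hφ.2.1 hφ.2.2 h.2.1
  have b2 := IsTest.integrable_mul hφ.1.continuous hφ.2.1 hφ.2.2 h'.2.1
  simp only [add_mul]
  rw [integral_add a1.integrableOn a2.integrableOn, integral_add b1.integrableOn b2.integrableOn,
    e1, e2]
  ring

theorem HasWeakPartial.const_mul {Ω : Set E3} {i : Fin 3} {u v : E3 → ℝ}
    (h : HasWeakPartial Ω i u v) (c : ℝ) :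
    HasWeakPartial Ω i (fun x => c * u x) (fun x => c * v x) := by
  refine ⟨h.1.smul c, h.2.1.smul c, fun φ hφ => ?_⟩
  have e1 := h.2.2 φ hφ
  simp only [mul_assoc, integral_const_mul, e1]
  ring

theorem HasWeakPartial.sub {Ω : Set E3} {i : Fin 3} {u u' v v' : E3 → ℝ}
    (h : HasWeakPartial Ω i u v) (h' : HasWeakPartial Ω i u' v') :
    HasWeakPartial Ω i (fun x => u x - u' x) (fun x => v x - v' x) := by
  have := h.add (h'.const_mul (-1))
  simpa only [neg_mul, one_mul, ← sub_eq_add_neg] using this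

theorem HasWeakPartial.mono {Ω Ω' : Set E3} (hs : Ω' ⊆ Ω) {i : Fin 3}
    {u v : E3 → ℝ} (h : HasWeakPartial Ω i u v) : HasWeakPartial Ω' i u v := by
  refine ⟨h.1.mono_set hs, h.2.1.mono_set hs, fun φ hφ => ?_⟩
  have e := h.2.2 φ (hφ.mono hs)
  rw [setIntegral_mul_eq_integral _ hφ.2.2,
    setIntegral_mul_eq_integral _ ((tsupport_partialD_subset i φ).trans hφ.2.2)]
  rwa [setIntegral_mul_eq_integral _ (hφ.2.2.trans hs),
    setIntegral_mul_eq_integral _ ((tsupport_partialD_subset i φ).trans (hφ.2.2.trans hs))] at e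

theorem partialD_mul {f g : E3 → ℝ} {x : E3} (i : Fin 3) (hf : DifferentiableAt ℝ f x)
    (hg : DifferentiableAt ℝ g x) :
    partialD i (fun x => f x * g x) x = f x * partialD i g x + partialD i f x * g x := by
  simp only [partialD]
  rw [fderiv_fun_mul hf hg]
  simp [mul_comm]

theorem hasWeakPartial_of_contDiff (Ω : Set E3) (i : Fin 3) {w : E3 → ℝ} (hw : ContDiff ℝ 1 w) :
    HasWeakPartial Ω i w (partialD i w) := by
  have hc : Continuous (partialD i w) :=
    (hw.continuous_fderiv (by simp)).clm_apply continuous_const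
  refine ⟨hw.continuous.locallyIntegrable.locallyIntegrableOn _,
    hc.locallyIntegrable.locallyIntegrableOn _, fun φ hφ => ?_⟩
  rw [setIntegral_mul_eq_integral _ hφ.2.2,
    setIntegral_mul_eq_integral _ ((tsupport_partialD_subset i φ).trans hφ.2.2)]
  refine integral_mul_fderiv_eq_neg_fderiv_mul_of_integrable ?_ ?_ ?_ ?_ ?_
  · exact IsTest.integrable_mul hφ.1.continuous hφ.2.1 (subset_univ _)
      (hc.locallyIntegrable.locallyIntegrableOn _)
  · exact IsTest.integrable_mul (hφ.continuous_partialD i) (hφ.hasCompactSupport_partialD i)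
      (subset_univ _) (hw.continuous.locallyIntegrable.locallyIntegrableOn _)
  · exact IsTest.integrable_mul hφ.1.continuous hφ.2.1 (subset_univ _)
      (hw.continuous.locallyIntegrable.locallyIntegrableOn _)
  · exact fun x _ => hw.differentiable (by simp) x
  · exact fun x _ => hφ.1.differentiable (by simp) x

theorem hasWeakPartial_const (Ω : Set E3) (i : Fin 3) (c : ℝ) :
    HasWeakPartial Ω i (fun _ => c) (fun _ => 0) := by
  have := hasWeakPartial_of_contDiff Ω i (w := fun _ => c) contDiff_const
  have e : partialD i (fun _ : E3 => c) = fun _ => 0 := by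
    funext x; simp [partialD]
  rwa [e] at this

/-! ### Mollification -/

/-- A sequence of bump functions whose supports shrink to the origin. -/
def bumpSeq (n : ℕ) : ContDiffBump (0 : E3) where
  rIn := 1 / (2 * (n + 1))
  rOut := 1 / (n + 1)
  rIn_pos := by positivity
  rIn_lt_rOut := by
    apply one_div_lt_one_div_of_lt <;> have : (0 : ℝ) ≤ n := n.cast_nonneg <;> linarith

/-- The normalised smoothing kernel. -/
def kern (n : ℕ) : E3 → ℝ := (bumpSeq n).normed volume

/-- The radius of the support of `kern n`. -/
def rad (n : ℕ) : ℝ := 1 / (n + 1)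

theorem rad_pos (n : ℕ) : 0 < rad n := by unfold rad; positivity

theorem tendsto_rad : Tendsto rad atTop (𝓝 0) := tendsto_one_div_add_atTop_nhds_zero_nat

theorem contDiff_kern (n : ℕ) : ContDiff ℝ ∞ (kern n) := (bumpSeq n).contDiff_normed

theorem continuous_kern (n : ℕ) : Continuous (kern n) := (contDiff_kern n).continuous

theorem kern_nonneg (n : ℕ) (x : E3) : 0 ≤ kern n x := (bumpSeq n).nonneg_normed x

theorem kern_neg (n : ℕ) (x : E3) : kern n (-x) = kern n x := (bumpSeq n).normed_neg x

theorem integral_kern (n : ℕ) : ∫ x, kern n x = 1 := (bumpSeq n).integral_normed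

theorem tsupport_kern (n : ℕ) : tsupport (kern n) = Metric.closedBall 0 (rad n) :=
  (bumpSeq n).tsupport_normed_eq

theorem hasCompactSupport_kern (n : ℕ) : HasCompactSupport (kern n) :=
  (bumpSeq n).hasCompactSupport_normed

theorem integrable_kern (n : ℕ) : Integrable (kern n) := (bumpSeq n).integrable_normed

theorem kern_eq_zero {n : ℕ} {x : E3} (h : rad n < ‖x‖) : kern n x = 0 := by
  apply image_eq_zero_of_notMem_tsupport
  rw [tsupport_kern]
  simpa using h

/-- The mollification of a locally integrable function. -/
def moll (n : ℕ) (u : E3 → ℝ) (x : E3) : ℝ := ∫ y, u y * kern n (x - y)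

theorem moll_eq_convolution (n : ℕ) (u : E3 → ℝ) :
    moll n u = convolution u (kern n) (ContinuousLinearMap.mul ℝ ℝ) volume := by
  funext x; simp [moll, convolution_def]

theorem moll_eq_integral_sub (n : ℕ) (u : E3 → ℝ) (x : E3) :
    moll n u x = ∫ y, kern n y * u (x - y) := by
  rw [moll, ← integral_sub_left_eq_self _ volume x]
  congr 1; funext y
  simp [mul_comm]

theorem contDiff_moll (n : ℕ) {u : E3 → ℝ} (hu : LocallyIntegrable u) :
    ContDiff ℝ ∞ (moll n u) := by
  rw [moll_eq_convolution]
  exact (hasCompactSupport_kern n).contDiff_convolution_right _ hu (contDiff_kern n)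

theorem ae_tendsto_moll {u : E3 → ℝ} (hu : LocallyIntegrable u) :
    ∀ᵐ x, Tendsto (fun n => moll n u x) atTop (𝓝 (u x)) := by
  -- The ratio `rOut / rIn` of the bumps is exactly 2 for all `n`, so the kernels are comparable to
  -- averages over balls and the Lebesgue differentiation theorem applies.
  have h := ContDiffBump.ae_convolution_tendsto_right_of_locallyIntegrable (μ := volume)
    (φ := bumpSeq) (l := atTop) (K := 2) tendsto_rad ?_ hu
  · filter_upwards [h] with x hx
    refine hx.congr fun n => ?_
    rw [moll_eq_integral_sub]
    simp [convolution_def, kern]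
  · refine Eventually.of_forall fun n => ?_
    simp only [bumpSeq]
    apply le_of_eq; field_simp

theorem partialD_moll (n : ℕ) (i : Fin 3) {u : E3 → ℝ} (hu : LocallyIntegrable u) (x : E3) :
    partialD i (moll n u) x = ∫ y, u y * partialD i (kern n) (x - y) := by
  have hk : ContDiff ℝ 1 (kern n) := (contDiff_kern n).of_le (by simp)
  have h := (hasCompactSupport_kern n).hasFDerivAt_convolution_right
    (ContinuousLinearMap.mul ℝ ℝ) (μ := volume) hu hk x
  rw [partialD, moll_eq_convolution, h.fderiv,
    convolution_precompR_apply _ hu ((hasCompactSupport_kern n).fderiv ℝ)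
      (hk.continuous_fderiv one_ne_zero)]
  simp [convolution_def, partialD]

theorem isTest_kern_sub (n : ℕ) (x : E3) {Ω : Set E3} (h : Metric.closedBall x (rad n) ⊆ Ω) :
    IsTest Ω (fun y => kern n (x - y)) := by
  have hs : tsupport (fun y => kern n (x - y)) ⊆ Metric.closedBall x (rad n) := by
    apply closure_minimal _ Metric.isClosed_closedBall
    intro y hy
    by_contra hc
    apply hy
    apply kern_eq_zero
    rw [Metric.mem_closedBall, dist_comm, dist_eq_norm] at hc
    exact not_le.mp hc
  exact ⟨(contDiff_kern n).comp (contDiff_const.sub contDiff_id),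
    HasCompactSupport.of_support_subset_isCompact (isCompact_closedBall x (rad n))
      ((subset_tsupport _).trans hs), hs.trans h⟩

theorem partialD_kern_sub (n : ℕ) (i : Fin 3) (x y : E3) :
    partialD i (fun y => kern n (x - y)) y = - partialD i (kern n) (x - y) := by
  have h1 : HasFDerivAt (kern n) (fderiv ℝ (kern n) (x - y)) (x - y) :=
    ((contDiff_kern n).differentiable (by simp) _).hasFDerivAt
  have h2 : HasFDerivAt (fun y : E3 => x - y) (-ContinuousLinearMap.id ℝ E3) y :=
    (hasFDerivAt_id y).const_sub x
  have h3 := (h1.comp y h2).fderiv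
  simp only [partialD]
  rw [show (fun y => kern n (x - y)) = kern n ∘ (fun y : E3 => x - y) from rfl, h3]
  simp

/-- The translated kernel y ↦ `kern n (x - y)` is a test function in Ω as soon as the closed ball
lies in Ω. Its inner derivative contributes the sign that cancels the one in the definition of the
weak derivative, and the extension by zero is never seen. -/
theorem partialD_moll_of_hasWeakPartial {Ω : Set E3} (hΩ : IsOpen Ω) {i : Fin 3} {u v : E3 → ℝ}
    (h : HasWeakPartial Ω i u v) (hu : LocallyIntegrable (Ω.indicator u))
    {n : ℕ} {x : E3} (hx : Metric.closedBall x (rad n) ⊆ Ω) :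
    partialD i (moll n (Ω.indicator u)) x = moll n (Ω.indicator v) x := by
  rw [partialD_moll n i hu, moll]
  have e := h.2.2 _ (isTest_kern_sub n x hx)
  have a : ∀ (w k : E3 → ℝ), (∫ y, Ω.indicator w y * k y) = ∫ y in Ω, w y * k y := by
    intro w k
    rw [← integral_indicator hΩ.measurableSet]
    congr 1; funext y
    by_cases hy : y ∈ Ω <;> simp [hy]
  rw [a u (fun y => partialD i (kern n) (x - y)), a v (fun y => kern n (x - y))]
  simp only [partialD_kern_sub, mul_neg, integral_neg] at e
  linarith

theorem abs_moll_le (n : ℕ) {u : E3 → ℝ} {C : ℝ} (hC : ∀ᵐ x, |u x| ≤ C) (x : E3) :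
    |moll n u x| ≤ C := by
  have hk : Integrable (fun y => C * kern n (x - y)) :=
    ((integrable_kern n).comp_sub_left x).const_mul C
  calc |moll n u x| ≤ ∫ y, C * kern n (x - y) := by
        rw [moll, ← Real.norm_eq_abs]
        refine norm_integral_le_of_norm_le hk ?_
        filter_upwards [hC] with y hy
        rw [norm_mul, Real.norm_eq_abs, Real.norm_eq_abs, abs_of_nonneg (kern_nonneg _ _)]
        exact mul_le_mul_of_nonneg_right hy (kern_nonneg _ _)
    _ = C := by
        rw [integral_const_mul, integral_sub_left_eq_self (kern n) volume x, integral_kern, mul_one]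

/-! ### The product rule for bounded functions -/

/-- Mollification is self-adjoint, by Fubini and the evenness of the kernel. It allows the mollifier
to be moved onto whichever factor is bounded. -/
theorem integral_moll_mul (n : ℕ) {v w : E3 → ℝ} (hv : Integrable v) (hw : Integrable w) :
    ∫ x, moll n v x * w x = ∫ x, v x * moll n w x := by
  have hint : Integrable (fun z : E3 × E3 => v z.2 * kern n (z.1 - z.2) * w z.1)
      (volume.prod volume) := by
    have h1 : Integrable (fun z : E3 × E3 => w z.1 * v z.2) (volume.prod volume) := hw.mul_prod hv
    have hc : Continuous (fun z : E3 × E3 => kern n (z.1 - z.2)) :=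
      (continuous_kern n).comp (continuous_fst.sub continuous_snd)
    obtain ⟨C, hC⟩ := (hasCompactSupport_kern n).exists_bound_of_continuous (continuous_kern n)
    refine (h1.bdd_mul hc.aestronglyMeasurable (c := C)
      (Eventually.of_forall fun z => hC (z.1 - z.2))).congr (Eventually.of_forall fun z => ?_)
    simp only; ring
  calc ∫ x, moll n v x * w x = ∫ x, ∫ y, v y * kern n (x - y) * w x := by
        congr 1; funext x; rw [moll, integral_mul_const]
    _ = ∫ y, ∫ x, v y * kern n (x - y) * w x := integral_integral_swap hint
    _ = ∫ y, v y * moll n w y := by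
        congr 1; funext y
        rw [moll, ← integral_const_mul]
        congr 1; funext x
        rw [← kern_neg n (x - y), neg_sub]; ring

theorem moll_eq_zero_of_support {n : ℕ} {w : E3 → ℝ} {K : Set E3} (hw : ∀ x ∉ K, w x = 0)
    {x : E3} (hx : x ∉ Metric.cthickening (rad n) K) : moll n w x = 0 := by
  rw [moll]
  apply integral_eq_zero_of_ae
  refine Eventually.of_forall fun y => ?_
  by_cases hy : y ∈ K
  · have : kern n (x - y) = 0 := by
      apply kern_eq_zero
      by_contra hc
      apply hx
      apply Metric.mem_cthickening_of_dist_le x y _ _ hy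
      rw [dist_eq_norm]; exact not_lt.mp hc
    simp [this]
  · simp [hw y hy]

/-- The product rule for bounded weakly differentiable functions. -/
theorem HasWeakPartial.mul_of_bounded {Ω : Set E3} (hΩ : IsOpen Ω) {i : Fin 3}
    {u₁ v₁ u₂ v₂ : E3 → ℝ} {C : ℝ}
    (h₁ : HasWeakPartial Ω i u₁ v₁) (h₂ : HasWeakPartial Ω i u₂ v₂)
    (b₁ : ∀ᵐ x ∂volume.restrict Ω, |u₁ x| ≤ C) (b₂ : ∀ᵐ x ∂volume.restrict Ω, |u₂ x| ≤ C) :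
    HasWeakPartial Ω i (fun x => u₁ x * u₂ x) (fun x => u₁ x * v₂ x + v₁ x * u₂ x) := by
  have key : ∀ (a b : E3 → ℝ), LocallyIntegrableOn a Ω → LocallyIntegrableOn b Ω →
      (∀ᵐ x ∂volume.restrict Ω, |a x| ≤ C) → LocallyIntegrableOn (fun x => a x * b x) Ω := by
    intro a b ha hb hC x hx
    obtain ⟨t, ht, hti⟩ := hb x hx
    refine ⟨t ∩ Ω, inter_mem ht self_mem_nhdsWithin, ?_⟩
    exact (hti.mono_set inter_subset_left).bdd_mul (c := C)
      (ha.aestronglyMeasurable.mono_set inter_subset_right)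
      (ae_restrict_of_ae_restrict_of_subset inter_subset_right hC)
  have hl₂ : LocallyIntegrableOn (fun x => v₁ x * u₂ x) Ω := by
    simpa only [mul_comm] using key u₂ v₁ h₂.1 h₁.2.1 b₂
  refine ⟨key u₁ u₂ h₁.1 h₂.1 b₁, (key u₁ v₂ h₁.1 h₂.2.1 b₁).add hl₂, fun φ hφ => ?_⟩
  set K := tsupport φ with hK
  have hKc : IsCompact K := hφ.2.1
  -- Only a neighbourhood of the support of φ matters. On Ω', which has compact closure in Ω, the
  -- functions u₁ and v₁ are integrable, so their extensions by zero can be mollified.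
  obtain ⟨δ, hδ, hδΩ⟩ := hKc.exists_cthickening_subset_open hΩ hφ.2.2
  set Ω' := Metric.thickening δ K with hΩ'
  have hΩ'o : IsOpen Ω' := Metric.isOpen_thickening
  have hsub : Ω' ⊆ Metric.cthickening δ K := Metric.thickening_subset_cthickening δ K
  have hΩ'Ω : Ω' ⊆ Ω := hsub.trans hδΩ
  have hKΩ' : K ⊆ Ω' := Metric.self_subset_thickening hδ K
  have hcc : IsCompact (Metric.cthickening δ K) := hKc.cthickening
  have iu₁ : Integrable (Ω'.indicator u₁) :=
    ((h₁.1.integrableOn_compact_subset hδΩ hcc).mono_set hsub).integrable_indicator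
      hΩ'o.measurableSet
  have iv₁ : Integrable (Ω'.indicator v₁) :=
    ((h₁.2.1.integrableOn_compact_subset hδΩ hcc).mono_set hsub).integrable_indicator
      hΩ'o.measurableSet
  have hC0 : 0 ≤ max C 0 := le_max_right _ _
  have bU : ∀ᵐ x, |Ω'.indicator u₁ x| ≤ max C 0 := by
    have := ae_restrict_of_ae_restrict_of_subset hΩ'Ω b₁
    rw [ae_restrict_iff' hΩ'o.measurableSet] at this
    filter_upwards [this] with x hx
    by_cases h : x ∈ Ω'
    · simpa [h] using Or.inl (hx h)
    · simp [h]
  have hdφ : tsupport (partialD i φ) ⊆ K := tsupport_partialD_subset i φ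
  set g : E3 → ℝ := fun x => u₂ x * φ x with hg
  have ig : Integrable g := IsTest.integrable_mul hφ.1.continuous hφ.2.1 hφ.2.2 h₂.1
  have idg : Integrable (fun x => u₂ x * partialD i φ x) :=
    IsTest.integrable_mul (hφ.continuous_partialD i) (hφ.hasCompactSupport_partialD i)
      (hdφ.trans hφ.2.2) h₂.1
  have ivg : Integrable (fun x => v₂ x * φ x) :=
    IsTest.integrable_mul hφ.1.continuous hφ.2.1 hφ.2.2 h₂.2.1
  set w : ℕ → E3 → ℝ := fun n => moll n (Ω'.indicator u₁) with hw
  have hws : ∀ n, ContDiff ℝ ∞ (w n) := fun n => contDiff_moll n iu₁.locallyIntegrable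
  have hwb : ∀ n x, |w n x| ≤ max C 0 := fun n x => abs_moll_le n bU x
  have hwt : ∀ᵐ x, Tendsto (fun n => w n x) atTop (𝓝 (Ω'.indicator u₁ x)) :=
    ae_tendsto_moll iu₁.locallyIntegrable
  have lim : ∀ f : E3 → ℝ, Integrable f →
      Tendsto (fun n => ∫ x, w n x * f x) atTop (𝓝 (∫ x, Ω'.indicator u₁ x * f x)) := by
    intro f hf
    refine tendsto_integral_of_dominated_convergence (fun x => max C 0 * ‖f x‖)
      (fun n => (hws n).continuous.aestronglyMeasurable.mul hf.1) (hf.norm.const_mul _)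
      (fun n => Eventually.of_forall fun x => ?_) ?_
    · rw [norm_mul]
      exact mul_le_mul_of_nonneg_right (hwb n x) (norm_nonneg _)
    · filter_upwards [hwt] with x hx using hx.mul_const _
  have l1 := lim _ idg
  have l3 := lim _ ivg
  have l2 : Tendsto (fun n => ∫ x, moll n (Ω'.indicator v₁) x * g x) atTop
      (𝓝 (∫ x, Ω'.indicator v₁ x * g x)) := by
    obtain ⟨M, hM⟩ := hφ.2.1.exists_bound_of_continuous hφ.1.continuous
    have gb : ∀ᵐ x, |g x| ≤ max C 0 * M := by
      have := b₂
      rw [ae_restrict_iff' hΩ.measurableSet] at this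
      filter_upwards [this] with x hx
      have hM0 : 0 ≤ M := (norm_nonneg _).trans (hM x)
      by_cases h : x ∈ K
      · rw [hg, abs_mul]
        exact mul_le_mul ((hx (hφ.2.2 h)).trans (le_max_left _ _)) (hM x) (abs_nonneg _) hC0
      · have : φ x = 0 := image_eq_zero_of_notMem_tsupport h
        simp only [hg, this, mul_zero, abs_zero]; positivity
    -- The mollified v₁ has no obvious dominating function, whereas g is bounded. Moving the
    -- mollifier onto g gives the integrable majorant const · |v₁|.
    simp only [integral_moll_mul _ iv₁ ig]
    refine tendsto_integral_of_dominated_convergence (fun x => (max C 0 * M) * ‖Ω'.indicator v₁ x‖)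
      (fun n => iv₁.1.mul (contDiff_moll n ig.locallyIntegrable).continuous.aestronglyMeasurable)
      (iv₁.norm.const_mul _) (fun n => Eventually.of_forall fun x => ?_) ?_
    · rw [norm_mul, mul_comm]
      exact mul_le_mul_of_nonneg_right (abs_moll_le n gb x) (norm_nonneg _)
    · filter_upwards [ae_tendsto_moll ig.locallyIntegrable] with x hx using hx.const_mul _
  -- The weak derivative of u₂ is tested with φ times the mollified u₁, which is smooth with compact
  -- support. The classical product rule then produces the three integrals whose limits were just
  -- found.
  have eqn : ∀ᶠ n in atTop, (∫ x, w n x * (u₂ x * partialD i φ x)) +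
      (∫ x, moll n (Ω'.indicator v₁) x * g x) = - ∫ x, w n x * (v₂ x * φ x) := by
    filter_upwards [tendsto_rad.eventually (gt_mem_nhds hδ)] with n hn
    have hball : ∀ x ∈ K, Metric.closedBall x (rad n) ⊆ Ω' := by
      intro x hx y hy
      exact Metric.mem_thickening_iff.mpr ⟨x, hx, lt_of_le_of_lt hy hn⟩
    have hd : ∀ x ∈ K, partialD i (w n) x = moll n (Ω'.indicator v₁) x := fun x hx =>
      partialD_moll_of_hasWeakPartial hΩ'o (h₁.mono hΩ'Ω) iu₁.locallyIntegrable (hball x hx)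
    have ht : IsTest Ω (fun x => w n x * φ x) := hφ.mul_left (hws n)
    have e := h₂.2.2 _ ht
    rw [setIntegral_mul_eq_integral _ ht.2.2,
      setIntegral_mul_eq_integral _ ((tsupport_partialD_subset i _).trans ht.2.2)] at e
    have e1 : ∀ x, u₂ x * partialD i (fun x => w n x * φ x) x =
        w n x * (u₂ x * partialD i φ x) + moll n (Ω'.indicator v₁) x * g x := by
      intro x
      rw [partialD_mul i ((hws n).differentiable (by simp) x) (hφ.1.differentiable (by simp) x)]
      by_cases hx : x ∈ K
      · rw [hd x hx]; simp only [hg]; ring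
      · have : φ x = 0 := image_eq_zero_of_notMem_tsupport hx
        simp only [hg, this]; ring
    simp only [e1] at e
    have j1 : Integrable (fun x => w n x * (u₂ x * partialD i φ x)) :=
      idg.bdd_mul (hws n).continuous.aestronglyMeasurable (Eventually.of_forall (hwb n))
    have j2 : Integrable (fun x => moll n (Ω'.indicator v₁) x * g x) := by
      have hc : Continuous (moll n (Ω'.indicator v₁)) :=
        (contDiff_moll n iv₁.locallyIntegrable).continuous
      refine (IsTest.integrable_mul (Ω := Ω) (hc.mul hφ.1.continuous) hφ.2.1.mul_left
        ((closure_mono (Function.support_mul_subset_right _ _)).trans hφ.2.2) h₂.1).congr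
        (Eventually.of_forall fun x => ?_)
      simp only [hg, Pi.mul_apply]; ring
    rw [integral_add j1 j2] at e
    rw [e]
    congr 1
    congr 1; funext x; ring
  have hfin := tendsto_nhds_unique_of_eventuallyEq (l1.add l2) l3.neg eqn
  rw [setIntegral_mul_eq_integral _ hφ.2.2, setIntegral_mul_eq_integral _ (hdφ.trans hφ.2.2)]
  have r : ∀ (f k : E3 → ℝ), (∀ x ∉ K, k x = 0) → 
      (fun x => Ω'.indicator f x * k x) = fun x => f x * k x := by
    intro f k hk
    funext x
    by_cases hx : x ∈ K
    · simp [hKΩ' hx]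
    · simp [hk x hx]
  have z1 : ∀ x ∉ K, φ x = 0 := fun x hx => image_eq_zero_of_notMem_tsupport hx
  have z2 : ∀ x ∉ K, partialD i φ x = 0 := fun x hx =>
    image_eq_zero_of_notMem_tsupport fun h => hx (hdφ h)
  rw [r u₁ _ (fun x hx => by simp [z2 x hx]), r u₁ _ (fun x hx => by simp [z1 x hx]),
    r v₁ g (fun x hx => by simp [hg, z1 x hx])] at hfin
  have k1 : Integrable (fun x => u₁ x * (v₂ x * φ x)) := by
    have := r u₁ (fun x => v₂ x * φ x) (fun x hx => by simp [z1 x hx])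
    rw [← this]
    exact ivg.bdd_mul iu₁.1 bU
  have k2 : Integrable (fun x => v₁ x * g x) := by
    refine (IsTest.integrable_mul hφ.1.continuous hφ.2.1 hφ.2.2 hl₂).congr
      (Eventually.of_forall fun x => ?_)
    simp only [hg]; ring
  have s : ∀ x, (u₁ x * v₂ x + v₁ x * u₂ x) * φ x = u₁ x * (v₂ x * φ x) + v₁ x * g x := by
    intro x; simp only [hg]; ring
  simp only [s]
  rw [integral_add k1 k2]
  simp only [mul_assoc]
  linarith

/-! ### The cylinder -/

theorem isOpen_cyl : IsOpen cyl := by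
  have : Continuous fun x : E3 => x 1 ^ 2 + x 2 ^ 2 := by fun_prop
  exact isOpen_lt this continuous_const

theorem measurableSet_cyl : MeasurableSet cyl := isOpen_cyl.measurableSet

theorem convex_cyl : Convex ℝ cyl := by
  intro x hx y hy a b ha hb hab
  simp only [cyl, mem_ofPred_eq, PiLp.add_apply, PiLp.smul_apply, smul_eq_mul] at *
  have h : (a * x 1 + b * y 1) ^ 2 + (a * x 2 + b * y 2) ^ 2 ≤
      a * (x 1 ^ 2 + x 2 ^ 2) + b * (y 1 ^ 2 + y 2 ^ 2) := by
    obtain rfl : b = 1 - a := by linarith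
    nlinarith [mul_nonneg (mul_nonneg ha hb) (add_nonneg (sq_nonneg (x 1 - y 1)) (sq_nonneg (x 2 - y 2)))]
  rcases eq_or_lt_of_le ha with rfl | ha'
  · have : b = 1 := by linarith
    subst this; linarith
  · nlinarith

theorem isOpen_cylFin (a : ℝ) : IsOpen (cylFin a) :=
  isOpen_cyl.inter (isOpen_lt (by fun_prop : Continuous fun x : E3 => |x 0|) continuous_const)

theorem measurableSet_cylFin (a : ℝ) : MeasurableSet (cylFin a) := (isOpen_cylFin a).measurableSet

theorem cylFin_subset (a : ℝ) : cylFin a ⊆ cyl := fun _ h => h.1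

/-- The pushforward of Lebesgue measure on the cylinder to its axis. -/
def axisMeasure : Measure ℝ := (volume.restrict cyl).map (fun x : E3 => x 0)

theorem measurable_coord (i : Fin 3) : Measurable (fun x : E3 => x i) := by fun_prop

theorem measure_cylFin_lt_top (a : ℝ) : volume (cylFin a) < ⊤ := by
  have : cylFin a ⊆ Metric.closedBall 0 (|a| + 1) := by
    intro x hx
    rw [mem_closedBall_zero_iff, EuclideanSpace.norm_eq, Real.sqrt_le_left (by positivity)]
    simp only [Fin.sum_univ_three, Real.norm_eq_abs, sq_abs]
    have h1 := hx.1
    have h2 := hx.2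
    simp only [cyl, mem_ofPred_eq] at h1
    have h3 : |x 0| ≤ |a| := h2.le.trans (le_abs_self a)
    have h4 : x 0 ^ 2 ≤ a ^ 2 := sq_le_sq.mpr h3
    nlinarith [abs_nonneg a, sq_abs a]
  exact (measure_mono this).trans_lt measure_closedBall_lt_top

instance isAddLeftInvariant_axisMeasure : axisMeasure.IsAddLeftInvariant := by
  refine ⟨fun t => ?_⟩
  have hsh : Measurable (fun x : E3 => EuclideanSpace.single 0 t + x) := by fun_prop
  rw [axisMeasure, Measure.map_map (by fun_prop) (measurable_coord 0)]
  have e : ((fun x => t + x) ∘ fun x : E3 => x 0) =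
      (fun x : E3 => x 0) ∘ fun x : E3 => EuclideanSpace.single 0 t + x := by
    funext x; simp
  rw [e, ← Measure.map_map (measurable_coord 0) hsh]
  congr 1
  have hp : MeasurePreserving (fun x : E3 => EuclideanSpace.single 0 t + x) volume volume :=
    measurePreserving_add_left volume _
  have hpre : (fun x : E3 => EuclideanSpace.single 0 t + x) ⁻¹' cyl = cyl := by
    ext x; simp [cyl]
  have := hp.restrict_preimage measurableSet_cyl
  rw [hpre] at this
  exact this.map_eq

instance isFiniteMeasureOnCompacts_axisMeasure : IsFiniteMeasureOnCompacts axisMeasure := by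
  refine ⟨fun K hK => ?_⟩
  obtain ⟨r, hr⟩ := hK.isBounded.subset_ball 0
  rw [axisMeasure, Measure.map_apply (measurable_coord 0) hK.measurableSet,
    Measure.restrict_apply (measurable_coord 0 hK.measurableSet)]
  refine (measure_mono ?_).trans_lt (measure_cylFin_lt_top r)
  rintro x ⟨hx, hxc⟩
  exact ⟨hxc, by simpa using hr hx⟩

/-- The area of the cross-section. -/
def area : NNReal := Measure.addHaarScalarFactor axisMeasure volume

/-- The cylinder is invariant under axial translations, so the pushforward is a
translation-invariant, locally finite measure on the line, hence a multiple of Lebesgue measure.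
This replaces Fubini for functions of the first variable, and the value of the constant never
matters beyond being positive and finite. -/
theorem axisMeasure_eq : axisMeasure = area • (volume : Measure ℝ) :=
  Measure.isAddLeftInvariant_eq_smul _ _

theorem area_pos : 0 < area := by
  rw [pos_iff_ne_zero]
  intro h
  have h0 : axisMeasure univ = 0 := by rw [axisMeasure_eq, h]; simp
  rw [axisMeasure, Measure.map_apply (measurable_coord 0) MeasurableSet.univ] at h0
  simp only [preimage_univ, Measure.restrict_apply_univ] at h0
  exact (isOpen_cyl.measure_pos volume ⟨0, by simp [cyl]⟩).ne' h0

theorem lintegral_cyl_comp {f : ℝ → ℝ≥0∞} (hf : AEMeasurable f) :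
    ∫⁻ x in cyl, f (x 0) = area * ∫⁻ t, f t := by
  have hf' : AEMeasurable f ((volume.restrict cyl).map (fun x : E3 => x 0)) := by
    change AEMeasurable f axisMeasure
    rw [axisMeasure_eq]
    exact hf.mono_ac (Measure.smul_absolutelyContinuous (c := area))
  rw [← lintegral_map' hf' (measurable_coord 0).aemeasurable]
  change ∫⁻ t, f t ∂axisMeasure = _
  rw [axisMeasure_eq, lintegral_smul_measure]
  rfl

theorem quasiMeasurePreserving_coord :
    Measure.QuasiMeasurePreserving (fun x : E3 => x 0) (volume.restrict cyl) volume := by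
  refine ⟨measurable_coord 0, ?_⟩
  change axisMeasure ≪ volume
  rw [axisMeasure_eq]
  exact Measure.smul_absolutelyContinuous

theorem ae_cyl_of_ae {P : ℝ → Prop} (h : ∀ᵐ t, P t) : ∀ᵐ x ∂volume.restrict cyl, P (x 0) :=
  quasiMeasurePreserving_coord.ae h

theorem integral_cyl_comp {f : ℝ → ℝ} (hf : AEStronglyMeasurable f) :
    ∫ x in cyl, f (x 0) = area * ∫ t, f t := by
  have hf' : AEStronglyMeasurable f ((volume.restrict cyl).map (fun x : E3 => x 0)) := by
    change AEStronglyMeasurable f axisMeasure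
    rw [axisMeasure_eq]
    exact hf.mono_ac Measure.smul_absolutelyContinuous
  rw [← integral_map (measurable_coord 0).aemeasurable hf']
  change ∫ t, f t ∂axisMeasure = _
  rw [axisMeasure_eq, integral_smul_nnreal_measure]
  rfl

theorem memLp_cyl_comp_iff {f : ℝ → ℝ} (hf : AEStronglyMeasurable f) (p : ℝ≥0∞) :
    MemLp (fun x : E3 => f (x 0)) p (volume.restrict cyl) ↔ MemLp f p := by
  have hf' : AEStronglyMeasurable f ((volume.restrict cyl).map (fun x : E3 => x 0)) := by
    change AEStronglyMeasurable f axisMeasure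
    rw [axisMeasure_eq]
    exact hf.mono_ac Measure.smul_absolutelyContinuous
  have h := memLp_map_measure_iff (p := p) hf' (measurable_coord 0).aemeasurable
  rw [show (fun x : E3 => f (x 0)) = f ∘ fun x : E3 => x 0 from rfl, ← h]
  change MemLp f p axisMeasure ↔ _
  rw [axisMeasure_eq]
  constructor
  · intro h
    have h2 := h.smul_measure (c := ((area⁻¹ : NNReal) : ℝ≥0∞)) ENNReal.coe_ne_top
    have e : ((area⁻¹ : NNReal) : ℝ≥0∞) • (area • (volume : Measure ℝ)) = volume := by
      rw [show (area • (volume : Measure ℝ)) = ((area : NNReal) : ℝ≥0∞) • (volume : Measure ℝ) from rfl,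
        smul_smul, ← ENNReal.coe_mul, inv_mul_cancel₀ area_pos.ne']
      simp
    rwa [e] at h2
  · intro h
    exact h.smul_measure (c := ((area : NNReal) : ℝ≥0∞)) ENNReal.coe_ne_top

theorem measure_cylFin {a : ℝ} : volume (cylFin a) = area * ENNReal.ofReal (2 * a) := by
  have h : cylFin a = (fun x : E3 => x 0) ⁻¹' (Ioo (-a) a) ∩ cyl := by
    ext x
    simp only [cylFin, mem_ofPred_eq, mem_inter_iff, mem_preimage, mem_Ioo, abs_lt]
    tauto
  rw [h, ← Measure.restrict_apply (measurable_coord 0 measurableSet_Ioo),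
    ← Measure.map_apply (measurable_coord 0) measurableSet_Ioo]
  change axisMeasure _ = _
  rw [axisMeasure_eq, Measure.smul_apply, Real.volume_Ioo]
  congr 2; ring

/-! ### Functions with vanishing weak partial derivatives -/

theorem fderiv_apply_eq_sum (f : E3 → ℝ) (x w : E3) :
    fderiv ℝ f x w = ∑ i, w i * partialD i f x := by
  have h : w = ∑ i, w i • EuclideanSpace.single i (1 : ℝ) := by
    ext j; simp [Finset.sum_apply, Pi.single_apply]
  conv_lhs => rw [h]
  simp [partialD]

/-- Along the segment the derivative of the mollification is the sum over i of (y - x)ᵢ ∂ᵢ, and each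
term vanishes, either because the coordinates agree or because the weak derivative is zero. The
mollification radius only has to be smaller than the distance from the segment to the complement of
Ω. -/
theorem eventually_moll_eq {Ω : Set E3} (hΩ : IsOpen Ω) {u : E3 → ℝ}
    (hu : LocallyIntegrable (Ω.indicator u)) {x y : E3} (hs : segment ℝ x y ⊆ Ω)
    (hz : ∀ i, (y - x) i = 0 ∨ HasWeakPartial Ω i u (fun _ => 0)) :
    ∀ᶠ n in atTop, moll n (Ω.indicator u) x = moll n (Ω.indicator u) y := by
  have hc : IsCompact (segment ℝ x y) := by
    rw [segment_eq_image_lineMap]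
    exact isCompact_Icc.image (AffineMap.lineMap_continuous)
  obtain ⟨δ, hδ, hδs⟩ := hc.exists_cthickening_subset_open hΩ hs
  filter_upwards [tendsto_rad.eventually (gt_mem_nhds hδ)] with n hn
  have hb : ∀ z ∈ segment ℝ x y, Metric.closedBall z (rad n) ⊆ Ω := by
    intro z hzs w hw
    exact hδs (Metric.mem_cthickening_of_dist_le w z _ _ hzs ((Metric.mem_closedBall.mp hw).trans hn.le))
  set F : ℝ → ℝ := fun s => moll n (Ω.indicator u) (x + s • (y - x)) with hF
  have hd : ∀ s ∈ Icc (0 : ℝ) 1, HasDerivWithinAt F 0 (Icc 0 1) s := by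
    intro s hsI
    have hmem : x + s • (y - x) ∈ segment ℝ x y := by
      rw [segment_eq_image']
      exact ⟨s, hsI, rfl⟩
    have h1 : HasFDerivAt (moll n (Ω.indicator u))
        (fderiv ℝ (moll n (Ω.indicator u)) (x + s • (y - x))) (x + s • (y - x)) :=
      ((contDiff_moll n hu).differentiable (by simp) _).hasFDerivAt
    have h2 : HasDerivAt (fun s : ℝ => x + s • (y - x)) (y - x) s := by
      simpa using ((hasDerivAt_id s).smul_const (y - x)).const_add x
    have h3 := h1.comp_hasDerivAt s h2
    have h4 : fderiv ℝ (moll n (Ω.indicator u)) (x + s • (y - x)) (y - x) = 0 := by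
      rw [fderiv_apply_eq_sum]
      refine Finset.sum_eq_zero fun i _ => ?_
      rcases hz i with h | h
      · rw [h, zero_mul]
      · rw [partialD_moll_of_hasWeakPartial hΩ h hu (hb _ hmem)]
        simp [moll]
    rw [h4] at h3
    exact h3.hasDerivWithinAt
  have := (convex_Icc (0 : ℝ) 1).norm_image_sub_le_of_norm_hasDerivWithin_le (C := 0) hd
    (by simp) (left_mem_Icc.mpr zero_le_one) (right_mem_Icc.mpr zero_le_one)
  simp only [hF, zero_smul, add_zero, one_smul, zero_mul, norm_le_zero_iff] at this
  have h5 := sub_eq_zero.mp this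
  rw [add_sub_cancel] at h5
  exact h5.symm

/-- The projection to the axis of the cylinder. -/
def axisPt (t : ℝ) : E3 := EuclideanSpace.single 0 t

theorem axisPt_mem_cyl (t : ℝ) : axisPt t ∈ cyl := by simp [axisPt, cyl]

theorem continuous_axisPt : Continuous axisPt := by
  unfold axisPt
  refine (PiLp.continuous_toLp 2 _).comp ?_
  exact continuous_pi fun i => by
    by_cases h : i = 0
    · subst h; simpa using! continuous_id
    · simpa [Pi.single_apply, h] using continuous_const

/-- A function on the cylinder whose weak derivatives in the cross-section vanish
depends on the first variable only. -/
theorem exists_measurable_comp {u : E3 → ℝ} (hu : LocallyIntegrable (cyl.indicator u))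
    (h : ∀ i, i ≠ 0 → HasWeakPartial cyl i u (fun _ => 0)) :
    ∃ f : ℝ → ℝ, Measurable f ∧ ∀ᵐ x ∂volume.restrict cyl, u x = f (x 0) := by
  have hm : ∀ n, Measurable (fun t => moll n (cyl.indicator u) (axisPt t)) := fun n =>
    ((contDiff_moll n hu).continuous.comp continuous_axisPt).measurable
  -- The candidate is the upper limit of the mollifications on the axis, which is measurable by
  -- construction. For almost every x the mollifications converge at x and eventually agree with
  -- their values at the axial projection of x, so the upper limit there is u x.
  refine ⟨fun t => limsup (fun n => moll n (cyl.indicator u) (axisPt t)) atTop,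
    Measurable.limsup hm, ?_⟩
  rw [ae_restrict_iff' measurableSet_cyl]
  filter_upwards [ae_tendsto_moll hu] with x hx hxc
  rw [indicator_of_mem hxc] at hx
  have he := eventually_moll_eq isOpen_cyl hu (x := x) (y := axisPt (x 0))
    (convex_cyl.segment_subset hxc (axisPt_mem_cyl _)) (fun i => by
      by_cases hi : i = 0
      · left; subst hi; simp [axisPt]
      · exact Or.inr (h i hi))
  exact (hx.congr' he).limsup_eq.symm

theorem ae_const_of_hasWeakPartial_zero {u : E3 → ℝ} (hu : LocallyIntegrable (cyl.indicator u))
    (h : ∀ i, HasWeakPartial cyl i u (fun _ => 0)) :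
    ∃ c : ℝ, ∀ᵐ x ∂volume.restrict cyl, u x = c := by
  refine ⟨limsup (fun n => moll n (cyl.indicator u) 0) atTop, ?_⟩
  rw [ae_restrict_iff' measurableSet_cyl]
  filter_upwards [ae_tendsto_moll hu] with x hx hxc
  rw [indicator_of_mem hxc] at hx
  have he := eventually_moll_eq isOpen_cyl hu (x := x) (y := 0)
    (convex_cyl.segment_subset hxc (by simp [cyl])) (fun i => Or.inr (h i))
  exact (hx.congr' he).limsup_eq.symm

/-- A function of the first variable has vanishing weak derivatives in the cross-section. -/
theorem weakPartial_ae_eq_zero_of_comp {u v : E3 → ℝ} (hu : LocallyIntegrable (cyl.indicator u))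
    (hv : LocallyIntegrable (cyl.indicator v)) {i : Fin 3} (hi : i ≠ 0)
    (h : HasWeakPartial cyl i u v) {f : ℝ → ℝ} (hf : ∀ᵐ x ∂volume.restrict cyl, u x = f (x 0)) :
    ∀ᵐ x ∂volume.restrict cyl, v x = 0 := by
  rw [ae_restrict_iff' measurableSet_cyl] at hf ⊢
  filter_upwards [ae_tendsto_moll hv] with x hx hxc
  rw [indicator_of_mem hxc] at hx
  obtain ⟨r, hr, hrx⟩ := Metric.isOpen_iff.mp isOpen_cyl x hxc
  refine tendsto_nhds_unique hx (tendsto_const_nhds.congr' ?_)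
  filter_upwards [tendsto_rad.eventually (gt_mem_nhds (half_pos hr))] with n hn
  have hball : ∀ z ∈ Metric.ball x (r / 2), Metric.closedBall z (rad n) ⊆ cyl := by
    intro z hz w hw
    apply hrx
    have h1 := Metric.mem_ball.mp hz
    have h2 := Metric.mem_closedBall.mp hw
    have := dist_triangle w z x
    rw [Metric.mem_ball]; linarith
  rw [← partialD_moll_of_hasWeakPartial isOpen_cyl h hu
    (hball x (Metric.mem_ball_self (half_pos hr)))]
  -- Near x the mollification is a function of the first coordinate alone, so its derivative in a
  -- cross-sectional direction is 0. The identity holds under the integral sign, so no measurability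
  -- of f is needed.
  have key : ∀ z ∈ Metric.ball x (r / 2), moll n (cyl.indicator u) z = ∫ y, kern n y * f (z 0 - y 0) := by
    intro z hz
    rw [moll_eq_integral_sub]
    apply integral_congr_ae
    have hq : ∀ᵐ y, (z - y) ∈ cyl → u (z - y) = f ((z - y) 0) :=
      (quasiMeasurePreserving_sub_left volume z).ae hf
    filter_upwards [hq] with y hy
    by_cases hyr : rad n < ‖y‖
    · simp [kern_eq_zero hyr]
    · have : z - y ∈ cyl := by
        apply hball z hz
        rw [Metric.mem_closedBall, dist_eq_norm]
        simpa using hyr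
      rw [indicator_of_mem this, hy this]
      simp
  have hd : HasFDerivAt (moll n (cyl.indicator u)) (fderiv ℝ (moll n (cyl.indicator u)) x) x :=
    ((contDiff_moll n hu).differentiable (by simp) _).hasFDerivAt
  have h2 : HasDerivAt (fun s : ℝ => x + s • EuclideanSpace.single i (1 : ℝ))
      (EuclideanSpace.single i (1 : ℝ)) 0 := by
    simpa using! ((hasDerivAt_id (0 : ℝ)).smul_const (EuclideanSpace.single i (1 : ℝ))).const_add x
  have hd' : HasFDerivAt (moll n (cyl.indicator u)) (fderiv ℝ (moll n (cyl.indicator u)) x)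
      (x + (0 : ℝ) • EuclideanSpace.single i (1 : ℝ)) := by simpa using hd
  have h3 := hd'.comp_hasDerivAt (0 : ℝ) h2
  have h4 : ((moll n (cyl.indicator u)) ∘ fun s : ℝ => x + s • EuclideanSpace.single i (1 : ℝ))
      =ᶠ[𝓝 0] fun _ => ∫ y, kern n y * f (x 0 - y 0) := by
    have hcont := h2.continuousAt
    have : ∀ᶠ s in 𝓝 (0 : ℝ), x + s • EuclideanSpace.single i (1 : ℝ) ∈ Metric.ball x (r / 2) := by
      apply hcont.eventually_mem
      simpa using Metric.ball_mem_nhds x (half_pos hr)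
    filter_upwards [this] with s hs
    simp only [Function.comp]
    rw [key _ hs]
    simp [hi.symm]
  exact (h3.unique ((hasDerivAt_const (0 : ℝ) _).congr_of_eventuallyEq h4)).symm

/-! ### Primitives of functions of the first variable -/

theorem locallyIntegrableOn_comp {h : ℝ → ℝ} (hh : LocallyIntegrable h) :
    LocallyIntegrableOn (fun x : E3 => h (x 0)) cyl := by
  intro x hx
  have hmem : cylFin (|x 0| + 1) ∈ 𝓝[cyl] x :=
    mem_nhdsWithin_of_mem_nhds ((isOpen_cylFin _).mem_nhds ⟨hx, by linarith⟩)
  refine ⟨cylFin (|x 0| + 1), hmem, ?_⟩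
  set I := Ioo (-(|x 0| + 1)) (|x 0| + 1) with hI
  have h1 : Integrable (I.indicator h) :=
    ((hh.integrableOn_isCompact isCompact_Icc).mono_set Ioo_subset_Icc_self).integrable_indicator
      measurableSet_Ioo
  have h2 := (memLp_cyl_comp_iff h1.1 1).mpr (memLp_one_iff_integrable.mpr h1)
  have h3 : IntegrableOn (fun x : E3 => I.indicator h (x 0)) cyl := memLp_one_iff_integrable.mp h2
  refine (h3.mono_set (cylFin_subset _)).congr_fun (fun y hy => ?_) (measurableSet_cylFin _)
  have : y 0 ∈ I := abs_lt.mp hy.2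
  simp [this]

theorem continuous_primitive {h : ℝ → ℝ} (hh : LocallyIntegrable h) (c : ℝ) :
    Continuous fun t => c + ∫ s in (0 : ℝ)..t, h s :=
  continuous_const.add (intervalIntegral.continuous_primitive (fun _ _ =>
    (hh.integrableOn_isCompact isCompact_uIcc).intervalIntegrable) 0)

theorem hasWeakPartial_primitive_of_continuous {g : ℝ → ℝ} (hg : Continuous g) (c : ℝ) (i : Fin 3) :
    HasWeakPartial cyl i (fun x : E3 => c + ∫ s in (0 : ℝ)..x 0, g s)
      (fun x => if i = 0 then g (x 0) else 0) := by
  have hd : ∀ t, HasDerivAt (fun t => c + ∫ s in (0 : ℝ)..t, g s) (g t) t := fun t =>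
    (intervalIntegral.integral_hasDerivAt_right (hg.intervalIntegrable _ _)
      (hg.stronglyMeasurableAtFilter _ _) hg.continuousAt).const_add c
  have hG : ContDiff ℝ 1 (fun t => c + ∫ s in (0 : ℝ)..t, g s) := by
    rw [contDiff_one_iff_deriv]
    exact ⟨fun t => (hd t).differentiableAt, by rwa [show deriv _ = g from funext fun t => (hd t).deriv]⟩
  have hx : ContDiff ℝ 1 (fun x : E3 => x 0) := by fun_prop
  have h := hasWeakPartial_of_contDiff cyl i (hG.comp hx)
  have e : partialD i ((fun t => c + ∫ s in (0 : ℝ)..t, g s) ∘ fun x : E3 => x 0) =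
      fun x => if i = 0 then g (x 0) else 0 := by
    funext x
    have h1 : HasFDerivAt (fun x : E3 => x 0) (EuclideanSpace.proj (𝕜 := ℝ) (0 : Fin 3)) x :=
      (EuclideanSpace.proj (𝕜 := ℝ) (0 : Fin 3)).hasFDerivAt
    have h2 := (hd (x 0)).comp_hasFDerivAt x h1
    rw [partialD, h2.fderiv]
    by_cases hi : i = 0
    · subst hi; simp
    · simp [hi, Ne.symm hi]
  rw [e] at h
  exact h

/-- For continuous h this is the fundamental theorem of calculus. In general h is approximated in L¹
by a continuous g on the interval seen by the test function. The primitives are then uniformly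
ε-close there, and both sides of the weak formulation change by O(ε). -/
theorem hasWeakPartial_primitive {h : ℝ → ℝ} (hh : LocallyIntegrable h) (c : ℝ) (i : Fin 3) :
    HasWeakPartial cyl i (fun x : E3 => c + ∫ s in (0 : ℝ)..x 0, h s)
      (fun x => if i = 0 then h (x 0) else 0) := by
  set F : ℝ → ℝ := fun t => c + ∫ s in (0 : ℝ)..t, h s with hF
  have hFc : Continuous F := continuous_primitive hh c
  have lF : LocallyIntegrableOn (fun x : E3 => F (x 0)) cyl :=
    (hFc.comp (by fun_prop : Continuous fun x : E3 => x 0)).locallyIntegrable.locallyIntegrableOn _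
  have lh : LocallyIntegrableOn (fun x : E3 => if i = 0 then h (x 0) else 0) cyl := by
    by_cases hi : i = 0
    · simpa [hi] using locallyIntegrableOn_comp hh
    · simpa [hi] using locallyIntegrableOn_zero
  refine ⟨lF, lh, fun φ hφ => ?_⟩
  obtain ⟨T, hT⟩ := hφ.2.1.isBounded.subset_ball 0
  have hTx : ∀ x ∈ tsupport φ, |x 0| < T := fun x hx => by
    have h1 : ‖x‖ < T := by simpa using hT hx
    exact (PiLp.norm_apply_le x 0).trans_lt h1
  -- Truncation makes the merely locally integrable h integrable without changing it on the axial
  -- range of the support of φ.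
  set h' : ℝ → ℝ := (Icc (-T) T).indicator h with hh'
  have ih' : Integrable h' :=
    (hh.integrableOn_isCompact isCompact_Icc).integrable_indicator measurableSet_Icc
  obtain ⟨M, hM⟩ := hφ.2.1.exists_bound_of_continuous hφ.1.continuous
  have hM0 : 0 ≤ M := (norm_nonneg _).trans (hM 0)
  have iD : Integrable (partialD i φ) :=
    (hφ.continuous_partialD i).integrable_of_hasCompactSupport (hφ.hasCompactSupport_partialD i)
  set A := ∫ x in cyl, |partialD i φ x| with hA
  have hA0 : 0 ≤ A := integral_nonneg fun _ => abs_nonneg _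
  have hds := (tsupport_partialD_subset i φ).trans hφ.2.2
  have main : ∀ ε > 0, |(∫ x in cyl, F (x 0) * partialD i φ x) +
      ∫ x in cyl, (if i = 0 then h (x 0) else 0) * φ x| ≤ ε * (A + area * M) := by
    intro ε hε
    obtain ⟨g, -, hg1, hgc, hgi⟩ := ih'.exists_hasCompactSupport_integral_sub_le hε
    have hw := hasWeakPartial_primitive_of_continuous hgc c i
    set G : ℝ → ℝ := fun t => c + ∫ s in (0 : ℝ)..t, g s with hG
    have id : Integrable (fun t => h' t - g t) := ih'.sub hgi
    have hFG : ∀ t, |t| < T → |F t - G t| ≤ ε := by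
      intro t ht
      have ht' := abs_lt.mp ht
      have e1 : ∫ s in (0 : ℝ)..t, h s = ∫ s in (0 : ℝ)..t, h' s := by
        apply intervalIntegral.integral_congr
        intro s hs
        have : s ∈ Icc (-T) T := by
          rcases le_total 0 t with h0 | h0
          · rw [uIcc_of_le h0] at hs; exact ⟨by linarith [hs.1], by linarith [hs.2]⟩
          · rw [uIcc_of_ge h0] at hs; exact ⟨by linarith [hs.1], by linarith [hs.2]⟩
        simp [hh', this]
      have e2 : F t - G t = ∫ s in (0 : ℝ)..t, (h' s - g s) := by
        simp only [hF, hG]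
        rw [e1, intervalIntegral.integral_sub ih'.intervalIntegrable hgi.intervalIntegrable]
        ring
      rw [e2, ← Real.norm_eq_abs]
      calc _ ≤ ∫ s in Set.uIoc (0 : ℝ) t, ‖h' s - g s‖ := intervalIntegral.norm_integral_le_integral_norm_uIoc
        _ ≤ ∫ s, ‖h' s - g s‖ := setIntegral_le_integral id.norm (Eventually.of_forall fun _ => norm_nonneg _)
        _ ≤ ε := hg1
    have e := hw.2.2 φ hφ
    have i1 : IntegrableOn (fun x => F (x 0) * partialD i φ x) cyl :=
      (IsTest.integrable_mul (hφ.continuous_partialD i) (hφ.hasCompactSupport_partialD i) hds lF).integrableOn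
    have i2 : IntegrableOn (fun x => G (x 0) * partialD i φ x) cyl :=
      (IsTest.integrable_mul (hφ.continuous_partialD i) (hφ.hasCompactSupport_partialD i) hds hw.1).integrableOn
    have i3 : IntegrableOn (fun x => (if i = 0 then h (x 0) else 0) * φ x) cyl :=
      (IsTest.integrable_mul hφ.1.continuous hφ.2.1 hφ.2.2 lh).integrableOn
    have i4 : IntegrableOn (fun x => (if i = 0 then g (x 0) else 0) * φ x) cyl :=
      (IsTest.integrable_mul hφ.1.continuous hφ.2.1 hφ.2.2 hw.2.1).integrableOn
    have d1 : |∫ x in cyl, (F (x 0) * partialD i φ x - G (x 0) * partialD i φ x)| ≤ ε * A := by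
      rw [hA, ← integral_const_mul, ← Real.norm_eq_abs]
      refine norm_integral_le_of_norm_le (iD.norm.integrableOn.const_mul ε) (Eventually.of_forall fun x => ?_)
      rw [← sub_mul, norm_mul]
      by_cases hx : x ∈ tsupport φ
      · exact mul_le_mul_of_nonneg_right (hFG _ (hTx x hx)) (norm_nonneg _)
      · have : partialD i φ x = 0 :=
          image_eq_zero_of_notMem_tsupport fun h => hx (tsupport_partialD_subset i φ h)
        simp [this]
    have d2 : |∫ x in cyl, ((if i = 0 then h (x 0) else 0) * φ x -
        (if i = 0 then g (x 0) else 0) * φ x)| ≤ ε * (area * M) := by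
      have hi1 : IntegrableOn (fun x : E3 => |h' (x 0) - g (x 0)|) cyl :=
        memLp_one_iff_integrable.mp ((memLp_cyl_comp_iff (f := fun t => |h' t - g t|) id.abs.1 1).mpr
          (memLp_one_iff_integrable.mpr id.abs))
      calc _ ≤ ∫ x in cyl, M * |h' (x 0) - g (x 0)| := by
            rw [← Real.norm_eq_abs]
            refine norm_integral_le_of_norm_le (hi1.const_mul M) (Eventually.of_forall fun x => ?_)
            by_cases hx : x ∈ tsupport φ
            · by_cases hi : i = 0
              · have : x 0 ∈ Icc (-T) T := by
                  have := abs_lt.mp (hTx x hx); exact ⟨this.1.le, this.2.le⟩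
                rw [← sub_mul, norm_mul, mul_comm]
                simp only [hi, if_true, hh', indicator_of_mem this]
                exact mul_le_mul_of_nonneg_right (hM x) (abs_nonneg _)
              · simp only [hi, if_false, zero_mul, sub_zero, norm_zero]; positivity
            · rw [image_eq_zero_of_notMem_tsupport hx]
              simp only [mul_zero, sub_zero, norm_zero]; positivity
        _ = M * (area * ∫ t, |h' t - g t|) := by
            rw [integral_const_mul, integral_cyl_comp (f := fun t => |h' t - g t|) id.abs.1]
        _ ≤ M * (area * ε) := by
            have : ∫ t, |h' t - g t| ≤ ε := hg1
            gcongr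
        _ = ε * (area * M) := by ring
    rw [integral_sub i1 i2] at d1
    rw [integral_sub i3 i4] at d2
    have := abs_le.mp d1
    have := abs_le.mp d2
    rw [abs_le]
    constructor <;> nlinarith
  have hz : |(∫ x in cyl, F (x 0) * partialD i φ x) +
      ∫ x in cyl, (if i = 0 then h (x 0) else 0) * φ x| ≤ 0 := by
    have hcont : Tendsto (fun ε : ℝ => ε * (A + area * M)) (𝓝[>] 0) (𝓝 0) := by
      have : Tendsto (fun ε : ℝ => ε * (A + area * M)) (𝓝 0) (𝓝 (0 * (A + area * M))) :=
        tendsto_id.mul_const _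
      rw [zero_mul] at this
      exact this.mono_left nhdsWithin_le_nhds
    exact ge_of_tendsto hcont (eventually_mem_nhdsWithin.mono fun ε hε => main ε hε)
  have := abs_nonpos_iff.mp hz
  linarith

/-! ### Maps of finite seminorm -/

theorem locallyIntegrable_indicator_of_memLp {Ω : Set E3} (hΩ : MeasurableSet Ω) {u : E3 → ℝ}
    {p : ℝ≥0∞} (hp : 1 ≤ p) (hu : MemLp u p (volume.restrict Ω)) :
    LocallyIntegrable (Ω.indicator u) :=
  ((memLp_indicator_iff_restrict hΩ).mpr hu).locallyIntegrable hp

theorem FiniteMaps.hasWeakPartial {m : E3 → E3} (hm : m ∈ FiniteMaps) (i j : Fin 3) :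
    HasWeakPartial cyl i (fun x => m x j) (fun x => dm i m x j) :=
  hasWeakPartial_weakPartial (hm.2.1 i j)

theorem FiniteMaps.abs_le_one {m : E3 → E3} (hm : m ∈ FiniteMaps) (j : Fin 3) : ∀ᵐ x ∂volume.restrict cyl, |m x j| ≤ 1 := by
  filter_upwards [hm.1] with x hx
  rw [← hx]; exact PiLp.norm_apply_le (m x) j

theorem FiniteMaps.sq_sum {m : E3 → E3} (hm : m ∈ FiniteMaps) :
    ∀ᵐ x ∂volume.restrict cyl, m x 0 ^ 2 + m x 1 ^ 2 + m x 2 ^ 2 = 1 := by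
  filter_upwards [hm.1] with x hx
  have := EuclideanSpace.norm_sq_eq (m x)
  rw [hx] at this
  simp only [Fin.sum_univ_three, Real.norm_eq_abs, sq_abs] at this
  linarith

theorem FiniteMaps.memLp_top {m : E3 → E3} (hm : m ∈ FiniteMaps) (j : Fin 3) : MemLp (fun x => m x j) ⊤ (volume.restrict cyl) :=
  memLp_top_of_bound (FiniteMaps.hasWeakPartial hm 0 j).1.aestronglyMeasurable 1
    (FiniteMaps.abs_le_one hm j)

theorem FiniteMaps.memLp_dm {m : E3 → E3} (hm : m ∈ FiniteMaps) (i j : Fin 3) : MemLp (fun x => dm i m x j) 2 (volume.restrict cyl) := by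
  have hmeas := (FiniteMaps.hasWeakPartial hm i j).2.1.aestronglyMeasurable
  rw [memLp_two_iff_integrable_sq hmeas]
  refine ⟨hmeas.pow 2, ?_⟩
  have h := hm.2.2
  rw [hSeminorm, ENNReal.add_lt_top] at h
  have h1 := (ENNReal.rpow_lt_top_iff_of_pos (by norm_num)).mp h.1
  rw [hasFiniteIntegral_iff_ofReal (Eventually.of_forall fun _ => sq_nonneg _)]
  refine (lintegral_mono fun x => ENNReal.ofReal_le_ofReal ?_).trans_lt h1
  calc dm i m x j ^ 2 ≤ ∑ j, dm i m x j ^ 2 :=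
        Finset.single_le_sum (f := fun j => dm i m x j ^ 2) (fun _ _ => sq_nonneg _) (Finset.mem_univ j)
    _ ≤ ∑ i, ∑ j, dm i m x j ^ 2 :=
        Finset.single_le_sum (f := fun i => ∑ j, dm i m x j ^ 2)
          (fun _ _ => Finset.sum_nonneg fun _ _ => sq_nonneg _) (Finset.mem_univ i)

theorem FiniteMaps.memLp_two {m : E3 → E3} (hm : m ∈ FiniteMaps) {j : Fin 3} (hj : j ≠ 0) :
    MemLp (fun x => m x j) 2 (volume.restrict cyl) := by
  have hmeas := (FiniteMaps.hasWeakPartial hm 0 j).1.aestronglyMeasurable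
  rw [memLp_two_iff_integrable_sq hmeas]
  refine ⟨hmeas.pow 2, ?_⟩
  have h := hm.2.2
  rw [hSeminorm, ENNReal.add_lt_top] at h
  have h1 := (ENNReal.rpow_lt_top_iff_of_pos (by norm_num)).mp h.2
  rw [hasFiniteIntegral_iff_ofReal (Eventually.of_forall fun _ => sq_nonneg _)]
  refine (lintegral_mono fun x => ENNReal.ofReal_le_ofReal ?_).trans_lt h1
  fin_cases j
  · exact absurd rfl hj
  · simpa using sq_nonneg (m x 2)
  · simpa using sq_nonneg (m x 1)

theorem hSeminorm_lt_top {m : E3 → E3}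
    (h1 : ∀ i j, MemLp (fun x => dm i m x j) 2 (volume.restrict cyl))
    (h2 : ∀ j, j ≠ 0 → MemLp (fun x => m x j) 2 (volume.restrict cyl)) : hSeminorm m < ⊤ := by
  rw [hSeminorm, ENNReal.add_lt_top]
  constructor
  · rw [ENNReal.rpow_lt_top_iff_of_pos (by norm_num)]
    have : Integrable (fun x => ∑ i, ∑ j, dm i m x j ^ 2) (volume.restrict cyl) :=
      integrable_finsetSum _ fun i _ => integrable_finsetSum _ fun j _ => (h1 i j).integrable_sq
    exact (hasFiniteIntegral_iff_ofReal (Eventually.of_forall fun _ =>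
      Finset.sum_nonneg fun _ _ => Finset.sum_nonneg fun _ _ => sq_nonneg _)).mp this.2
  · rw [ENNReal.rpow_lt_top_iff_of_pos (by norm_num)]
    have : Integrable (fun x => m x 1 ^ 2 + m x 2 ^ 2) (volume.restrict cyl) :=
      (h2 1 (by simp)).integrable_sq.add (h2 2 (by simp)).integrable_sq
    exact (hasFiniteIntegral_iff_ofReal (Eventually.of_forall fun _ => by positivity)).mp this.2

/-- The tangentiality `m · ∂ᵢ m = 0`. -/
theorem FiniteMaps.inner_dm {m : E3 → E3} (hm : m ∈ FiniteMaps) (i : Fin 3) :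
    ∀ᵐ x ∂volume.restrict cyl,
      m x 0 * dm i m x 0 + m x 1 * dm i m x 1 + m x 2 * dm i m x 2 = 0 := by
  have hp : ∀ j, HasWeakPartial cyl i (fun x => m x j * m x j)
      (fun x => m x j * dm i m x j + dm i m x j * m x j) := fun j =>
    (FiniteMaps.hasWeakPartial hm i j).mul_of_bounded isOpen_cyl (FiniteMaps.hasWeakPartial hm i j)
      (FiniteMaps.abs_le_one hm j) (FiniteMaps.abs_le_one hm j)
  have hs := ((hp 0).add (hp 1)).add (hp 2)
  have hc : HasWeakPartial cyl i (fun x => m x 0 * m x 0 + m x 1 * m x 1 + m x 2 * m x 2)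
      (fun _ => 0) := by
    refine (hasWeakPartial_const cyl i 1).congr ?_ EventuallyEq.rfl
    filter_upwards [FiniteMaps.sq_sum hm] with x hx
    linarith
  filter_upwards [hs.unique isOpen_cyl hc] with x hx
  linarith

/-- A limit configuration is given by an absolutely continuous profile. -/
theorem AdmLimit.exists_profile {m : E3 → E3} (hm : m ∈ AdmLimit) :
    ∃ (c : Fin 3 → ℝ) (h : Fin 3 → ℝ → ℝ), (∀ j, MemLp (h j) 2) ∧ ∀ᵐ x ∂volume.restrict cyl,
      (∀ j, m x j = c j + ∫ s in (0 : ℝ)..x 0, h j s) ∧ (∀ j, dm 0 m x j = h j (x 0)) ∧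
      ∀ i, i ≠ 0 → ∀ j, dm i m x j = 0 := by
  obtain ⟨hf, f, hfm⟩ := hm
  have lu : ∀ j, LocallyIntegrable (cyl.indicator fun x => m x j) := fun j =>
    locallyIntegrable_indicator_of_memLp measurableSet_cyl le_top (FiniteMaps.memLp_top hf j)
  have lv : ∀ i j, LocallyIntegrable (cyl.indicator fun x => dm i m x j) := fun i j =>
    locallyIntegrable_indicator_of_memLp measurableSet_cyl one_le_two (FiniteMaps.memLp_dm hf i j)
  have hz : ∀ i, i ≠ 0 → ∀ j, ∀ᵐ x ∂volume.restrict cyl, dm i m x j = 0 := fun i hi j =>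
    weakPartial_ae_eq_zero_of_comp (lu j) (lv i j) hi (FiniteMaps.hasWeakPartial hf i j)
      (f := fun t => f t j) (hfm.mono fun x hx => by rw [hx])
  -- By symmetry of the second derivatives of test functions, ∂ᵢ∂₀m = ∂₀∂ᵢm in the weak sense, and
  -- ∂ᵢm = 0 in the cross-section. Hence ∂₀m is itself a function of the first variable.
  have hcross : ∀ i, i ≠ 0 → ∀ j, HasWeakPartial cyl i (fun x => dm 0 m x j) (fun _ => 0) := by
    intro i hi j
    refine ⟨(FiniteMaps.hasWeakPartial hf 0 j).2.1, locallyIntegrableOn_zero, fun φ hφ => ?_⟩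
    have e1 := (FiniteMaps.hasWeakPartial hf 0 j).2.2 _ (hφ.isTest_partialD i)
    have e2 := (FiniteMaps.hasWeakPartial hf i j).2.2 _ (hφ.isTest_partialD 0)
    have e3 : ∫ x in cyl, dm i m x j * partialD 0 φ x = 0 :=
      integral_eq_zero_of_ae ((hz i hi j).mono fun x hx => by simp [hx])
    have e4 : partialD 0 (partialD i φ) = partialD i (partialD 0 φ) := by
      funext x
      have hsym : IsSymmSndFDerivAt ℝ φ x :=
        (hφ.1.contDiffAt).isSymmSndFDerivAt (by
          simpa using (WithTop.coe_le_coe.mpr le_top : ((2 : ℕ∞) : WithTop ℕ∞) ≤ ((⊤ : ℕ∞) : WithTop ℕ∞)))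
      have hdd : DifferentiableAt ℝ (fderiv ℝ φ) x :=
        (hφ.1.fderiv_right (m := ∞) (by simp)).differentiable (by simp) x
      have hd : ∀ k l : Fin 3, partialD k (partialD l φ) x =
          fderiv ℝ (fderiv ℝ φ) x (EuclideanSpace.single k 1) (EuclideanSpace.single l 1) := by
        intro k l
        change fderiv ℝ (fun y => fderiv ℝ φ y (EuclideanSpace.single l 1)) x _ = _
        rw [fderiv_clm_apply hdd (differentiableAt_const _)]
        simp
      rw [hd, hd]; exact hsym.eq _ _
    rw [e4] at e1
    simp only [zero_mul, integral_zero, neg_zero]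
    linarith
  choose h hmeas hh using fun j => exists_measurable_comp (lv 0 j) (fun i hi => hcross i hi j)
  have hL2 : ∀ j, MemLp (h j) 2 := fun j =>
    (memLp_cyl_comp_iff (hmeas j).aestronglyMeasurable 2).mp
      ((memLp_congr_ae (hh j)).mp (FiniteMaps.memLp_dm hf 0 j))
  have hloc : ∀ j, LocallyIntegrable (h j) := fun j => (hL2 j).locallyIntegrable one_le_two
  -- After subtracting the primitive of its axial derivative, mⱼ has zero weak gradient on the
  -- convex set `cyl`, hence is constant.
  have hcst : ∀ j, ∃ c : ℝ, ∀ᵐ x ∂volume.restrict cyl,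
      m x j - (0 + ∫ s in (0 : ℝ)..x 0, h j s) = c := by
    intro j
    refine ae_const_of_hasWeakPartial_zero ?_ fun i => ?_
    · rw [indicator_sub]
      refine (lu j).sub ?_
      exact ((continuous_primitive (hloc j) 0).comp
        (by fun_prop : Continuous fun x : E3 => x 0)).locallyIntegrable.indicator measurableSet_cyl
    · refine ((FiniteMaps.hasWeakPartial hf i j).sub (hasWeakPartial_primitive (hloc j) 0 i)).congr
        EventuallyEq.rfl ?_
      by_cases hi : i = 0
      · subst hi
        filter_upwards [hh j] with x hx
        simp [hx]
      · filter_upwards [hz i hi j] with x hx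
        simp [hx, hi]
  choose c hc using hcst
  refine ⟨c, h, hL2, ?_⟩
  have hz' : ∀ᵐ x ∂volume.restrict cyl, ∀ i, i ≠ 0 → ∀ j, dm i m x j = 0 := by
    rw [ae_all_iff]; intro i
    by_cases hi : i = 0
    · simp [hi]
    · have := ae_all_iff.mpr (hz i hi)
      filter_upwards [this] with x hx _ using hx
  filter_upwards [ae_all_iff.mpr hc, ae_all_iff.mpr hh, hz'] with x h1 h2 h3
  exact ⟨fun j => by linarith [h1 j], h2, h3⟩

/-! ### The homogeneous Sobolev space and the stray field -/

theorem tendsto_integral_mul_of_eLpNorm {α : Type*} [MeasurableSpace α] {μ : Measure α}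
    {p q : ℝ≥0∞} [p.HolderConjugate q] {f : ℕ → α → ℝ} {f₀ g : α → ℝ}
    (hf : ∀ n, MemLp (f n) p μ) (hf₀ : MemLp f₀ p μ) (hg : MemLp g q μ)
    (h : Tendsto (fun n => eLpNorm (f n - f₀) p μ) atTop (𝓝 0)) :
    Tendsto (fun n => ∫ x, f n x * g x ∂μ) atTop (𝓝 (∫ x, f₀ x * g x ∂μ)) := by
  rw [tendsto_iff_edist_tendsto_0]
  have hlim : Tendsto (fun n => eLpNorm (f n - f₀) p μ * eLpNorm g q μ) atTop (𝓝 0) := by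
    simpa using ENNReal.Tendsto.mul_const h (Or.inr hg.2.ne)
  refine tendsto_of_tendsto_of_tendsto_of_le_of_le tendsto_const_nhds hlim (fun _ => zero_le) fun n => ?_
  have i1 : Integrable (fun x => f n x * g x) μ := memLp_one_iff_integrable.mp ((hg.mul (hf n)))
  have i2 : Integrable (fun x => f₀ x * g x) μ := memLp_one_iff_integrable.mp (hg.mul hf₀)
  simp only
  rw [edist_eq_enorm_sub, ← integral_sub i1 i2]
  calc _ ≤ ∫⁻ x, ‖f n x * g x - f₀ x * g x‖ₑ ∂μ := enorm_integral_le_lintegral_enorm _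
    _ = eLpNorm ((f n - f₀) • g) 1 μ := by
        rw [eLpNorm_one_eq_lintegral_enorm]
        congr 1; funext x; simp [sub_mul]
    _ ≤ _ := eLpNorm_smul_le_mul_eLpNorm hg.1 ((hf n).sub hf₀).1

theorem IsTest.memLp {Ω : Set E3} {ζ : E3 → ℝ} (h : IsTest Ω ζ) (p : ℝ≥0∞) : MemLp ζ p :=
  h.1.continuous.memLp_of_hasCompactSupport h.2.1

theorem IsTest.memLp_partialD {Ω : Set E3} {ζ : E3 → ℝ} (h : IsTest Ω ζ) (i : Fin 3) (p : ℝ≥0∞) :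
    MemLp (partialD i ζ) p :=
  (h.isTest_partialD i).memLp p

theorem IsTest.sub {ζ ξ : E3 → ℝ} (h : IsTest univ ζ) (h' : IsTest univ ξ) :
    IsTest univ (ζ - ξ) :=
  ⟨h.1.sub h'.1, by simpa using h.2.1.sub h'.2.1, subset_univ _⟩

theorem IsTest.partialD_sub {ζ ξ : E3 → ℝ} (h : IsTest univ ζ) (h' : IsTest univ ξ) (i : Fin 3) :
    partialD i (ζ - ξ) = partialD i ζ - partialD i ξ := by
  funext x
  simp only [partialD, Pi.sub_apply]
  rw [fderiv_sub (h.1.differentiable (by simp) x) (h'.1.differentiable (by simp) x)]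
  simp

/-- The Sobolev inequality in terms of partial derivatives. -/
theorem exists_sobolev_const : ∃ C : NNReal, ∀ ζ : E3 → ℝ, IsTest univ ζ →
    eLpNorm ζ 6 ≤ C * ∑ i, eLpNorm (partialD i ζ) 2 := by
  refine ⟨SNormLESNormFDerivOfEqConst ℝ (volume : Measure E3) ((2 : NNReal) : ℝ), fun ζ hζ => ?_⟩
  have h := eLpNorm_le_eLpNorm_fderiv_of_eq (volume : Measure E3) (u := ζ) (hζ.1.of_le (by simp))
    hζ.2.1 (p := 2) (p' := 6) (by norm_num) (by simp) (by simp; norm_num)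
  refine h.trans (mul_le_mul' le_rfl ?_)
  have hb : ∀ x, ‖fderiv ℝ ζ x‖ ≤ ‖∑ i, |partialD i ζ x|‖ := by
    intro x
    have h0 : 0 ≤ ∑ i, |partialD i ζ x| := Finset.sum_nonneg fun _ _ => abs_nonneg _
    rw [Real.norm_of_nonneg h0]
    refine ContinuousLinearMap.opNorm_le_bound _ h0 fun w => ?_
    rw [fderiv_apply_eq_sum, Real.norm_eq_abs, Finset.sum_mul]
    refine (Finset.abs_sum_le_sum_abs _ _).trans (Finset.sum_le_sum fun i _ => ?_)
    rw [abs_mul, mul_comm]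
    exact mul_le_mul_of_nonneg_left (PiLp.norm_apply_le w i) (abs_nonneg _)
  calc eLpNorm (fderiv ℝ ζ) ((2 : NNReal) : ℝ≥0∞) volume
      ≤ eLpNorm (fun x => ∑ i, |partialD i ζ x|) 2 volume := by
        simpa using eLpNorm_mono (p := 2) hb
    _ = eLpNorm (∑ i, fun x => |partialD i ζ x|) 2 volume := by
        congr 1
    _ ≤ ∑ i, eLpNorm (fun x => |partialD i ζ x|) 2 volume :=
        eLpNorm_sum_le (fun i _ => (hζ.memLp_partialD i 2).abs.1) (by norm_num)
    _ = ∑ i, eLpNorm (partialD i ζ) 2 volume := by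
        congr 1; funext i; exact eLpNorm_norm (partialD i ζ)

theorem fact_one_le_six : Fact ((1 : ℝ≥0∞) ≤ 6) := ⟨by norm_num⟩

attribute [local instance] fact_one_le_six

/-- Weak derivatives pass to limits of test functions. -/
theorem hasWeakPartial_of_tendsto {ζ : ℕ → E3 → ℝ} (hζ : ∀ n, IsTest univ (ζ n)) {U v : E3 → ℝ}
    (hU : MemLp U 6) (hv : MemLp v 2) (i : Fin 3)
    (h1 : Tendsto (fun n => eLpNorm (ζ n - U) 6 volume) atTop (𝓝 0))
    (h2 : Tendsto (fun n => eLpNorm (partialD i (ζ n) - v) 2 volume) atTop (𝓝 0)) :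
    HasWeakPartial univ i U v := by
  refine ⟨(hU.locallyIntegrable (by norm_num)).locallyIntegrableOn _,
    (hv.locallyIntegrable one_le_two).locallyIntegrableOn _, fun φ hφ => ?_⟩
  simp only [Measure.restrict_univ]
  have l1 := tendsto_integral_mul_of_eLpNorm (q := ENNReal.conjExponent 6)
    (fun n => (hζ n).memLp 6) hU (hφ.memLp_partialD i _) h1
  have l2 := tendsto_integral_mul_of_eLpNorm (q := ENNReal.conjExponent 2)
    (fun n => (hζ n).memLp_partialD i 2) hv (hφ.memLp _) h2
  refine tendsto_nhds_unique l1 (l2.neg.congr fun n => ?_)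
  have := (hasWeakPartial_of_contDiff univ i ((hζ n).1.of_le (m := 1) (by simp))).2.2 φ hφ
  simp only [Measure.restrict_univ] at this
  linarith

/-- The weighted gradient of a function. -/
def gradW (s : Fin 3 → ℝ) (ζ : E3 → ℝ) (x : E3) : E3 := WithLp.toLp 2 fun i => s i * partialD i ζ x

theorem IsTest.memLp_gradW {ζ : E3 → ℝ} (h : IsTest univ ζ) (s : Fin 3 → ℝ) :
    MemLp (gradW s ζ) 2 :=
  memLp_piLp_iff.mpr fun i => (h.memLp_partialD i 2).const_mul (s i)

/-- The space of weighted gradients of test functions. -/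
def gradSpace (s : Fin 3 → ℝ) : Submodule ℝ (Lp E3 2 (volume : Measure E3)) where
  carrier := {f | ∃ ζ, IsTest univ ζ ∧ f =ᵐ[volume] gradW s ζ}
  zero_mem' := by
    refine ⟨fun _ => 0, ⟨contDiff_const, HasCompactSupport.zero, subset_univ _⟩, ?_⟩
    filter_upwards [Lp.coeFn_zero E3 2 (volume : Measure E3)] with x hx
    rw [hx]; ext i; simp [gradW, partialD]
  add_mem' := by
    rintro f g ⟨ζ, hζ, hf⟩ ⟨ξ, hξ, hg⟩
    refine ⟨ζ + ξ, ⟨hζ.1.add hξ.1, hζ.2.1.add hξ.2.1, subset_univ _⟩, ?_⟩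
    filter_upwards [Lp.coeFn_add f g, hf, hg] with x h1 h2 h3
    rw [h1, Pi.add_apply, h2, h3]; ext i
    simp [gradW, partialD, fderiv_add (hζ.1.differentiable (by simp) x)
      (hξ.1.differentiable (by simp) x), mul_add]
  smul_mem' := by
    rintro c f ⟨ζ, hζ, hf⟩
    refine ⟨c • ζ, ⟨contDiff_const.smul hζ.1, hζ.2.1.smul_left (f := fun _ => c), subset_univ _⟩, ?_⟩
    filter_upwards [Lp.coeFn_smul c f, hf] with x h1 h2
    rw [h1, Pi.smul_apply, h2]; ext i
    simp [gradW, partialD, fderiv_const_smul (hζ.1.differentiable (by simp) x) c]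
    ring

theorem MemHomSobolev.exists_grad {U : E3 → ℝ} (hU : MemHomSobolev U) :
    ∃ ζ : ℕ → E3 → ℝ, (∀ n, IsTest univ (ζ n)) ∧
      Tendsto (fun n => eLpNorm (ζ n - U) 6 volume) atTop (𝓝 0) ∧
      (∀ i, MemLp (weakPartial univ i U) 2) ∧
      ∀ i, Tendsto (fun n => eLpNorm (partialD i (ζ n) - weakPartial univ i U) 2 volume) atTop (𝓝 0) := by
  obtain ⟨-, ζ, h1, h2, h3⟩ := hU
  choose v hv1 hv2 hv3 using h3
  have e : ∀ i, weakPartial univ i U =ᵐ[volume] v i := fun i => by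
    have := (hv1 i).weakPartial_ae_eq isOpen_univ
    rwa [Measure.restrict_univ] at this
  refine ⟨ζ, h1, h2, fun i => (memLp_congr_ae (e i)).mpr (hv2 i), fun i => ?_⟩
  refine (hv3 i).congr fun n => eLpNorm_congr_ae ?_
  exact EventuallyEq.rfl.sub (e i).symm

/-- The gradient w of U - V is orthogonal, in the weighted inner product, to the gradients of all
test functions, and it is an L² limit of such gradients. So w is orthogonal to itself and vanishes.
The Sobolev inequality applied to the approximants then carries this from the gradients to U - V in
L⁶, which also excludes additive constants. -/
theorem potential_unique {s : Fin 3 → ℝ} (hs : ∀ i, 0 < s i) {U V : E3 → ℝ}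
    (hU : MemHomSobolev U) (hV : MemHomSobolev V)
    (h : ∀ ζ, IsTest univ ζ →
      ∫ x, ∑ i, (s i * weakPartial univ i U x) * (s i * partialD i ζ x) =
        ∫ x, ∑ i, (s i * weakPartial univ i V x) * (s i * partialD i ζ x)) :
    U =ᵐ[volume] V := by
  obtain ⟨ζ, z1, z2, z3, z4⟩ := hU.exists_grad
  obtain ⟨ξ, x1, x2, x3, x4⟩ := hV.exists_grad
  set w : Fin 3 → E3 → ℝ := fun i => weakPartial univ i U - weakPartial univ i V with hw
  have mw : ∀ i, MemLp (w i) 2 := fun i => (z3 i).sub (x3 i)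
  have td : ∀ n, IsTest univ (ζ n - ξ n) := fun n => (z1 n).sub (x1 n)
  have tw : ∀ i, Tendsto (fun n => eLpNorm (partialD i (ζ n - ξ n) - w i) 2 volume) atTop (𝓝 0) := by
    intro i
    have hsum := (z4 i).add (x4 i)
    rw [add_zero] at hsum
    refine tendsto_of_tendsto_of_tendsto_of_le_of_le tendsto_const_nhds hsum (fun _ => zero_le) fun n => ?_
    have e : partialD i (ζ n - ξ n) - w i = (partialD i (ζ n) - weakPartial univ i U) -
        (partialD i (ξ n) - weakPartial univ i V) := by
      rw [(z1 n).partialD_sub (x1 n)]; simp only [hw]; abel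
    rw [e]
    exact eLpNorm_sub_le (((z1 n).memLp_partialD i 2).sub (z3 i)).1
      (((x1 n).memLp_partialD i 2).sub (x3 i)).1 (by norm_num)
  have orth : ∀ n, ∑ i, s i ^ 2 * ∫ x, partialD i (ζ n - ξ n) x * w i x = 0 := by
    intro n
    have e := h _ (td n)
    have iU : ∀ i, Integrable (fun x => (s i * weakPartial univ i U x) * (s i * partialD i (ζ n - ξ n) x)) :=
      fun i => ((z3 i).const_mul (s i)).integrable_mul (((td n).memLp_partialD i 2).const_mul (s i))
    have iV : ∀ i, Integrable (fun x => (s i * weakPartial univ i V x) * (s i * partialD i (ζ n - ξ n) x)) :=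
      fun i => ((x3 i).const_mul (s i)).integrable_mul (((td n).memLp_partialD i 2).const_mul (s i))
    rw [integral_finsetSum _ (fun i _ => iU i), integral_finsetSum _ (fun i _ => iV i), ← sub_eq_zero,
      ← Finset.sum_sub_distrib] at e
    rw [← e]
    refine Finset.sum_congr rfl fun i _ => ?_
    rw [← integral_const_mul, ← integral_sub (iU i) (iV i)]
    congr 1; funext x; simp only [hw, Pi.sub_apply]; ring
  have lim : Tendsto (fun n => ∑ i, s i ^ 2 * ∫ x, partialD i (ζ n - ξ n) x * w i x) atTop
      (𝓝 (∑ i, s i ^ 2 * ∫ x, w i x * w i x)) := by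
    refine tendsto_finsetSum _ fun i _ => Tendsto.const_mul _ ?_
    exact tendsto_integral_mul_of_eLpNorm (p := 2) (q := 2) (fun n => (td n).memLp_partialD i 2) (mw i) (mw i) (tw i)
  simp only [orth] at lim
  have z := tendsto_nhds_unique lim tendsto_const_nhds
  have w0 : ∀ i, w i =ᵐ[volume] 0 := by
    have hnn : ∀ i, 0 ≤ s i ^ 2 * ∫ x, w i x * w i x := fun i =>
      mul_nonneg (sq_nonneg _) (integral_nonneg fun x => mul_self_nonneg _)
    intro i
    have := (Finset.sum_eq_zero_iff_of_nonneg (fun i _ => hnn i)).mp z i (Finset.mem_univ i)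
    have h0 : ∫ x, w i x * w i x = 0 := by
      rcases mul_eq_zero.mp this with h | h
      · exact absurd h (pow_ne_zero 2 (hs i).ne')
      · exact h
    have := (integral_eq_zero_iff_of_nonneg (fun x => mul_self_nonneg (w i x))
      ((mw i).integrable_mul (mw i))).mp h0
    filter_upwards [this] with x hx
    exact mul_self_eq_zero.mp hx
  obtain ⟨C, hC⟩ := exists_sobolev_const
  have t0 : Tendsto (fun n => eLpNorm (ζ n - ξ n) 6 volume) atTop (𝓝 0) := by
    have hlim : Tendsto (fun n => C * ∑ i, eLpNorm (partialD i (ζ n - ξ n)) 2 volume) atTop (𝓝 0) := by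
      have : Tendsto (fun n => ∑ i, eLpNorm (partialD i (ζ n - ξ n)) 2 volume) atTop (𝓝 0) := by
        rw [show (0 : ℝ≥0∞) = ∑ i : Fin 3, 0 by simp]
        refine tendsto_finsetSum _ fun i _ => (tw i).congr fun n => eLpNorm_congr_ae ?_
        filter_upwards [w0 i] with x hx
        simp [hx]
      simpa using ENNReal.Tendsto.const_mul this (Or.inr ENNReal.coe_ne_top)
    exact tendsto_of_tendsto_of_tendsto_of_le_of_le tendsto_const_nhds hlim (fun _ => zero_le)
      fun n => hC _ (td n)
  have hle : ∀ n, eLpNorm (U - V) 6 volume ≤ eLpNorm (ζ n - U) 6 volume + eLpNorm (ξ n - V) 6 volume +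
      eLpNorm (ζ n - ξ n) 6 volume := by
    intro n
    have mU := ((z1 n).memLp 6).sub hU.1
    have mV := ((x1 n).memLp 6).sub hV.1
    have e : U - V = (ξ n - V) - (ζ n - U) + (ζ n - ξ n) := by abel
    rw [e]
    refine (eLpNorm_add_le (mV.sub mU).1 ((td n).memLp 6).1 (by norm_num)).trans ?_
    gcongr
    rw [add_comm]
    exact eLpNorm_sub_le mV.1 mU.1 (by norm_num)
  have hz : eLpNorm (U - V) 6 volume ≤ 0 := by
    have := (z2.add x2).add t0
    simp only [add_zero] at this
    exact ge_of_tendsto' this hle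
  have := (eLpNorm_eq_zero_iff (hU.1.sub hV.1).1 (by norm_num)).mp (le_antisymm hz zero_le)
  filter_upwards [this] with x hx
  exact sub_eq_zero.mp hx

/-- Solvability of `div_s ∇_s U = div_s f` for square integrable `f`. -/
theorem exists_potential {s : Fin 3 → ℝ} (hs : ∀ i, 0 < s i) {f : Fin 3 → E3 → ℝ}
    (hf : ∀ i, MemLp (f i) 2) :
    ∃ U, MemHomSobolev U ∧ (∀ ζ, IsTest univ ζ →
      ∫ x, ∑ i, (s i * weakPartial univ i U x) * (s i * partialD i ζ x) =
        ∫ x, ∑ i, f i x * (s i * partialD i ζ x)) ∧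
      ∫ x, ∑ i, (s i * weakPartial univ i U x) ^ 2 ≤ ∫ x, ∑ i, f i x ^ 2 := by
  have mf : MemLp (fun x => (WithLp.toLp 2 fun i => f i x : E3)) 2 := memLp_piLp_iff.mpr hf
  set F := mf.toLp _ with hF
  set K := (gradSpace s).topologicalClosure with hK
  have : CompleteSpace K := (gradSpace s).isClosed_topologicalClosure.completeSpace_coe
  -- The weighted gradient of the potential is the orthogonal projection of f onto the closure of
  -- the gradients of test functions. The weak equation is the orthogonality of the residual, and
  -- the energy bound is the contractivity of the projection.
  set v : Lp E3 2 (volume : Measure E3) := K.starProjection F with hv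
  have hvK : v ∈ K := Submodule.starProjection_apply_mem K F
  obtain ⟨g, hg, hgv⟩ := mem_closure_iff_seq_limit.mp
    (show v ∈ closure (gradSpace s : Set (Lp E3 2 (volume : Measure E3))) from hvK)
  choose ζ hζ hgζ using hg
  have hcoord : ∀ (a b : E3) (i : Fin 3), ‖a i - b i‖ ≤ ‖a - b‖ := fun a b i => PiLp.norm_apply_le (a - b) i
  have hgv' := (Lp.tendsto_Lp_iff_tendsto_eLpNorm' _ _).mp hgv
  set vi : Fin 3 → E3 → ℝ := fun i x => (s i)⁻¹ * (v x) i with hvi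
  have mvc : ∀ i, MemLp (fun x => (v x) i) 2 := fun i => memLp_piLp_iff.mp (Lp.memLp v) i
  have mvi : ∀ i, MemLp (vi i) 2 := fun i => (mvc i).const_mul _
  have tvi : ∀ i, Tendsto (fun n => eLpNorm (partialD i (ζ n) - vi i) 2 volume) atTop (𝓝 0) := by
    intro i
    have hlim : Tendsto (fun n => ENNReal.ofReal (s i)⁻¹ * eLpNorm (⇑(g n) - ⇑v) 2 volume) atTop (𝓝 0) := by
      simpa using ENNReal.Tendsto.const_mul hgv' (Or.inr ENNReal.ofReal_ne_top)
    refine tendsto_of_tendsto_of_tendsto_of_le_of_le tendsto_const_nhds hlim (fun _ => zero_le) fun n => ?_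
    refine eLpNorm_le_mul_eLpNorm_of_ae_le_mul ?_ 2
    filter_upwards [hgζ n] with x hx
    have h1 := hcoord (g n x) (v x) i
    rw [hx] at h1
    simp only [gradW] at h1
    have h2 : partialD i (ζ n) x - vi i x = (s i)⁻¹ * (s i * partialD i (ζ n) x - v x i) := by
      simp only [hvi]; field_simp [(hs i).ne']
    rw [Pi.sub_apply, Pi.sub_apply, h2, norm_mul, Real.norm_of_nonneg (inv_nonneg.mpr (hs i).le), hx]
    exact mul_le_mul_of_nonneg_left h1 (inv_nonneg.mpr (hs i).le)
  obtain ⟨C, hC⟩ := exists_sobolev_const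
  -- The gradients of the ζₙ converge in L², so by Sobolev the ζₙ themselves are Cauchy in L⁶. Their
  -- limit is the potential.
  have hcau : CauchySeq fun n => ((hζ n).memLp 6).toLp (ζ n) := by
    rw [Lp.cauchySeq_Lp_iff_cauchySeq_eLpNorm]
    have hb : Tendsto (fun n : ℕ × ℕ => (C : ℝ≥0∞) * ∑ i, (eLpNorm (partialD i (ζ n.1) - vi i) 2 volume +
        eLpNorm (partialD i (ζ n.2) - vi i) 2 volume)) atTop (𝓝 0) := by
      have : Tendsto (fun n : ℕ × ℕ => ∑ i, (eLpNorm (partialD i (ζ n.1) - vi i) 2 volume +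
        eLpNorm (partialD i (ζ n.2) - vi i) 2 volume)) atTop (𝓝 (∑ i : Fin 3, (0 + 0))) := by
        refine tendsto_finsetSum _ fun i _ => ?_
        rw [← prod_atTop_atTop_eq]
        exact ((tvi i).comp tendsto_fst).add ((tvi i).comp tendsto_snd)
      simp only [add_zero, Finset.sum_const_zero] at this
      simpa using ENNReal.Tendsto.const_mul this (Or.inr ENNReal.coe_ne_top)
    refine tendsto_of_tendsto_of_tendsto_of_le_of_le tendsto_const_nhds hb (fun _ => zero_le) fun n => ?_
    have e : eLpNorm (⇑(((hζ n.1).memLp 6).toLp (ζ n.1)) - ⇑(((hζ n.2).memLp 6).toLp (ζ n.2))) 6 volume =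
        eLpNorm (ζ n.1 - ζ n.2) 6 volume :=
      eLpNorm_congr_ae (((hζ n.1).memLp 6).coeFn_toLp.sub ((hζ n.2).memLp 6).coeFn_toLp)
    simp only
    rw [e]
    refine (hC _ ((hζ n.1).sub (hζ n.2))).trans ?_
    gcongr with i
    have e2 : partialD i (ζ n.1 - ζ n.2) = (partialD i (ζ n.1) - vi i) - (partialD i (ζ n.2) - vi i) := by
      rw [(hζ n.1).partialD_sub (hζ n.2)]; abel
    rw [e2]
    exact eLpNorm_sub_le (((hζ n.1).memLp_partialD i 2).sub (mvi i)).1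
      (((hζ n.2).memLp_partialD i 2).sub (mvi i)).1 (by norm_num)
  obtain ⟨UL, hUL⟩ := cauchySeq_tendsto_of_complete hcau
  have mU : MemLp (UL : E3 → ℝ) 6 := Lp.memLp UL
  have tU : Tendsto (fun n => eLpNorm (ζ n - ⇑UL) 6 volume) atTop (𝓝 0) := by
    refine ((Lp.tendsto_Lp_iff_tendsto_eLpNorm' _ _).mp hUL).congr fun n => eLpNorm_congr_ae ?_
    exact ((hζ n).memLp 6).coeFn_toLp.sub EventuallyEq.rfl
  have wU : ∀ i, HasWeakPartial univ i UL (vi i) := fun i =>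
    hasWeakPartial_of_tendsto hζ mU (mvi i) i tU (tvi i)
  have eU : ∀ i, ∀ᵐ x, s i * weakPartial univ i UL x = v x i := by
    intro i
    have := (wU i).weakPartial_ae_eq isOpen_univ
    rw [Measure.restrict_univ] at this
    filter_upwards [this] with x hx
    rw [hx]; simp only [hvi]; field_simp [(hs i).ne']
  have eU' : ∀ᵐ x, ∀ i, s i * weakPartial univ i UL x = v x i := ae_all_iff.mpr eU
  refine ⟨UL, ⟨mU, ζ, hζ, tU, fun i => ⟨vi i, wU i, mvi i, tvi i⟩⟩, fun φ hφ => ?_, ?_⟩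
  · have mφ := hφ.memLp_gradW s
    have hφK : mφ.toLp _ ∈ K := subset_closure ⟨φ, hφ, mφ.coeFn_toLp⟩
    have ho := Submodule.starProjection_inner_eq_zero (K := K) F (mφ.toLp _) hφK
    rw [inner_sub_left, sub_eq_zero, L2.inner_def, L2.inner_def] at ho
    calc _ = ∫ x, inner ℝ (v x) ((mφ.toLp _ : Lp E3 2 volume) x) := by
          apply integral_congr_ae
          filter_upwards [eU', mφ.coeFn_toLp] with x h1 h2
          rw [h2, PiLp.inner_apply]
          simp only [h1, gradW]
          exact Finset.sum_congr rfl fun i _ => by simp [mul_comm]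
      _ = ∫ x, inner ℝ (F x) ((mφ.toLp _ : Lp E3 2 volume) x) := ho.symm
      _ = _ := by
          apply integral_congr_ae
          filter_upwards [mf.coeFn_toLp, mφ.coeFn_toLp] with x h1 h2
          rw [h2, hF, h1, PiLp.inner_apply]
          simp only [gradW]
          exact Finset.sum_congr rfl fun i _ => by simp [mul_comm]
  · have hn : ‖v‖ ^ 2 ≤ ‖F‖ ^ 2 := by
      gcongr; exact Submodule.norm_starProjection_apply_le K F
    rw [← real_inner_self_eq_norm_sq, ← real_inner_self_eq_norm_sq, L2.inner_def, L2.inner_def] at hn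
    calc _ = ∫ x, inner ℝ (v x) (v x) := by
          apply integral_congr_ae
          filter_upwards [eU'] with x h1
          rw [PiLp.inner_apply]
          exact Finset.sum_congr rfl fun i _ => by simp [h1, pow_two]
      _ ≤ ∫ x, inner ℝ (F x) (F x) := hn
      _ = _ := by
          apply integral_congr_ae
          filter_upwards [mf.coeFn_toLp] with x h1
          rw [hF, h1, PiLp.inner_apply]
          exact Finset.sum_congr rfl fun i _ => by simp [pow_two]

/-! ### The stray field of an admissible map -/

/-- Physically meaningful parameters. -/
def WireParams.Good (p : WireParams) : Prop :=
  0 < p.R ∧ 0 < p.L ∧ 0 < p.d ∧ 0 < p.Q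

theorem WireParams.Good.rho_pos {p : WireParams} (hp : p.Good) : 0 < p.rho :=
  div_pos hp.2.2.1 (Real.sqrt_pos.mpr hp.2.2.2)

theorem WireParams.Good.eta_pos {p : WireParams} (hp : p.Good) : 0 < p.eta :=
  div_pos hp.1 hp.rho_pos

theorem WireParams.Good.len_pos {p : WireParams} (hp : p.Good) : 0 < p.len :=
  div_pos hp.2.1 hp.rho_pos

theorem WireParams.Good.sc_pos {p : WireParams} (hp : p.Good) (i : Fin 3) : 0 < p.sc i := by
  unfold WireParams.sc
  split_ifs
  · exact one_pos
  · exact one_div_pos.mpr hp.eta_pos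

/-- The source of the stray field. -/
def straySource (p : WireParams) (m : E3 → E3) (i : Fin 3) : E3 → ℝ :=
  (cylFin p.len).indicator fun x => 1 / p.eta * m x i

theorem memLp_straySource (p : WireParams) {m : E3 → E3} (hm : m ∈ FiniteMaps) (i : Fin 3) :
    MemLp (straySource p m i) 2 := by
  rw [straySource, memLp_indicator_iff_restrict (measurableSet_cylFin _)]
  have : IsFiniteMeasure (volume.restrict (cylFin p.len)) :=
    ⟨by simpa using measure_cylFin_lt_top p.len⟩
  have h := ((FiniteMaps.memLp_top hm i).mono_measure
    (Measure.restrict_mono_set volume (cylFin_subset p.len))).mono_exponent (p := 2) le_top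
  exact h.const_mul _

theorem integral_straySource (p : WireParams) (m : E3 → E3) (w : Fin 3 → E3 → ℝ) :
    ∫ x, ∑ i, straySource p m i x * w i x = 1 / p.eta * ∫ x in cylFin p.len, ∑ i, m x i * w i x := by
  rw [← integral_const_mul, ← integral_indicator (measurableSet_cylFin _)]
  congr 1; funext x
  by_cases hx : x ∈ cylFin p.len
  · simp only [straySource, indicator_of_mem hx, Finset.mul_sum, mul_assoc]
  · simp [straySource, indicator_of_notMem hx]

theorem exists_isStrayPotential {p : WireParams} (hp : p.Good) {m : E3 → E3} (hm : m ∈ FiniteMaps) :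
    ∃ U, IsStrayPotential p m U ∧ (∀ V, IsStrayPotential p m V → V =ᵐ[volume] U) ∧
      ∫ x, ∑ i, (p.sc i * weakPartial univ i U x) ^ 2 ≤ ∫ x, ∑ i, straySource p m i x ^ 2 := by
  obtain ⟨U, hU, h1, h2⟩ := exists_potential hp.sc_pos (memLp_straySource p hm)
  have hs : IsStrayPotential p m U := ⟨hU, fun ζ hζ => by
    rw [h1 ζ hζ]; exact integral_straySource p m fun i x => p.sc i * partialD i ζ x⟩
  refine ⟨U, hs, fun V hV => potential_unique hp.sc_pos hV.1 hU fun ζ hζ => ?_, h2⟩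
  rw [hV.2 ζ hζ, hs.2 ζ hζ]

theorem strayEnergy_nonneg (p : WireParams) (m : E3 → E3) : 0 ≤ strayEnergy p m :=
  mul_nonneg (by positivity) (integral_nonneg fun _ => Finset.sum_nonneg fun _ _ => sq_nonneg _)

/-- The potential has at most the energy of its source. As |m| = 1, the source contributes η⁻² times
the volume of the finite cylinder, and η = R/ρ cancels the prefactor R². The bound does not depend
on m. -/
theorem strayEnergy_le {p : WireParams} (hp : p.Good) {m : E3 → E3} (hm : m ∈ FiniteMaps) :
    strayEnergy p m ≤ 2 * area * (p.rho * p.L / p.d ^ 2) := by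
  obtain ⟨U, h1, h2, h3⟩ := exists_isStrayPotential hp hm
  have hex : ∃ U, IsStrayPotential p m U := ⟨U, h1⟩
  have hspec : IsStrayPotential p m (strayPotential p m) := by
    rw [strayPotential, dif_pos hex]; exact hex.choose_spec
  have hae := h2 _ hspec
  -- `strayPotential` is an arbitrary choice among the solutions. Uniqueness identifies it with the
  -- U for which the energy bound is known, and almost everywhere equality passes to weak
  -- derivatives.
  have hw : ∀ᵐ x, ∀ i, weakPartial univ i (strayPotential p m) x = weakPartial univ i U x := by
    rw [ae_all_iff]
    intro i
    obtain ⟨-, ζ, -, -, h⟩ := hspec.1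
    obtain ⟨v, hv, -⟩ := h i
    have := weakPartial_congr isOpen_univ (i := i) (u := strayPotential p m) (u' := U)
      (by rwa [Measure.restrict_univ]) ⟨v, hv⟩
    rwa [Measure.restrict_univ] at this
  have e1 : ∫ x, ∑ i, (p.sc i * weakPartial univ i (strayPotential p m) x) ^ 2 =
      ∫ x, ∑ i, (p.sc i * weakPartial univ i U x) ^ 2 :=
    integral_congr_ae (hw.mono fun x hx => by simp only [hx])
  have e2 : ∫ x, ∑ i, straySource p m i x ^ 2 = (1 / p.eta) ^ 2 * (area * (2 * p.len)) := by
    have : ∀ᵐ x, ∑ i, straySource p m i x ^ 2 = (cylFin p.len).indicator (fun _ => (1 / p.eta) ^ 2) x := by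
      have hs := FiniteMaps.sq_sum hm
      rw [ae_restrict_iff' measurableSet_cyl] at hs
      filter_upwards [hs] with x hx
      by_cases h : x ∈ cylFin p.len
      · have := hx h.1
        simp only [straySource, indicator_of_mem h, Fin.sum_univ_three, mul_pow]
        rw [← mul_add, ← mul_add, this, mul_one]
      · simp [straySource, h]
    rw [integral_congr_ae this, integral_indicator (measurableSet_cylFin _), setIntegral_const,
      smul_eq_mul, mul_comm, Measure.real, measure_cylFin, ENNReal.toReal_mul,
      ENNReal.toReal_ofReal (by linarith [hp.len_pos])]
    rfl
  rw [strayEnergy, e1]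
  have hη := hp.eta_pos
  have hρ := hp.rho_pos
  have hR := hp.1
  have hd := hp.2.2.1
  calc p.R ^ 2 / p.d ^ 2 * ∫ x, ∑ i, (p.sc i * weakPartial univ i U x) ^ 2
      ≤ p.R ^ 2 / p.d ^ 2 * ((1 / p.eta) ^ 2 * (area * (2 * p.len))) := by
        rw [← e2]; gcongr
    _ = 2 * area * (p.rho * p.L / p.d ^ 2) := by
        rw [WireParams.eta, WireParams.len]
        field_simp

/-! ### Admissible maps outside the finite cylinder -/

/-- Beyond the ends, m' vanishes on an open set, hence so do its weak derivatives. There m₁² = 1, so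
the tangentiality m · ∂ᵢm = 0 reduces to m₁ ∂ᵢm₁ = 0 and kills the first component as well. -/
theorem Adm.dm_ae_eq_zero {p : WireParams} {m : E3 → E3} (hm : m ∈ Adm p) :
    ∀ᵐ x ∂volume.restrict cyl, p.len ≤ |x 0| → ∀ i j, dm i m x j = 0 := by
  have hf := hm.1
  set Ω' : Set E3 := cyl ∩ {x | p.len < |x 0|} with hΩ'
  have ho : IsOpen Ω' := isOpen_cyl.inter
    (isOpen_lt continuous_const (by fun_prop : Continuous fun x : E3 => |x 0|))
  have h12 : ∀ i j, j ≠ 0 → ∀ᵐ x ∂volume.restrict cyl, p.len < |x 0| → dm i m x j = 0 := by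
    intro i j hj
    have h1 : HasWeakPartial Ω' i (fun x => m x j) (fun x => dm i m x j) :=
      (FiniteMaps.hasWeakPartial hf i j).mono inter_subset_left
    have hz := hm.2
    rw [ae_restrict_iff' measurableSet_cyl] at hz
    have h2 : (fun x => m x j) =ᵐ[volume.restrict Ω'] fun _ => 0 := by
      rw [EventuallyEq, ae_restrict_iff' ho.measurableSet]
      filter_upwards [hz] with x hx hxΩ
      have hxx := hx hxΩ.1 (le_of_lt hxΩ.2)
      fin_cases j
      · exact absurd rfl hj
      · exact hxx.1
      · exact hxx.2
    have h3 := (h1.congr h2 EventuallyEq.rfl).unique ho (hasWeakPartial_const Ω' i 0)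
    rw [EventuallyEq, ae_restrict_iff' ho.measurableSet] at h3
    rw [ae_restrict_iff' measurableSet_cyl]
    filter_upwards [h3] with x hx hxc hxl using hx ⟨hxc, hxl⟩
  -- Weak derivatives are local only on open sets, so the closed condition `p.len ≤ |x 0|` is
  -- replaced by the strict one. The two end sections are null sets.
  have hne : ∀ᵐ x ∂volume.restrict cyl, |x 0| ≠ p.len := by
    have h1 : ∀ᵐ t : ℝ, |t| ≠ p.len := by
      have hs : {t : ℝ | ¬ |t| ≠ p.len} ⊆ {p.len, -p.len} := by
        intro t ht
        simp only [mem_ofPred_eq, not_not] at ht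
        rcases abs_choice t with h | h
        · left; rw [← ht, h]
        · right; rw [mem_singleton_iff]; linarith
      exact measure_mono_null hs ((Set.toFinite _).measure_zero _)
    exact ae_cyl_of_ae h1
  have h12' : ∀ᵐ x ∂volume.restrict cyl, ∀ i j, j ≠ 0 → p.len < |x 0| → dm i m x j = 0 := by
    rw [ae_all_iff]; intro i
    rw [ae_all_iff]; intro j
    by_cases hj : j = 0
    · simp [hj]
    · filter_upwards [h12 i j hj] with x hx _ using hx
  filter_upwards [h12', hne, ae_all_iff.mpr (FiniteMaps.inner_dm hf), FiniteMaps.sq_sum hf, hm.2]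
    with x h1 h2 h3 h4 h5 hx i j
  have hlt : p.len < |x 0| := lt_of_le_of_ne hx h2.symm
  by_cases hj : j = 0
  · subst hj
    have h6 := h3 i
    obtain ⟨h7, h8⟩ := h5 hx
    rw [h7, h8] at h4
    rw [h7, h8] at h6
    have : m x 0 ≠ 0 := fun h => by rw [h] at h4; norm_num at h4
    simpa [this] using h6
  · exact h1 i j hj hlt

theorem integrableOn_of_support_cylFin {f : E3 → ℝ} {a : ℝ} (hf : MemLp f 2 (volume.restrict cyl))
    (h0 : ∀ᵐ x ∂volume.restrict cyl, a ≤ |x 0| → f x = 0) : IntegrableOn f cyl := by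
  have : IsFiniteMeasure (volume.restrict (cylFin a)) := ⟨by simpa using measure_cylFin_lt_top a⟩
  have h1 : IntegrableOn f (cylFin a) :=
    (hf.mono_measure (Measure.restrict_mono_set volume (cylFin_subset a))).integrable one_le_two
  have h2 : Integrable ((cylFin a).indicator f) := h1.integrable_indicator (measurableSet_cylFin a)
  refine h2.integrableOn.congr ?_
  rw [ae_restrict_iff' measurableSet_cyl] at h0
  rw [EventuallyEq, ae_restrict_iff' measurableSet_cyl]
  filter_upwards [h0] with x hx hxc
  by_cases h : x ∈ cylFin a
  · simp [h]
  · rw [indicator_of_notMem h, hx hxc]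
    by_contra hh
    exact h ⟨hxc, not_le.mp hh⟩

/-- For k = 0 the factor m₁ is only bounded, so the product is not automatically integrable on the
infinite cylinder. It is integrable here because the derivative lives on a set of finite measure,
where L² embeds into L¹. -/
theorem Adm.integrableOn_dm_mul {p : WireParams} {m : E3 → E3} (hm : m ∈ Adm p) (i j k : Fin 3) :
    IntegrableOn (fun x => dm i m x j * m x k) cyl := by
  have h1 := integrableOn_of_support_cylFin (FiniteMaps.memLp_dm hm.1 i j)
    ((Adm.dm_ae_eq_zero hm).mono fun x hx h => hx h i j)
  have := h1.bdd_mul (c := 1) (FiniteMaps.memLp_top hm.1 k).1 (FiniteMaps.abs_le_one hm.1 k)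
  simp only [mul_comm (m _ k)] at this
  exact this

/-! ### Integration by parts along the axis -/

/-- Cut-off functions exhausting the cylinder. -/
def cylCut (ℓ : ℝ) (n : ℕ) (x : E3) : ℝ :=
  (⟨|ℓ| + 1, |ℓ| + 2, by positivity, by linarith⟩ : ContDiffBump (0 : ℝ)) (x 0) *
  (⟨1 - 2 / (n + 3), 1 - 1 / (n + 3), by
      rw [sub_pos, div_lt_one (by positivity)]; linarith [(Nat.cast_nonneg n : (0 : ℝ) ≤ n)], by
      have : (0 : ℝ) < n + 3 := by positivity
      rw [sub_lt_sub_iff_left, div_lt_div_iff_of_pos_right this]; norm_num⟩ : ContDiffBump (0 : ℝ))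
    (x 1 ^ 2 + x 2 ^ 2)

theorem contDiff_cylCut (ℓ : ℝ) (n : ℕ) : ContDiff ℝ ∞ (cylCut ℓ n) := by
  unfold cylCut
  refine ContDiff.mul ?_ ?_
  · exact (ContDiffBump.contDiff _).comp (by fun_prop)
  · exact (ContDiffBump.contDiff _).comp (by fun_prop)

theorem isTest_cylCut (ℓ : ℝ) (n : ℕ) : IsTest cyl (cylCut ℓ n) := by
  set K : Set E3 := {x | |x 0| ≤ |ℓ| + 2 ∧ x 1 ^ 2 + x 2 ^ 2 ≤ 1 - 1 / ((n : ℝ) + 3)} with hK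
  have hn : (0 : ℝ) < 1 / ((n : ℝ) + 3) := by positivity
  have hKc : IsClosed K :=
    (isClosed_le (by fun_prop : Continuous fun x : E3 => |x 0|) continuous_const).inter
      (isClosed_le (by fun_prop : Continuous fun x : E3 => x 1 ^ 2 + x 2 ^ 2) continuous_const)
  have hKcyl : K ⊆ cylFin (|ℓ| + 3) := fun x hx =>
    ⟨by have := hx.2; simp only [cyl, mem_ofPred_eq]; linarith, by have := hx.1; linarith⟩
  have hb : Bornology.IsBounded K := by
    refine (Metric.isBounded_closedBall (x := (0 : E3)) (r := |ℓ| + 4)).subset fun x hx => ?_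
    rw [mem_closedBall_zero_iff, EuclideanSpace.norm_eq, Real.sqrt_le_left (by positivity)]
    simp only [Fin.sum_univ_three, Real.norm_eq_abs, sq_abs]
    have h1 := hx.1
    have h2 := hx.2
    have h3 : x 0 ^ 2 ≤ (|ℓ| + 2) ^ 2 := sq_le_sq.mpr (by rwa [abs_of_nonneg (by positivity : 0 ≤ |ℓ| + 2)])
    nlinarith [abs_nonneg ℓ]
  have hcomp : IsCompact K := Metric.isCompact_of_isClosed_isBounded hKc hb
  have hsupp : Function.support (cylCut ℓ n) ⊆ K := by
    intro x hx
    have hx' := Function.mem_support.mp hx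
    rw [cylCut, mul_ne_zero_iff] at hx'
    constructor
    · by_contra h
      exact hx'.1 (ContDiffBump.zero_of_le_dist _ (by simpa using (not_le.mp h).le))
    · by_contra h
      refine hx'.2 (ContDiffBump.zero_of_le_dist _ ?_)
      rw [Real.dist_eq, sub_zero, abs_of_nonneg (by positivity)]
      exact (not_le.mp h).le
  exact ⟨contDiff_cylCut ℓ n, HasCompactSupport.of_support_subset_isCompact hcomp hsupp,
    (closure_minimal hsupp hKc).trans (hKcyl.trans (cylFin_subset _))⟩

theorem abs_cylCut_le (ℓ : ℝ) (n : ℕ) (x : E3) : |cylCut ℓ n x| ≤ 1 := by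
  rw [cylCut, abs_of_nonneg (mul_nonneg (ContDiffBump.nonneg _) (ContDiffBump.nonneg _))]
  exact mul_le_one₀ (ContDiffBump.le_one _) (ContDiffBump.nonneg _) (ContDiffBump.le_one _)

theorem tendsto_cylCut {ℓ : ℝ} {x : E3} (hx : x ∈ cyl) (h0 : |x 0| < |ℓ| + 1) :
    Tendsto (fun n => cylCut ℓ n x) atTop (𝓝 1) := by
  have hlim : Tendsto (fun n : ℕ => 1 - 2 / ((n : ℝ) + 3)) atTop (𝓝 (1 - 0)) := by
    refine tendsto_const_nhds.sub ?_
    exact tendsto_const_nhds.div_atTop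
      (tendsto_atTop_add_const_right _ _ tendsto_natCast_atTop_atTop)
  rw [sub_zero] at hlim
  refine tendsto_const_nhds.congr' ?_
  filter_upwards [hlim.eventually (lt_mem_nhds hx)] with n hn
  rw [cylCut, ContDiffBump.one_of_mem_closedBall, ContDiffBump.one_of_mem_closedBall, mul_one]
  · rw [Metric.mem_closedBall, Real.dist_eq, sub_zero, abs_of_nonneg (by positivity)]
    exact hn.le
  · rw [Metric.mem_closedBall, Real.dist_eq, sub_zero]
    exact h0.le

theorem partialD_cylCut {ℓ : ℝ} (n : ℕ) {x : E3} (h0 : |x 0| < |ℓ| + 1) :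
    partialD 0 (cylCut ℓ n) x = 0 := by
  have hd : HasFDerivAt (cylCut ℓ n) (fderiv ℝ (cylCut ℓ n) x)
      (x + (0 : ℝ) • EuclideanSpace.single 0 (1 : ℝ)) := by
    simpa using ((contDiff_cylCut ℓ n).differentiable (by simp) x).hasFDerivAt
  have h2 : HasDerivAt (fun s : ℝ => x + s • EuclideanSpace.single (0 : Fin 3) (1 : ℝ))
      (EuclideanSpace.single (0 : Fin 3) (1 : ℝ)) 0 := by
    simpa using! ((hasDerivAt_id (0 : ℝ)).smul_const (EuclideanSpace.single (0 : Fin 3) (1 : ℝ))).const_add x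
  have h3 := hd.comp_hasDerivAt (0 : ℝ) h2
  have h4 : (cylCut ℓ n ∘ fun s : ℝ => x + s • EuclideanSpace.single (0 : Fin 3) (1 : ℝ))
      =ᶠ[𝓝 0] fun _ => cylCut ℓ n x := by
    have hc : ContinuousAt (fun s : ℝ => |x 0 + s|) 0 := by fun_prop
    have : ∀ᶠ s in 𝓝 (0 : ℝ), |x 0 + s| < |ℓ| + 1 :=
      hc.eventually_lt continuousAt_const (by simpa using h0)
    filter_upwards [this] with s hs
    simp only [Function.comp, cylCut]
    refine congrArg₂ (· * ·) ?_ (by simp)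
    rw [ContDiffBump.one_of_mem_closedBall, ContDiffBump.one_of_mem_closedBall]
    · rw [Metric.mem_closedBall, Real.dist_eq, sub_zero]; exact h0.le
    · rw [Metric.mem_closedBall, Real.dist_eq, sub_zero]; simpa using hs.le
  exact h3.unique ((hasDerivAt_const (0 : ℝ) _).congr_of_eventuallyEq h4)

/-- The cut-offs are independent of x₁ for |x₁| < |ℓ| + 1, which contains the region where u and v
may be nonzero. Their axial derivative therefore does not meet u, and the cylinder can be exhausted
up to its lateral boundary without a boundary term. The absolute value |ℓ| makes the argument valid
for either sign of ℓ. -/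
theorem integral_weakPartial_eq_zero {u v : E3 → ℝ} {ℓ : ℝ} (h : HasWeakPartial cyl 0 u v)
    (hv : IntegrableOn v cyl) (hu0 : ∀ᵐ x ∂volume.restrict cyl, ℓ ≤ |x 0| → u x = 0)
    (hv0 : ∀ᵐ x ∂volume.restrict cyl, ℓ ≤ |x 0| → v x = 0) : ∫ x in cyl, v x = 0 := by
  have hlt : ∀ x : E3, x 0 ∈ Ioo (-(|ℓ| + 1)) (|ℓ| + 1) ↔ |x 0| < |ℓ| + 1 := fun x => abs_lt.symm
  have hlim : Tendsto (fun n => ∫ x in cyl, v x * cylCut ℓ n x) atTop (𝓝 (∫ x in cyl, v x)) := by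
    refine tendsto_integral_of_dominated_convergence (fun x => ‖v x‖)
      (fun n => hv.1.mul (contDiff_cylCut ℓ n).continuous.aestronglyMeasurable) hv.norm
      (fun n => Eventually.of_forall fun x => ?_) ?_
    · rw [norm_mul]
      exact mul_le_of_le_one_right (norm_nonneg _) (abs_cylCut_le ℓ n x)
    · filter_upwards [hv0, ae_restrict_mem measurableSet_cyl] with x hx hxc
      by_cases h0 : |x 0| < |ℓ| + 1
      · simpa using (tendsto_cylCut hxc h0).const_mul (v x)
      · rw [hx (by linarith [le_abs_self ℓ, not_lt.mp h0])]; simp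
  refine tendsto_nhds_unique hlim (tendsto_const_nhds.congr fun n => ?_)
  have e := h.2.2 _ (isTest_cylCut ℓ n)
  have e0 : ∫ x in cyl, u x * partialD 0 (cylCut ℓ n) x = 0 := by
    refine integral_eq_zero_of_ae ?_
    filter_upwards [hu0] with x hx
    by_cases h0 : |x 0| < |ℓ| + 1
    · simp [partialD_cylCut n h0]
    · simp [hx (by linarith [le_abs_self ℓ, not_lt.mp h0])]
  linarith

/-! ### Decomposition of the energy -/

/-- The energy density in the axial direction. -/
def axialDensity (m : E3 → E3) (x : E3) : ℝ := (∑ j, dm 0 m x j ^ 2) + (m x 1 ^ 2 + m x 2 ^ 2)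

/-- Axial exchange and anisotropy energy. -/
def axialEnergy (m : E3 → E3) : ℝ := ∫ x in cyl, axialDensity m x

/-- The rescaled exchange energy density in the cross-section. -/
def transversalDensity (p : WireParams) (m : E3 → E3) (x : E3) : ℝ :=
  (∑ j, (p.sc 1 * dm 1 m x j) ^ 2) + ∑ j, (p.sc 2 * dm 2 m x j) ^ 2

/-- Rescaled exchange energy in the cross-section. -/
def transversalEnergy (p : WireParams) (m : E3 → E3) : ℝ := ∫ x in cyl, transversalDensity p m x

/-- The axial chirality density `e₁ · (∂₁m ∧ m)`. -/
def chiralDensity (m : E3 → E3) (x : E3) : ℝ := dm 0 m x 1 * m x 2 - dm 0 m x 2 * m x 1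

/-- The axial chirality. -/
def chirality (m : E3 → E3) : ℝ := ∫ x in cyl, chiralDensity m x

/-- The components of the chirality tensor `(η⁻¹∂ₖ m) ∧ m`. -/
def crossDensity (p : WireParams) (m : E3 → E3) (k j : Fin 3) (x : E3) : ℝ :=
  ((p.sc k • dm k m x) ⨯₃ (fun j => m x j)) j

/-- The integrated chirality tensor. -/
def crossEnergy (p : WireParams) (m : E3 → E3) (k j : Fin 3) : ℝ := ∫ x in cyl, crossDensity p m k j x

theorem axialDensity_nonneg (m : E3 → E3) (x : E3) : 0 ≤ axialDensity m x := by
  unfold axialDensity; positivity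

theorem transversalDensity_nonneg (p : WireParams) (m : E3 → E3) (x : E3) :
    0 ≤ transversalDensity p m x := by
  unfold transversalDensity; positivity

theorem axialEnergy_nonneg (m : E3 → E3) : 0 ≤ axialEnergy m :=
  integral_nonneg (axialDensity_nonneg m)

theorem transversalEnergy_nonneg (p : WireParams) (m : E3 → E3) : 0 ≤ transversalEnergy p m :=
  integral_nonneg (transversalDensity_nonneg p m)

theorem integrableOn_axialDensity {m : E3 → E3} (hm : m ∈ FiniteMaps) :
    IntegrableOn (axialDensity m) cyl :=
  (integrable_finsetSum _ fun j _ => (FiniteMaps.memLp_dm hm 0 j).integrable_sq).add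
    ((FiniteMaps.memLp_two hm (j := 1) (by simp)).integrable_sq.add
      (FiniteMaps.memLp_two hm (j := 2) (by simp)).integrable_sq)

theorem integrableOn_transversalDensity (p : WireParams) {m : E3 → E3} (hm : m ∈ FiniteMaps) :
    IntegrableOn (transversalDensity p m) cyl :=
  (integrable_finsetSum _ fun j _ => ((FiniteMaps.memLp_dm hm 1 j).const_mul _).integrable_sq).add
    (integrable_finsetSum _ fun j _ => ((FiniteMaps.memLp_dm hm 2 j).const_mul _).integrable_sq)

theorem integrableOn_chiralDensity {m : E3 → E3} (hm : m ∈ FiniteMaps) :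
    IntegrableOn (chiralDensity m) cyl :=
  ((FiniteMaps.memLp_dm hm 0 1).integrable_mul (FiniteMaps.memLp_two hm (j := 2) (by simp))).sub
    ((FiniteMaps.memLp_dm hm 0 2).integrable_mul (FiniteMaps.memLp_two hm (j := 1) (by simp)))

theorem two_mul_abs_chiralDensity_le (m : E3 → E3) (x : E3) :
    2 * |chiralDensity m x| ≤ axialDensity m x := by
  simp only [chiralDensity, axialDensity, Fin.sum_univ_three]
  rw [← abs_two (α := ℝ), ← abs_mul, abs_le]
  constructor <;> nlinarith [sq_nonneg (dm 0 m x 1 - m x 2), sq_nonneg (dm 0 m x 1 + m x 2),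
    sq_nonneg (dm 0 m x 2 - m x 1), sq_nonneg (dm 0 m x 2 + m x 1), sq_nonneg (dm 0 m x 0)]

theorem abs_setIntegral_le {f g : E3 → ℝ} {s : Set E3} (hg : IntegrableOn g s) (h : ∀ x, |f x| ≤ g x) :
    |∫ x in s, f x| ≤ ∫ x in s, g x := by
  rw [← Real.norm_eq_abs]
  exact norm_integral_le_of_norm_le hg (Eventually.of_forall h)

theorem two_mul_abs_chirality_le {m : E3 → E3} (hm : m ∈ FiniteMaps) :
    2 * |chirality m| ≤ axialEnergy m := by
  have h := abs_setIntegral_le ((integrableOn_axialDensity hm).const_mul (1 / 2))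
    (f := chiralDensity m) (fun x => by linarith [two_mul_abs_chiralDensity_le m x])
  rw [integral_const_mul] at h
  change |chirality m| ≤ 1 / 2 * axialEnergy m at h
  linarith

theorem integrableOn_crossDensity {p : WireParams} {m : E3 → E3} (hm : m ∈ Adm p) (k j : Fin 3) :
    IntegrableOn (crossDensity p m k j) cyl := by
  have h : ∀ a b c d : Fin 3, IntegrableOn
      (fun x => p.sc k * dm k m x a * m x b - p.sc k * dm k m x c * m x d) cyl := fun a b c d => by
    simp only [mul_assoc]
    exact ((Adm.integrableOn_dm_mul hm k a b).const_mul _).sub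
      ((Adm.integrableOn_dm_mul hm k c d).const_mul _)
  fin_cases j
  · simpa [crossDensity, cross_apply] using! h 1 2 2 1
  · simpa [crossDensity, cross_apply] using! h 2 0 0 2
  · simpa [crossDensity, cross_apply] using! h 0 1 1 0

theorem density_eq (p : WireParams) (m : E3 → E3) (x : E3) :
    density p m x = axialDensity m x + transversalDensity p m x +
      p.rho / p.d ^ 2 * ∑ k, ∑ j, p.D k j * crossDensity p m k j x := by
  have h0 : p.sc 0 = 1 := by simp [WireParams.sc]
  simp only [density, axialDensity, transversalDensity, crossDensity, dotProduct]
  congr 1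
  rw [Fin.sum_univ_three (fun i => ∑ j, (p.sc i * dm i m x j) ^ 2), h0]
  simp only [one_mul]
  ring

theorem integrableOn_density {p : WireParams} {m : E3 → E3} (hm : m ∈ Adm p) :
    IntegrableOn (density p m) cyl := by
  rw [show density p m = _ from funext (density_eq p m)]
  refine ((integrableOn_axialDensity hm.1).add (integrableOn_transversalDensity p hm.1)).add ?_
  exact (integrable_finsetSum _ fun k _ => integrable_finsetSum _ fun j _ =>
    (integrableOn_crossDensity hm k j).const_mul _).const_mul _

theorem energy_eq {p : WireParams} {m : E3 → E3} (hm : m ∈ Adm p) :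
    energy p m = axialEnergy m + transversalEnergy p m +
      p.rho / p.d ^ 2 * ∑ k, ∑ j, p.D k j * crossEnergy p m k j + strayEnergy p m := by
  have i3 : ∀ k j, IntegrableOn (fun x => p.D k j * crossDensity p m k j x) cyl := fun k j =>
    (integrableOn_crossDensity hm k j).const_mul _
  have i2 : ∀ k, IntegrableOn (fun x => ∑ j, p.D k j * crossDensity p m k j x) cyl := fun k =>
    integrable_finsetSum _ fun j _ => i3 k j
  have i1 : IntegrableOn (fun x => ∑ k, ∑ j, p.D k j * crossDensity p m k j x) cyl :=
    integrable_finsetSum _ fun k _ => i2 k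
  have i12 : IntegrableOn (fun x => axialDensity m x + transversalDensity p m x) cyl :=
    (integrableOn_axialDensity hm.1).add (integrableOn_transversalDensity p hm.1)
  simp only [energy, density_eq]
  rw [integral_add i12 (i1.const_mul _), integral_add (integrableOn_axialDensity hm.1)
    (integrableOn_transversalDensity p hm.1), integral_const_mul, integral_finsetSum _ fun k _ => i2 k]
  simp only [integral_finsetSum _ fun j _ => i3 _ j, integral_const_mul]
  rfl

theorem energyLimit_eq {γ : ℝ} {m : E3 → E3} (hm : m ∈ FiniteMaps) :
    energyLimit γ m = axialEnergy m - 2 * γ * chirality m := by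
  have h : densityLimit γ m = fun x => axialDensity m x - 2 * γ * chiralDensity m x := by
    funext x
    simp [densityLimit, axialDensity, chiralDensity, cross_apply, Matrix.vecHead, Matrix.vecTail]
  rw [energyLimit, h, integral_sub (integrableOn_axialDensity hm)
    ((integrableOn_chiralDensity hm).const_mul _), integral_const_mul]
  rfl

theorem integrableOn_densityLimit {γ : ℝ} {m : E3 → E3} (hm : m ∈ FiniteMaps) :
    IntegrableOn (densityLimit γ m) cyl := by
  have h : densityLimit γ m = fun x => axialDensity m x - 2 * γ * chiralDensity m x := by
    funext x
    simp [densityLimit, axialDensity, chiralDensity, cross_apply, Matrix.vecHead, Matrix.vecTail]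
  rw [h]
  exact (integrableOn_axialDensity hm).sub ((integrableOn_chiralDensity hm).const_mul _)

/-! ### Estimates of the chirality tensor and of the total error -/

theorem crossEnergy_zero_zero (p : WireParams) (m : E3 → E3) : crossEnergy p m 0 0 = chirality m := by
  have : crossDensity p m 0 0 = chiralDensity m := by
    funext x; simp [crossDensity, chiralDensity, cross_apply, WireParams.sc]
  rw [crossEnergy, this, chirality]

theorem integral_axial_by_parts {p : WireParams} {m : E3 → E3} (hm : m ∈ Adm p) {l : Fin 3} (hl : l ≠ 0) :
    ∫ x in cyl, (dm 0 m x 0 * m x l + dm 0 m x l * m x 0) = 0 := by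
  have hw := (FiniteMaps.hasWeakPartial hm.1 0 0).mul_of_bounded isOpen_cyl
    (FiniteMaps.hasWeakPartial hm.1 0 l) (FiniteMaps.abs_le_one hm.1 0) (FiniteMaps.abs_le_one hm.1 l)
  have hw' : HasWeakPartial cyl 0 (fun x => m x 0 * m x l)
      (fun x => dm 0 m x 0 * m x l + dm 0 m x l * m x 0) :=
    hw.congr EventuallyEq.rfl (Eventually.of_forall fun x => by simp only; ring)
  refine integral_weakPartial_eq_zero (ℓ := p.len) hw'
    ((Adm.integrableOn_dm_mul hm 0 0 l).add (Adm.integrableOn_dm_mul hm 0 l 0)) ?_ ?_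
  · filter_upwards [hm.2] with x hx h
    have := hx h
    fin_cases l
    · exact absurd rfl hl
    · simp [this.1]
    · simp [this.2]
  · filter_upwards [Adm.dm_ae_eq_zero hm] with x hx h
    simp [hx h]

/-- The off-axis components pair an axial derivative with m₁, which is not square integrable. The
product m₁mₗ vanishes beyond the ends, so integration by parts turns -∂₁mₗ m₁ into ∂₁m₁ mₗ. Only
square integrable factors remain. -/
theorem abs_crossEnergy_zero_le {p : WireParams} {m : E3 → E3} (hm : m ∈ Adm p) {j : Fin 3} (hj : j ≠ 0) :
    |crossEnergy p m 0 j| ≤ axialEnergy m := by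
  have hs : p.sc 0 = 1 := by simp [WireParams.sc]
  have key : ∀ l, l ≠ 0 → |∫ x in cyl, 2 * (dm 0 m x 0 * m x l)| ≤ axialEnergy m := by
    intro l hl
    refine abs_setIntegral_le (integrableOn_axialDensity hm.1) fun x => ?_
    have h1 : m x l ^ 2 ≤ m x 1 ^ 2 + m x 2 ^ 2 := by
      fin_cases l
      · exact absurd rfl hl
      · simpa using sq_nonneg (m x 2)
      · simpa using sq_nonneg (m x 1)
    simp only [axialDensity, Fin.sum_univ_three]
    rw [abs_le]
    constructor <;> nlinarith [sq_nonneg (dm 0 m x 0 - m x l), sq_nonneg (dm 0 m x 0 + m x l),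
      sq_nonneg (dm 0 m x 1), sq_nonneg (dm 0 m x 2)]
  have split : ∀ l, l ≠ 0 → ∫ x in cyl, (dm 0 m x 0 * m x l - dm 0 m x l * m x 0) =
      ∫ x in cyl, 2 * (dm 0 m x 0 * m x l) := by
    intro l hl
    have h := integral_axial_by_parts hm hl
    have i1 := Adm.integrableOn_dm_mul hm 0 0 l
    have i2 := Adm.integrableOn_dm_mul hm 0 l 0
    rw [integral_add i1 i2] at h
    rw [integral_sub i1 i2, integral_const_mul]
    linarith
  fin_cases j
  · exact absurd rfl hj
  · have e : crossEnergy p m 0 1 = - ∫ x in cyl, (dm 0 m x 0 * m x 2 - dm 0 m x 2 * m x 0) := by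
      rw [crossEnergy, ← integral_neg]
      congr 1; funext x
      simp [crossDensity, cross_apply, hs]
    change |crossEnergy p m 0 1| ≤ _
    rw [e, abs_neg, split 2 (by simp)]
    exact key 2 (by simp)
  · have e : crossEnergy p m 0 2 = ∫ x in cyl, (dm 0 m x 0 * m x 1 - dm 0 m x 1 * m x 0) := by
      rw [crossEnergy]
      congr 1; funext x
      simp [crossDensity, cross_apply, hs]
    change |crossEnergy p m 0 2| ≤ _
    rw [e, split 1 (by simp)]
    exact key 1 (by simp)

theorem sq_sc_dm_le (p : WireParams) (m : E3 → E3) {k : Fin 3} (hk : k ≠ 0) (x : E3) :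
    ∑ j, (p.sc k * dm k m x j) ^ 2 ≤ transversalDensity p m x := by
  have h1 : 0 ≤ ∑ j, (p.sc 1 * dm 1 m x j) ^ 2 := Finset.sum_nonneg fun _ _ => sq_nonneg _
  have h2 : 0 ≤ ∑ j, (p.sc 2 * dm 2 m x j) ^ 2 := Finset.sum_nonneg fun _ _ => sq_nonneg _
  unfold transversalDensity
  fin_cases k
  · exact absurd rfl hk
  · exact le_add_of_nonneg_right h2
  · exact le_add_of_nonneg_left h1

/-- The first component of the vector product involves only m₂ and m₃, so Young's inequality
suffices and no length of the wire enters. -/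
theorem abs_crossEnergy_axial_le {p : WireParams} {m : E3 → E3} (hm : m ∈ Adm p) {k : Fin 3} (hk : k ≠ 0) :
    |crossEnergy p m k 0| ≤ axialEnergy m + transversalEnergy p m := by
  rw [axialEnergy, transversalEnergy, ← integral_add (integrableOn_axialDensity hm.1)
    (integrableOn_transversalDensity p hm.1)]
  refine abs_setIntegral_le ((integrableOn_axialDensity hm.1).add
    (integrableOn_transversalDensity p hm.1)) fun x => ?_
  have h := sq_sc_dm_le p m hk x
  have e : crossDensity p m k 0 x = p.sc k * dm k m x 1 * m x 2 - p.sc k * dm k m x 2 * m x 1 := by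
    simp [crossDensity, cross_apply]; ring
  rw [e]
  rw [Fin.sum_univ_three] at h
  simp only [axialDensity, Fin.sum_univ_three]
  set a := p.sc k * dm k m x 1
  set b := p.sc k * dm k m x 2
  rw [abs_le]
  constructor <;> nlinarith [sq_nonneg (a - m x 2), sq_nonneg (a + m x 2), sq_nonneg (b - m x 1),
    sq_nonneg (b + m x 1), sq_nonneg (dm 0 m x 0), sq_nonneg (dm 0 m x 1), sq_nonneg (dm 0 m x 2),
    sq_nonneg (p.sc k * dm k m x 0)]

/-- The factors of m are estimated by 1, which leaves the L¹ norm of the rescaled derivative on a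
cylinder of volume 2·area·`len`. Young's inequality with weight √`len` balances the two parts: the
constant term of order 1/√`len` integrates to order √`len`, as does the quadratic one. -/
theorem abs_crossEnergy_le {p : WireParams} (hp : p.Good) {m : E3 → E3} (hm : m ∈ Adm p) {k : Fin 3}
    (hk : k ≠ 0) (j : Fin 3) :
    |crossEnergy p m k j| ≤ √p.len * ((1 + 4 * area) * (1 + transversalEnergy p m)) := by
  have hl := hp.len_pos
  have hq := Real.sqrt_pos.mpr hl
  have hqq : √p.len * √p.len = p.len := Real.mul_self_sqrt hl.le
  have ic : IntegrableOn ((cylFin p.len).indicator fun _ => 2 / √p.len) cyl := by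
    have : IntegrableOn (fun _ : E3 => 2 / √p.len) (cylFin p.len) :=
      integrableOn_const (measure_cylFin_lt_top _).ne
    exact (this.integrable_indicator (measurableSet_cylFin _)).integrableOn
  have it := (integrableOn_transversalDensity p hm.1).const_mul √p.len
  have hle : |crossEnergy p m k j| ≤
      ∫ x in cyl, (√p.len * transversalDensity p m x + (cylFin p.len).indicator (fun _ => 2 / √p.len) x) := by
    rw [crossEnergy, ← Real.norm_eq_abs]
    refine norm_integral_le_of_norm_le (it.add ic) ?_
    filter_upwards [Adm.dm_ae_eq_zero hm, FiniteMaps.abs_le_one hm.1 0, FiniteMaps.abs_le_one hm.1 1,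
      FiniteMaps.abs_le_one hm.1 2, ae_restrict_mem measurableSet_cyl] with x h0 b0 b1 b2 hxc
    rw [Real.norm_eq_abs]
    by_cases hx : x ∈ cylFin p.len
    · rw [indicator_of_mem hx]
      have h := sq_sc_dm_le p m hk x
      set a : Fin 3 → ℝ := fun j => p.sc k * dm k m x j with ha
      have hb : ∀ i, |m x i| ≤ 1 := fun i => by fin_cases i <;> assumption
      -- This is (√`len` |a| - 1)² ≥ 0 divided by 2√`len`.
      have hyoung : ∀ i, |a i| ≤ √p.len * a i ^ 2 / 2 + 1 / √p.len / 2 := by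
        intro i
        have : 0 ≤ (√p.len * |a i| - 1) ^ 2 / √p.len := by positivity
        have e : (√p.len * |a i| - 1) ^ 2 / √p.len = √p.len * a i ^ 2 - 2 * |a i| + 1 / √p.len := by
          rw [← sq_abs (a i)]; field_simp; ring
        linarith
      have main : ∀ i₁ i₂ i₃ i₄, |a i₁ * m x i₂ - a i₃ * m x i₄| ≤
          √p.len * transversalDensity p m x + 2 / √p.len := by
        intro i₁ i₂ i₃ i₄
        have t1 : |a i₁ * m x i₂| ≤ |a i₁| := by
          rw [abs_mul]; exact mul_le_of_le_one_right (abs_nonneg _) (hb _)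
        have t2 : |a i₃ * m x i₄| ≤ |a i₃| := by
          rw [abs_mul]; exact mul_le_of_le_one_right (abs_nonneg _) (hb _)
        have s : ∀ i, a i ^ 2 ≤ transversalDensity p m x := fun i =>
          (Finset.single_le_sum (f := fun i => a i ^ 2) (fun _ _ => sq_nonneg _) (Finset.mem_univ i)).trans h
        have s1 := mul_le_mul_of_nonneg_left (s i₁) hq.le
        have s3 := mul_le_mul_of_nonneg_left (s i₃) hq.le
        have y1 := hyoung i₁
        have y3 := hyoung i₃
        have hi : 0 < 1 / √p.len := by positivity
        have e2 : 2 / √p.len = 2 * (1 / √p.len) := by ring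
        calc _ ≤ |a i₁ * m x i₂| + |a i₃ * m x i₄| := abs_sub _ _
          _ ≤ _ := by rw [e2]; linarith
      fin_cases j
      · simpa [crossDensity, cross_apply, ha, mul_assoc, ← mul_sub, abs_mul] using! main 1 2 2 1
      · simpa [crossDensity, cross_apply, ha, mul_assoc, ← mul_sub, abs_mul] using! main 2 0 0 2
      · simpa [crossDensity, cross_apply, ha, mul_assoc, ← mul_sub, abs_mul] using! main 0 1 1 0
    · rw [indicator_of_notMem hx]
      have hlen : p.len ≤ |x 0| := by
        by_contra hc; exact hx ⟨hxc, not_le.mp hc⟩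
      have : dm k m x = 0 := funext fun j => h0 hlen k j
      have e : crossDensity p m k j x = 0 := by simp [crossDensity, this]
      rw [e, abs_zero, add_zero]
      exact mul_nonneg hq.le (transversalDensity_nonneg p m x)
  rw [integral_add it ic, integral_const_mul, setIntegral_indicator (measurableSet_cylFin _),
    inter_eq_right.mpr (cylFin_subset _), setIntegral_const, Measure.real, measure_cylFin,
    ENNReal.toReal_mul, ENNReal.toReal_ofReal (by linarith)] at hle
  have hG := transversalEnergy_nonneg p m
  change _ ≤ √p.len * transversalEnergy p m + _ at hle
  refine hle.trans ?_
  have ha : (0 : ℝ) ≤ area := area.2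
  have e : ((area : ℝ≥0∞).toReal * (2 * p.len)) • (2 / √p.len) = √p.len * (4 * area) := by
    rw [ENNReal.coe_toReal, smul_eq_mul]
    field_simp
    rw [Real.sq_sqrt hl.le]; ring
  rw [e, ← mul_add]
  gcongr
  nlinarith

/-- The relative error between the full energy and its leading order part. -/
def energyError (γ : ℝ) (p : WireParams) : ℝ :=
  |p.rho / p.d ^ 2 * p.D 0 0 - -2 * γ| +
  p.rho / p.d ^ 2 * (|p.D 0 1| + |p.D 0 2| + |p.D 1 0| + |p.D 2 0|) +
  (1 + 4 * area) * (√(p.rho * p.L) / p.d ^ 2 * (|p.D 1 1| + |p.D 1 2| + |p.D 2 1| + |p.D 2 2|)) +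
  2 * area * (p.rho * p.L / p.d ^ 2)

theorem energyError_nonneg (γ : ℝ) {p : WireParams} (hp : p.Good) : 0 ≤ energyError γ p := by
  have := hp.rho_pos
  have := hp.2.1
  have := hp.2.2.1
  unfold energyError; positivity

/-- Compactness and both bounds rest on this estimate. Each component of `D` is matched with the
sharpest available bound for its chirality integral, so that the prefactors are exactly the
quantities that the regime sends to 0. -/
theorem abs_energy_sub_le (γ : ℝ) {p : WireParams} (hp : p.Good) {m : E3 → E3} (hm : m ∈ Adm p) :
    |energy p m - (axialEnergy m + transversalEnergy p m - 2 * γ * chirality m)| ≤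
      energyError γ p * (1 + axialEnergy m + transversalEnergy p m) := by
  rw [energy_eq hm]
  have hρ := hp.rho_pos
  have hd := hp.2.2.1
  have hL := hp.2.1
  set N := axialEnergy m with hN
  set G := transversalEnergy p m with hG
  have hN0 : 0 ≤ N := axialEnergy_nonneg m
  have hG0 : 0 ≤ G := transversalEnergy_nonneg p m
  set κ := p.rho / p.d ^ 2 with hκ
  have hκ0 : 0 < κ := by positivity
  -- The factor √`len` lost on the cross-sectional chirality terms combines with ρ/d² into √(ρL)/d²,
  -- the scale at which the regime controls them.
  have hκl : κ * √p.len = √(p.rho * p.L) / p.d ^ 2 := by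
    have : p.rho * √p.len = √(p.rho * p.L) := by
      have e : p.rho * p.L = p.rho ^ 2 * p.len := by rw [WireParams.len]; field_simp
      rw [e, Real.sqrt_mul (sq_nonneg _), Real.sqrt_sq hρ.le]
    rw [hκ, ← this]; ring
  have hX : |chirality m| ≤ N := by
    have := two_mul_abs_chirality_le hm.1
    linarith [abs_nonneg (chirality m)]
  have hS0 := strayEnergy_nonneg p m
  have hS1 := strayEnergy_le hp hm.1
  have hs0 : 0 ≤ p.rho * p.L / p.d ^ 2 := by positivity
  set E := 1 + N + G with hE
  have t0 : |(κ * p.D 0 0 - -2 * γ) * chirality m| ≤ |κ * p.D 0 0 - -2 * γ| * E := by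
    rw [abs_mul]; gcongr; linarith
  have tm : ∀ k j, |crossEnergy p m k j| ≤ N + G → |κ * (p.D k j * crossEnergy p m k j)| ≤ κ * |p.D k j| * E := by
    intro k j h
    rw [abs_mul, abs_mul, abs_of_pos hκ0, ← mul_assoc]; gcongr; linarith
  have tc : ∀ k j, k ≠ 0 → |κ * (p.D k j * crossEnergy p m k j)| ≤
      (1 + 4 * area) * (√(p.rho * p.L) / p.d ^ 2 * |p.D k j|) * E := by
    intro k j hk
    have h := abs_crossEnergy_le hp hm hk j
    have ha : (0 : ℝ) ≤ area := area.2
    calc |κ * (p.D k j * crossEnergy p m k j)| = κ * |p.D k j| * |crossEnergy p m k j| := by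
          rw [abs_mul, abs_mul, abs_of_pos hκ0, ← mul_assoc]
      _ ≤ κ * |p.D k j| * (√p.len * ((1 + 4 * area) * E)) := by
          gcongr
          refine h.trans ?_
          gcongr
          change 1 + G ≤ E
          linarith
      _ = _ := by rw [← hκl]; ring
  have t01 := tm 0 1 ((abs_crossEnergy_zero_le hm (by simp)).trans (by linarith))
  have t02 := tm 0 2 ((abs_crossEnergy_zero_le hm (by simp)).trans (by linarith))
  have t10 := tm 1 0 (abs_crossEnergy_axial_le hm (by simp))
  have t20 := tm 2 0 (abs_crossEnergy_axial_le hm (by simp))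
  have t11 := tc 1 1 (by simp)
  have t12 := tc 1 2 (by simp)
  have t21 := tc 2 1 (by simp)
  have t22 := tc 2 2 (by simp)
  have ts : strayEnergy p m ≤ 2 * area * (p.rho * p.L / p.d ^ 2) * E := by
    refine hS1.trans (le_mul_of_one_le_right ?_ (by linarith))
    have ha : (0 : ℝ) ≤ area := area.2
    positivity
  simp only [Fin.sum_univ_three, crossEnergy_zero_zero]
  rw [abs_le] at t0 t01 t02 t10 t20 t11 t12 t21 t22
  rw [energyError, abs_le]
  constructor <;> linarith [t0.1, t0.2, t01.1, t01.2, t02.1, t02.2, t10.1, t10.2, t20.1, t20.2,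
    t11.1, t11.2, t12.1, t12.2, t21.1, t21.2, t22.1, t22.2]

theorem Regime.tendsto_energyError {γ : ℝ} {p : ℝ → WireParams} (hp : Regime γ p) :
    Tendsto (fun η => energyError γ (p η)) (𝓝[>] 0) (𝓝 0) := by
  have h1 : Tendsto (fun η => |(p η).rho / (p η).d ^ 2 * (p η).D 0 0 - -2 * γ|) (𝓝[>] 0) (𝓝 0) := by
    simpa using (hp.D_11.sub_const (-2 * γ)).abs
  have h := ((h1.add hp.D_mixed).add (hp.D_cross.const_mul (1 + 4 * (area : ℝ)))).add
    (hp.rhoL_d.const_mul (2 * (area : ℝ)))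
  simpa [energyError] using h

theorem Regime.good {γ : ℝ} {p : ℝ → WireParams} (hp : Regime γ p) :
    ∀ᶠ η in 𝓝[>] 0, (p η).Good := hp.pos

theorem Regime.tendsto_len {γ : ℝ} {p : ℝ → WireParams} (hp : Regime γ p) :
    Tendsto (fun η => (p η).len) (𝓝[>] 0) atTop := by
  have h : Tendsto (fun η => (p η).rho / (p η).L) (𝓝[>] 0) (𝓝[>] 0) := by
    refine tendsto_nhdsWithin_iff.mpr ⟨hp.rho_L, ?_⟩
    filter_upwards [hp.good] with η hη using div_pos hη.rho_pos hη.2.1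
  refine (tendsto_inv_nhdsGT_zero.comp h).congr fun η => ?_
  simp [WireParams.len]

/-! ### Lower semicontinuity -/

/-- The polarisation of the limit energy, as a function of the first argument. -/
def limitPolar (γ : ℝ) (m m₀ : E3 → E3) : ℝ :=
  (∫ x in cyl, dm 0 m x 0 * dm 0 m₀ x 0) + (∫ x in cyl, dm 0 m x 1 * (dm 0 m₀ x 1 - γ * m₀ x 2)) +
  (∫ x in cyl, dm 0 m x 2 * (dm 0 m₀ x 2 + γ * m₀ x 1)) +
  (∫ x in cyl, m x 1 * (m₀ x 1 + γ * dm 0 m₀ x 2)) + ∫ x in cyl, m x 2 * (m₀ x 2 - γ * dm 0 m₀ x 1)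

/-- The integrand of `limitPolar`. -/
def limitPolarDensity (γ : ℝ) (m m₀ : E3 → E3) (x : E3) : ℝ :=
  dm 0 m x 0 * dm 0 m₀ x 0 + dm 0 m x 1 * (dm 0 m₀ x 1 - γ * m₀ x 2) +
  dm 0 m x 2 * (dm 0 m₀ x 2 + γ * m₀ x 1) +
  m x 1 * (m₀ x 1 + γ * dm 0 m₀ x 2) + m x 2 * (m₀ x 2 - γ * dm 0 m₀ x 1)

/-- The limit energy density in terms of its constituents. -/
def limitForm (γ : ℝ) (m : E3 → E3) (x : E3) : ℝ := axialDensity m x - 2 * γ * chiralDensity m x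

theorem integrableOn_limitForm (γ : ℝ) {m : E3 → E3} (hm : m ∈ FiniteMaps) :
    IntegrableOn (limitForm γ m) cyl :=
  (integrableOn_axialDensity hm).sub ((integrableOn_chiralDensity hm).const_mul _)

theorem integral_limitForm (γ : ℝ) {m : E3 → E3} (hm : m ∈ FiniteMaps) :
    ∫ x in cyl, limitForm γ m x = axialEnergy m - 2 * γ * chirality m := by
  simp only [limitForm]
  rw [integral_sub (integrableOn_axialDensity hm) ((integrableOn_chiralDensity hm).const_mul _),
    integral_const_mul]
  rfl

theorem limitPolarDensity_self (γ : ℝ) (m : E3 → E3) (x : E3) :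
    limitPolarDensity γ m m x = limitForm γ m x := by
  simp only [limitPolarDensity, limitForm, axialDensity, chiralDensity, Fin.sum_univ_three]
  ring

/-- The difference of the two sides is the quadratic form evaluated at m - m₀. Apart from the square
of the first derivative component it equals (a - γd)² + (b + γc)² + (1 - γ²)(c² + d²), nonnegative
for |γ| ≤ 1. -/
theorem two_mul_limitPolarDensity_le {γ : ℝ} (hγ : |γ| ≤ 1) (m m₀ : E3 → E3) (x : E3) :
    2 * limitPolarDensity γ m m₀ x - limitForm γ m₀ x ≤ limitForm γ m x := by
  simp only [limitPolarDensity, limitForm, axialDensity, chiralDensity, Fin.sum_univ_three]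
  set a := dm 0 m x 1 - dm 0 m₀ x 1 with ha
  set b := dm 0 m x 2 - dm 0 m₀ x 2 with hb
  set c := m x 1 - m₀ x 1 with hc
  set d := m x 2 - m₀ x 2 with hd
  have h : 0 ≤ a ^ 2 + b ^ 2 + c ^ 2 + d ^ 2 - 2 * γ * (a * d - b * c) := by
    have e : γ ^ 2 ≤ 1 := by rw [← sq_abs]; nlinarith [abs_nonneg γ]
    nlinarith [sq_nonneg (a - γ * d), sq_nonneg (b + γ * c), mul_nonneg (sub_nonneg.mpr e) (sq_nonneg d),
      mul_nonneg (sub_nonneg.mpr e) (sq_nonneg c)]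
  have h0 := sq_nonneg (dm 0 m x 0 - dm 0 m₀ x 0)
  simp only [ha, hb, hc, hd] at h
  nlinarith [h, h0]

theorem FiniteMaps.memLp_polar {γ : ℝ} {m₀ : E3 → E3} (hm : m₀ ∈ FiniteMaps) :
    MemLp (fun x => dm 0 m₀ x 1 - γ * m₀ x 2) 2 (volume.restrict cyl) ∧
    MemLp (fun x => dm 0 m₀ x 2 + γ * m₀ x 1) 2 (volume.restrict cyl) ∧
    MemLp (fun x => m₀ x 1 + γ * dm 0 m₀ x 2) 2 (volume.restrict cyl) ∧
    MemLp (fun x => m₀ x 2 - γ * dm 0 m₀ x 1) 2 (volume.restrict cyl) := by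
  have h1 := FiniteMaps.memLp_dm hm 0 1
  have h2 := FiniteMaps.memLp_dm hm 0 2
  have h3 := FiniteMaps.memLp_two hm (j := 1) (by simp)
  have h4 := FiniteMaps.memLp_two hm (j := 2) (by simp)
  exact ⟨h1.sub (h4.const_mul γ), h2.add (h3.const_mul γ), h3.add (h2.const_mul γ),
    h4.sub (h1.const_mul γ)⟩

theorem integral_limitPolarDensity {γ : ℝ} {m m₀ : E3 → E3} (hm : m ∈ FiniteMaps)
    (hm₀ : m₀ ∈ FiniteMaps) : IntegrableOn (limitPolarDensity γ m m₀) cyl ∧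
    ∫ x in cyl, limitPolarDensity γ m m₀ x = limitPolar γ m m₀ := by
  obtain ⟨p1, p2, p3, p4⟩ := FiniteMaps.memLp_polar (γ := γ) hm₀
  have i0 : IntegrableOn (fun x => dm 0 m x 0 * dm 0 m₀ x 0) cyl :=
    (FiniteMaps.memLp_dm hm 0 0).integrable_mul (FiniteMaps.memLp_dm hm₀ 0 0)
  have i1 : IntegrableOn (fun x => dm 0 m x 1 * (dm 0 m₀ x 1 - γ * m₀ x 2)) cyl :=
    (FiniteMaps.memLp_dm hm 0 1).integrable_mul p1
  have i2 : IntegrableOn (fun x => dm 0 m x 2 * (dm 0 m₀ x 2 + γ * m₀ x 1)) cyl :=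
    (FiniteMaps.memLp_dm hm 0 2).integrable_mul p2
  have i3 : IntegrableOn (fun x => m x 1 * (m₀ x 1 + γ * dm 0 m₀ x 2)) cyl :=
    (FiniteMaps.memLp_two hm (j := 1) (by simp)).integrable_mul p3
  have i4 : IntegrableOn (fun x => m x 2 * (m₀ x 2 - γ * dm 0 m₀ x 1)) cyl :=
    (FiniteMaps.memLp_two hm (j := 2) (by simp)).integrable_mul p4
  have i01 : IntegrableOn (fun x => dm 0 m x 0 * dm 0 m₀ x 0 +
      dm 0 m x 1 * (dm 0 m₀ x 1 - γ * m₀ x 2)) cyl := i0.add i1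
  have i012 : IntegrableOn (fun x => dm 0 m x 0 * dm 0 m₀ x 0 +
      dm 0 m x 1 * (dm 0 m₀ x 1 - γ * m₀ x 2) + dm 0 m x 2 * (dm 0 m₀ x 2 + γ * m₀ x 1)) cyl := i01.add i2
  have i0123 : IntegrableOn (fun x => dm 0 m x 0 * dm 0 m₀ x 0 +
      dm 0 m x 1 * (dm 0 m₀ x 1 - γ * m₀ x 2) + dm 0 m x 2 * (dm 0 m₀ x 2 + γ * m₀ x 1) +
      m x 1 * (m₀ x 1 + γ * dm 0 m₀ x 2)) cyl := i012.add i3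
  refine ⟨i0123.add i4, ?_⟩
  simp only [limitPolarDensity, limitPolar]
  rw [integral_add i0123 i4, integral_add i012 i3, integral_add i01 i2, integral_add i0 i1]

/-- The polarisation is linear in its first argument and tests only derivatives and m' against fixed
L² functions, which is precisely what weak convergence controls. -/
theorem tendsto_limitPolar {γ : ℝ} {m : ℕ → E3 → E3} {m₀ : E3 → E3} (hm₀ : m₀ ∈ FiniteMaps)
    (h : WeakConv m m₀) :
    Tendsto (fun k => limitPolar γ (m k) m₀) atTop (𝓝 (axialEnergy m₀ - 2 * γ * chirality m₀)) := by
  obtain ⟨p1, p2, p3, p4⟩ := FiniteMaps.memLp_polar (γ := γ) hm₀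
  have e : axialEnergy m₀ - 2 * γ * chirality m₀ = limitPolar γ m₀ m₀ := by
    rw [← (integral_limitPolarDensity hm₀ hm₀).2, ← integral_limitForm γ hm₀]
    simp only [limitPolarDensity_self]
  rw [e]
  exact (((((h _ (FiniteMaps.memLp_dm hm₀ 0 0)).1 0 0).add ((h _ p1).1 0 1)).add ((h _ p2).1 0 2)).add
    ((h _ p3).2 1 (by simp))).add ((h _ p4).2 2 (by simp))

theorem two_mul_limitPolar_le {γ : ℝ} (hγ : |γ| ≤ 1) {m m₀ : E3 → E3} (hm : m ∈ FiniteMaps)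
    (hm₀ : m₀ ∈ FiniteMaps) :
    2 * limitPolar γ m m₀ - (axialEnergy m₀ - 2 * γ * chirality m₀) ≤
      axialEnergy m - 2 * γ * chirality m := by
  obtain ⟨h1, h2⟩ := integral_limitPolarDensity (γ := γ) hm hm₀
  rw [← h2, ← integral_limitForm γ hm₀, ← integral_limitForm γ hm, ← integral_const_mul,
    ← integral_sub (h1.const_mul 2) (integrableOn_limitForm γ hm₀)]
  exact integral_mono ((h1.const_mul 2).sub (integrableOn_limitForm γ hm₀))
    (integrableOn_limitForm γ hm) fun x => two_mul_limitPolarDensity_le hγ m m₀ x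

/-- Coercivity of the limit form: 2|γ||X| ≤ |γ|N. The constant 1 - |γ| is positive exactly for |γ| <
1. -/
theorem axialEnergy_le {γ : ℝ} {m : E3 → E3} (hm : m ∈ FiniteMaps) :
    (1 - |γ|) * axialEnergy m ≤ axialEnergy m - 2 * γ * chirality m := by
  have h := two_mul_abs_chirality_le hm
  have h2 : γ * chirality m ≤ |γ| * |chirality m| := by rw [← abs_mul]; exact le_abs_self _
  nlinarith [abs_nonneg γ]

/-- The relative error is absorbed: δN ≤ δq/(1 - |γ|) by coercivity, and δG ≤ G/2 because the
hypothesis gives δ ≤ 1/2. -/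
theorem energy_lower_bound {γ : ℝ} (hγ : |γ| < 1) {p : WireParams} (hp : p.Good) {m : E3 → E3}
    (hm : m ∈ Adm p) (hδ : energyError γ p ≤ (1 - |γ|) / 2) :
    (1 - energyError γ p / (1 - |γ|)) * (axialEnergy m - 2 * γ * chirality m) +
      transversalEnergy p m / 2 - energyError γ p ≤ energy p m := by
  have h := (abs_le.mp (abs_energy_sub_le γ hp hm)).1
  have hc := axialEnergy_le (γ := γ) hm.1
  have hN := axialEnergy_nonneg m
  have hG := transversalEnergy_nonneg p m
  have h0 := energyError_nonneg γ hp
  have hc0 : 0 < 1 - |γ| := by linarith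
  set δ := energyError γ p
  set q := axialEnergy m - 2 * γ * chirality m
  have h1 : axialEnergy m ≤ q / (1 - |γ|) := by rw [le_div_iff₀ hc0]; linarith
  have h2 : δ * axialEnergy m ≤ δ * (q / (1 - |γ|)) := mul_le_mul_of_nonneg_left h1 h0
  have h3 : δ * transversalEnergy p m ≤ 1 / 2 * transversalEnergy p m := by
    gcongr; linarith [abs_nonneg γ]
  have e : (1 - δ / (1 - |γ|)) * q = q - δ * (q / (1 - |γ|)) := by ring
  rw [e]
  linarith

theorem energyLimit_le_liminf {γ : ℝ} (hγ : |γ| < 1) {p : ℝ → WireParams} (hp : Regime γ p)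
    {s : ℕ → ℝ} {m : ℕ → E3 → E3} {m₀ : E3 → E3} (hs : Tendsto s atTop (𝓝[>] 0))
    (hm : ∀ k, m k ∈ Adm (p (s k))) (hm₀ : m₀ ∈ AdmLimit) (hw : WeakConv m m₀) :
    ((energyLimit γ m₀ : ℝ) : EReal) ≤
      liminf (fun k => ((energy (p (s k)) (m k) : ℝ) : EReal)) atTop := by
  have hf := hm₀.1
  rw [energyLimit_eq hf]
  set q₀ := axialEnergy m₀ - 2 * γ * chirality m₀ with hq₀
  have hδ : Tendsto (fun k => energyError γ (p (s k))) atTop (𝓝 0) := hp.tendsto_energyError.comp hs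
  have hB : Tendsto (fun k => limitPolar γ (m k) m₀) atTop (𝓝 q₀) := tendsto_limitPolar hf hw
  have hc0 : 0 < 1 - |γ| := by linarith
  -- An explicit minorant of the energies that converges to the limit energy: q(mₖ) is replaced by
  -- its tangent 2B(mₖ, m₀) - q(m₀) and the nonnegative cross-sectional energy is dropped. The
  -- comparison takes place in `EReal`, so the energies need not be bounded.
  have hlim : Tendsto (fun k => (1 - energyError γ (p (s k)) / (1 - |γ|)) *
      (2 * limitPolar γ (m k) m₀ - q₀) - energyError γ (p (s k))) atTop (𝓝 q₀) := by
    have := ((hδ.div_const (1 - |γ|)).const_sub 1).mul ((hB.const_mul 2).sub_const q₀) |>.sub hδ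
    convert this using 2
    ring
  have hlimE : Tendsto (fun k => (((1 - energyError γ (p (s k)) / (1 - |γ|)) *
      (2 * limitPolar γ (m k) m₀ - q₀) - energyError γ (p (s k)) : ℝ) : EReal)) atTop (𝓝 (q₀ : EReal)) :=
    (continuous_coe_real_ereal.tendsto q₀).comp hlim
  rw [← hlimE.liminf_eq]
  refine liminf_le_liminf ?_
  filter_upwards [hs.eventually hp.good, hδ.eventually (gt_mem_nhds (half_pos hc0))] with k hg hk
  have hk' : energyError γ (p (s k)) ≤ (1 - |γ|) / 2 := hk.le
  have h1 := energy_lower_bound hγ hg (hm k) hk'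
  have h2 := two_mul_limitPolar_le hγ.le (hm k).1 hf
  have h3 := transversalEnergy_nonneg (p (s k)) (m k)
  have h4 : 0 ≤ 1 - energyError γ (p (s k)) / (1 - |γ|) := by
    rw [sub_nonneg, div_le_one hc0]; linarith
  have h5 := mul_le_mul_of_nonneg_left h2 h4
  rw [EReal.coe_le_coe_iff]
  linarith

/-! ### Mollification error -/

/-- Dual form of the estimate of a translation difference in L¹ by |y| times the norm of the
gradient. The shift acts on the smooth ψ, so s ↦ ∫ u ψ(· - sy) is differentiable. The definition of
the weak derivative moves ∂ᵢ from ψ to u, and the mean value inequality on [0, 1] concludes. The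
thickening condition keeps all the shifted ψ inside Ω. -/
theorem abs_integral_mul_sub_shift_le {Ω : Set E3} (hΩ : IsOpen Ω) {u : E3 → ℝ} {v : Fin 3 → E3 → ℝ}
    (h : ∀ i, HasWeakPartial Ω i u (v i)) (hu : IntegrableOn u Ω) (hv : ∀ i, IntegrableOn (v i) Ω)
    {ψ : E3 → ℝ} (hψ : ContDiff ℝ ∞ ψ) (hc : HasCompactSupport ψ) {C r : ℝ} (hC : ∀ x, |ψ x| ≤ C)
    (hs : Metric.cthickening r (tsupport ψ) ⊆ Ω) {y : E3} (hy : ‖y‖ ≤ r) :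
    |∫ x, Ω.indicator u x * (ψ x - ψ (x - y))| ≤ ‖y‖ * (C * ∑ i, ∫ x in Ω, |v i x|) := by
  have hC0 : 0 ≤ C := (abs_nonneg _).trans (hC 0)
  have hui : Integrable (Ω.indicator u) := hu.integrable_indicator hΩ.measurableSet
  have hψ1 : ContDiff ℝ 1 ψ := hψ.of_le (by simp)
  have hdc : Continuous (fderiv ℝ ψ) := hψ1.continuous_fderiv one_ne_zero
  obtain ⟨M, hM⟩ := (hc.fderiv (𝕜 := ℝ)).exists_bound_of_continuous hdc
  have hM0 : 0 ≤ M := (norm_nonneg _).trans (hM 0)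
  let G : ℝ → ℝ := fun s => ∫ x, Ω.indicator u x * ψ (x - s • y)
  let G' : ℝ → ℝ := fun s => ∫ x, Ω.indicator u x * fderiv ℝ ψ (x - s • y) (-y)
  have hG : ∀ s, HasDerivAt G (G' s) s := by
    intro s
    refine (hasDerivAt_integral_of_dominated_loc_of_deriv_le (s := univ) (μ := (volume : Measure E3))
      (F := fun s x => Ω.indicator u x * ψ (x - s • y))
      (F' := fun s x => Ω.indicator u x * fderiv ℝ ψ (x - s • y) (-y))
      (bound := fun x => |Ω.indicator u x| * (M * ‖y‖)) univ_mem ?_ ?_ ?_ ?_ ?_ ?_).2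
    · refine Eventually.of_forall fun t => hui.aestronglyMeasurable.mul ?_
      exact (hψ.continuous.comp (by fun_prop)).aestronglyMeasurable
    · exact hui.mul_bdd (c := C) (hψ.continuous.comp (by fun_prop)).aestronglyMeasurable
        (Eventually.of_forall fun x => hC _)
    · refine hui.aestronglyMeasurable.mul ?_
      exact ((hdc.comp (by fun_prop)).clm_apply continuous_const).aestronglyMeasurable
    · refine Eventually.of_forall fun x t _ => ?_
      rw [norm_mul, Real.norm_eq_abs]
      gcongr
      refine (ContinuousLinearMap.le_opNorm _ _).trans ?_
      rw [norm_neg]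
      gcongr
      exact hM _
    · exact hui.abs.mul_const _
    · refine Eventually.of_forall fun x t _ => ?_
      have h1 : HasDerivAt (fun t : ℝ => x - t • y) (-y) t := by
        simpa using ((hasDerivAt_id t).smul_const y).const_sub x
      have h2 := ((hψ1.differentiable one_ne_zero (x - t • y)).hasFDerivAt.comp_hasDerivAt t h1)
      exact h2.const_mul _
  have hshift : ∀ s : ℝ, s ∈ Icc (0 : ℝ) 1 → IsTest Ω (fun x => ψ (x - s • y)) := by
    intro s hs1
    have e : (fun x => ψ (x - s • y)) = ψ ∘ (Homeomorph.subRight (s • y)) := rfl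
    refine ⟨hψ.comp (contDiff_id.sub contDiff_const), ?_, ?_⟩
    · rw [e]; exact hc.comp_homeomorph _
    · rw [e, tsupport_comp_eq_preimage]
      intro x hx
      apply hs
      refine Metric.mem_cthickening_of_dist_le x _ _ _ hx ?_
      simp only [Homeomorph.subRight_apply, dist_eq_norm, sub_sub_cancel, norm_smul, Real.norm_eq_abs,
        abs_of_nonneg hs1.1]
      nlinarith [norm_nonneg y, hs1.1, hs1.2]
  have hG' : ∀ s ∈ Icc (0 : ℝ) 1, |G' s| ≤ ‖y‖ * (C * ∑ i, ∫ x in Ω, |v i x|) := by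
    intro s hs1
    have ht := hshift s hs1
    have e1 : ∀ i x, partialD i (fun x => ψ (x - s • y)) x = partialD i ψ (x - s • y) := by
      intro i x
      simp only [partialD]
      rw [fderiv_comp_sub]
    have e2 : G' s = ∑ i, y i * ∫ x in Ω, v i x * ψ (x - s • y) := by
      have e3 : ∀ i, ∫ x, Ω.indicator u x * partialD i ψ (x - s • y) =
          - ∫ x in Ω, v i x * ψ (x - s • y) := by
        intro i
        rw [← (h i).2.2 _ ht, ← integral_indicator hΩ.measurableSet]
        refine integral_congr_ae (Eventually.of_forall fun x => ?_)
        by_cases hx : x ∈ Ω <;> simp [hx, e1]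
      have e4 : ∀ i, Integrable (fun x => Ω.indicator u x * partialD i ψ (x - s • y)) := by
        intro i
        refine hui.mul_bdd (c := M * 1) ?_ (Eventually.of_forall fun x => ?_)
        · exact ((hdc.clm_apply continuous_const).comp (by fun_prop)).aestronglyMeasurable
        · refine (ContinuousLinearMap.le_opNorm _ _).trans ?_
          gcongr
          · exact hM _
          · simp
      calc G' s = ∫ x, ∑ i, (-y i) * (Ω.indicator u x * partialD i ψ (x - s • y)) := by
            refine integral_congr_ae (Eventually.of_forall fun x => ?_)
            simp only [fderiv_apply_eq_sum, Finset.mul_sum]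
            refine Finset.sum_congr rfl fun i _ => ?_
            simp only [PiLp.neg_apply]
            ring
        _ = ∑ i, (-y i) * ∫ x, Ω.indicator u x * partialD i ψ (x - s • y) := by
            rw [integral_finsetSum _ fun i _ => (e4 i).const_mul _]
            simp only [integral_const_mul]
        _ = _ := by
            refine Finset.sum_congr rfl fun i _ => ?_
            rw [e3]; ring
    rw [e2]
    refine (Finset.abs_sum_le_sum_abs _ _).trans ?_
    rw [Finset.mul_sum, Finset.mul_sum]
    refine Finset.sum_le_sum fun i _ => ?_
    rw [abs_mul]
    have h1 : |y i| ≤ ‖y‖ := PiLp.norm_apply_le y i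
    have h2 : |∫ x in Ω, v i x * ψ (x - s • y)| ≤ C * ∫ x in Ω, |v i x| := by
      rw [← integral_const_mul]
      refine abs_setIntegral_le ((hv i).abs.const_mul C) fun x => ?_
      rw [abs_mul, mul_comm]
      gcongr
      exact hC _
    gcongr
  have h1 := norm_image_sub_le_of_norm_deriv_le_segment_01' (f := G) (f' := G')
    (fun s _ => (hG s).hasDerivWithinAt) (fun s hs => hG' s ⟨hs.1, hs.2.le⟩)
  have hib : ∀ s : ℝ, Integrable (fun x => Ω.indicator u x * ψ (x - s • y)) := fun s =>
    hui.mul_bdd (c := C) (hψ.continuous.comp (by fun_prop)).aestronglyMeasurable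
        (Eventually.of_forall fun x => hC _)
  have e : G 1 - G 0 = - ∫ x, Ω.indicator u x * (ψ x - ψ (x - y)) := by
    have i0 := hib 0
    have i1 := hib 1
    simp only [zero_smul, one_smul, sub_zero] at i0 i1
    simp only [G, zero_smul, one_smul, sub_zero]
    rw [← integral_sub i1 i0, ← integral_neg]
    exact integral_congr_ae (Eventually.of_forall fun x => by ring)
  rwa [e, norm_neg] at h1

theorem integrable_moll (n : ℕ) {u : E3 → ℝ} (hu : Integrable u) : Integrable (moll n u) := by
  rw [moll_eq_convolution]
  exact hu.integrable_convolution _ (integrable_kern n)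

/-- By self-adjointness the mollification error passes to ψ, where it is the average of ψ(x) - ψ(x -
y) against the kernel. Only |y| ≤ `rad n` contributes, so the shift estimate can be integrated in y.
-/
theorem abs_integral_sub_moll_mul_le {Ω : Set E3} (hΩ : IsOpen Ω) {u : E3 → ℝ} {v : Fin 3 → E3 → ℝ}
    (h : ∀ i, HasWeakPartial Ω i u (v i)) (hu : IntegrableOn u Ω) (hv : ∀ i, IntegrableOn (v i) Ω)
    {ψ : E3 → ℝ} (hψ : ContDiff ℝ ∞ ψ) (hc : HasCompactSupport ψ) {C : ℝ} (hC : ∀ x, |ψ x| ≤ C)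
    {n : ℕ} (hs : Metric.cthickening (rad n) (tsupport ψ) ⊆ Ω) :
    |∫ x, (Ω.indicator u x - moll n (Ω.indicator u) x) * ψ x| ≤
      rad n * (C * ∑ i, ∫ x in Ω, |v i x|) := by
  have hC0 : 0 ≤ C := (abs_nonneg _).trans (hC 0)
  have hui : Integrable (Ω.indicator u) := hu.integrable_indicator hΩ.measurableSet
  have hψi : Integrable ψ := hψ.continuous.integrable_of_hasCompactSupport hc
  have hk := integrable_kern n
  set V := C * ∑ i, ∫ x in Ω, |v i x| with hV
  have hV0 : 0 ≤ V := mul_nonneg hC0 (Finset.sum_nonneg fun i _ => integral_nonneg fun x => abs_nonneg _)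
  have hprod : Integrable (Function.uncurry fun x y => Ω.indicator u x * (kern n y * (ψ x - ψ (x - y))))
      (volume.prod volume) := by
    have h1 := (hui.mul_prod hk).mul_bdd (c := C + C)
      (g := fun z : E3 × E3 => ψ z.1 - ψ (z.1 - z.2)) ?_ ?_
    · refine h1.congr (Eventually.of_forall fun z => ?_)
      simp only [Function.uncurry]; ring
    · exact ((hψ.continuous.comp continuous_fst).sub
        (hψ.continuous.comp (continuous_fst.sub continuous_snd))).aestronglyMeasurable
    · exact Eventually.of_forall fun z => (norm_sub_le _ _).trans (add_le_add (hC _) (hC _))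
  have e1 : ∀ x, ψ x - moll n ψ x = ∫ y, kern n y * (ψ x - ψ (x - y)) := by
    intro x
    have i1 : Integrable (fun y => kern n y * ψ (x - y)) :=
      hk.mul_bdd (c := C) (hψ.continuous.comp (by fun_prop)).aestronglyMeasurable
        (Eventually.of_forall fun y => hC _)
    simp only [mul_sub]
    rw [integral_sub (hk.mul_const _) i1, integral_mul_const, integral_kern, one_mul, moll_eq_integral_sub]
  have e2 : ∫ x, (Ω.indicator u x - moll n (Ω.indicator u) x) * ψ x =
      ∫ y, kern n y * ∫ x, Ω.indicator u x * (ψ x - ψ (x - y)) := by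
    have i1 : Integrable (fun x => Ω.indicator u x * ψ x) :=
      hui.mul_bdd (c := C) hψ.continuous.aestronglyMeasurable (Eventually.of_forall hC)
    have i2 : Integrable (fun x => moll n (Ω.indicator u) x * ψ x) :=
      (integrable_moll n hui).mul_bdd (c := C) hψ.continuous.aestronglyMeasurable (Eventually.of_forall hC)
    have i3 : Integrable (fun x => Ω.indicator u x * moll n ψ x) :=
      hui.mul_bdd (c := C) (contDiff_moll n hψi.locallyIntegrable).continuous.aestronglyMeasurable
        (Eventually.of_forall fun x => abs_moll_le n (Eventually.of_forall hC) x)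
    calc _ = (∫ x, Ω.indicator u x * ψ x) - ∫ x, moll n (Ω.indicator u) x * ψ x := by
          rw [← integral_sub i1 i2]; simp only [sub_mul]
      _ = ∫ x, Ω.indicator u x * (ψ x - moll n ψ x) := by
          rw [integral_moll_mul n hui hψi, ← integral_sub i1 i3]; simp only [mul_sub]
      _ = ∫ x, ∫ y, Ω.indicator u x * (kern n y * (ψ x - ψ (x - y))) := by
          simp only [e1, integral_const_mul]
      _ = ∫ y, ∫ x, Ω.indicator u x * (kern n y * (ψ x - ψ (x - y))) := integral_integral_swap hprod
      _ = _ := by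
          refine integral_congr_ae (Eventually.of_forall fun y => ?_)
          simp only
          rw [← integral_const_mul]
          exact integral_congr_ae (Eventually.of_forall fun x => by ring)
  rw [e2]
  have h3 : ‖∫ y, kern n y * ∫ x, Ω.indicator u x * (ψ x - ψ (x - y))‖ ≤ ∫ y, kern n y * (rad n * V) := by
    refine norm_integral_le_of_norm_le (hk.mul_const _) (Eventually.of_forall fun y => ?_)
    rw [norm_mul, Real.norm_eq_abs, abs_of_nonneg (kern_nonneg n y)]
    by_cases hy : rad n < ‖y‖
    · simp [kern_eq_zero hy]
    · have hy' := not_lt.mp hy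
      refine mul_le_mul_of_nonneg_left ?_ (kern_nonneg n y)
      refine (abs_integral_mul_sub_shift_le hΩ h hu hv hψ hc hC hs hy').trans ?_
      exact mul_le_mul_of_nonneg_right hy' hV0
  rwa [integral_mul_const, integral_kern, one_mul] at h3

/-- A quantitative substitute for local Rellich compactness, obtained by duality. The L¹ norm is the
pairing with the sign of the error on K. One thickening of K makes room for smoothing that sign, the
other for the shifts in the mollification of u. -/
theorem setIntegral_abs_sub_moll_le {Ω : Set E3} (hΩ : IsOpen Ω) {u : E3 → ℝ} {v : Fin 3 → E3 → ℝ}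
    (h : ∀ i, HasWeakPartial Ω i u (v i)) (hu : IntegrableOn u Ω) (hv : ∀ i, IntegrableOn (v i) Ω)
    {K : Set E3} (hK : IsCompact K) {n : ℕ}
    (hs : Metric.cthickening (rad n) (Metric.cthickening (rad n) K) ⊆ Ω) :
    ∫ x in K, |u x - moll n (Ω.indicator u) x| ≤ rad n * ∑ i, ∫ x in Ω, |v i x| := by
  have hui : Integrable (Ω.indicator u) := hu.integrable_indicator hΩ.measurableSet
  have hKΩ : K ⊆ Ω := (Metric.self_subset_cthickening K).trans
    ((Metric.self_subset_cthickening _).trans hs)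
  set g : E3 → ℝ := fun x => Ω.indicator u x - moll n (Ω.indicator u) x with hg
  have hgi : Integrable g := hui.sub (integrable_moll n hui)
  -- The optimal test function is discontinuous. Its mollifications with index k ≥ n are admissible,
  -- bounded by 1, and converge to it almost everywhere as k → ∞.
  set w : E3 → ℝ := K.indicator (fun x => SignType.sign (g x) : E3 → ℝ) with hw
  have hw1 : ∀ x, |w x| ≤ 1 := by
    intro x
    by_cases hx : x ∈ K
    · rw [hw, indicator_of_mem hx]
      rcases lt_trichotomy (g x) 0 with h | h | h <;> simp [h]
    · simp [hw, hx]
  have hwm : AEStronglyMeasurable w := by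
    refine AEStronglyMeasurable.indicator ?_ hK.measurableSet
    have : Measurable (fun t : ℝ => ((SignType.sign t : SignType) : ℝ)) := by
      have e : (fun t : ℝ => ((SignType.sign t : SignType) : ℝ)) =
          fun t => if 0 < t then 1 else if t < 0 then -1 else 0 := by
        funext t
        rcases lt_trichotomy t 0 with h | h | h
        · simp [h, h.not_gt]
        · simp [h]
        · simp [h]
      rw [e]
      exact Measurable.ite measurableSet_Ioi measurable_const
        (Measurable.ite measurableSet_Iio measurable_const measurable_const)
    exact (this.comp_aemeasurable hgi.aestronglyMeasurable.aemeasurable).aestronglyMeasurable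
  have hwi : Integrable w := by
    have : IntegrableOn w K := Measure.integrableOn_of_bounded hK.measure_lt_top.ne hwm
      (M := 1) (Eventually.of_forall hw1)
    rwa [integrableOn_iff_integrable_of_support_subset] at this
    exact support_indicator_subset
  have hw0 : ∀ x ∉ K, w x = 0 := fun x hx => by simp [hw, hx]
  have hbd : ∀ k ≥ n, |∫ x, g x * moll k w x| ≤ rad n * (1 * ∑ i, ∫ x in Ω, |v i x|) := by
    intro k hk
    have hr : rad k ≤ rad n := by unfold rad; gcongr
    have hsup : tsupport (moll k w) ⊆ Metric.cthickening (rad k) K := by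
      refine closure_minimal ?_ Metric.isClosed_cthickening
      intro x hx
      by_contra hx'
      exact hx (moll_eq_zero_of_support hw0 hx')
    refine abs_integral_sub_moll_mul_le hΩ h hu hv (contDiff_moll k hwi.locallyIntegrable) ?_
      (fun x => abs_moll_le k (Eventually.of_forall hw1) x) ?_
    · exact HasCompactSupport.of_support_subset_isCompact hK.cthickening (subset_tsupport _ |>.trans hsup)
    · exact (Metric.cthickening_subset_of_subset _ (hsup.trans (Metric.cthickening_mono hr _))).trans hs
  have hlim : Tendsto (fun k => ∫ x, g x * moll k w x) atTop (𝓝 (∫ x, g x * w x)) := by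
    refine tendsto_integral_of_dominated_convergence (fun x => |g x|) ?_ hgi.abs ?_ ?_
    · exact fun k => hgi.aestronglyMeasurable.mul
        (contDiff_moll k hwi.locallyIntegrable).continuous.aestronglyMeasurable
    · refine fun k => Eventually.of_forall fun x => ?_
      rw [norm_mul, Real.norm_eq_abs, Real.norm_eq_abs]
      exact mul_le_of_le_one_right (abs_nonneg _) (abs_moll_le k (Eventually.of_forall hw1) x)
    · filter_upwards [ae_tendsto_moll hwi.locallyIntegrable] with x hx using hx.const_mul _
  have hfin := le_of_tendsto hlim.abs (eventually_atTop.mpr ⟨n, hbd⟩)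
  rw [one_mul] at hfin
  refine le_trans (le_of_eq ?_) ((le_abs_self _).trans hfin)
  rw [← integral_indicator hK.measurableSet]
  refine integral_congr_ae (Eventually.of_forall fun x => ?_)
  by_cases hx : x ∈ K
  · simp only [hw, indicator_of_mem hx, self_mul_sign, hg, indicator_of_mem (hKΩ hx)]
  · simp [hw, hx]

/-! ### Weak compactness -/

/-- Sequential Banach–Alaoglu in the dual of the separable space L², translated by the Riesz
isomorphism. -/
theorem exists_subseq_weak_limit {μ : Measure E3} [SigmaFinite μ] {u : ℕ → E3 → ℝ} {C : ℝ}
    (hu : ∀ k, MemLp (u k) 2 μ) (hC : ∀ k, ∫ x, u k x ^ 2 ∂μ ≤ C) :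
    ∃ (φ : ℕ → ℕ) (v : E3 → ℝ), StrictMono φ ∧ MemLp v 2 μ ∧ ∀ g, MemLp g 2 μ →
      Tendsto (fun k => ∫ x, u (φ k) x * g x ∂μ) atTop (𝓝 (∫ x, v x * g x ∂μ)) := by
  have : Fact ((2 : ℝ≥0∞) ≠ ⊤) := ⟨by simp⟩
  let T : ℕ → StrongDual ℝ (Lp ℝ 2 μ) := fun k => InnerProductSpace.toDual ℝ _ ((hu k).toLp)
  have hin : ∀ {a g : E3 → ℝ} (ha : MemLp a 2 μ) (hg : MemLp g 2 μ),
      inner ℝ (ha.toLp a) (hg.toLp g) = ∫ x, a x * g x ∂μ := by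
    intro a g ha hg
    rw [L2.inner_def]
    refine integral_congr_ae ?_
    filter_upwards [ha.coeFn_toLp, hg.coeFn_toLp] with x h1 h2
    simp [h1, h2, mul_comm]
  have hT : ∀ k, StrongDual.toWeakDual (T k) ∈
      WeakDual.toStrongDual ⁻¹' Metric.closedBall (0 : StrongDual ℝ (Lp ℝ 2 μ)) (√C) := by
    intro k
    have h1 : ‖T k‖ = ‖(hu k).toLp‖ := LinearIsometryEquiv.norm_map _ _
    have h2 : ‖(hu k).toLp‖ ^ 2 ≤ C := by
      rw [← real_inner_self_eq_norm_sq, hin]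
      simpa [sq] using hC k
    simp only [mem_preimage, mem_closedBall_zero_iff]
    change ‖T k‖ ≤ _
    rw [h1]
    exact Real.le_sqrt_of_sq_le h2
  obtain ⟨a, -, φ, hφ, hlim⟩ := WeakDual.isSeqCompact_closedBall ℝ (Lp ℝ 2 μ) 0 (√C) hT
  let V : Lp ℝ 2 μ := (InnerProductSpace.toDual ℝ _).symm (WeakDual.toStrongDual a)
  refine ⟨φ, V, hφ, Lp.memLp V, fun g hg => ?_⟩
  have h1 := (WeakDual.eval_continuous (𝕜 := ℝ) (hg.toLp g)).tendsto a |>.comp hlim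
  have e1 : a (hg.toLp g) = ∫ x, V x * g x ∂μ := by
    rw [← hin (Lp.memLp V) hg, Lp.toLp_coeFn]
    simp only [V, InnerProductSpace.toDual_symm_apply]
    rfl
  rw [e1] at h1
  refine h1.congr fun k => ?_
  rw [← hin (hu _) hg]
  rfl

theorem exists_subseq_weak_limit_finite {ι : Type*} [Finite ι] {μ : Measure E3} [SigmaFinite μ]
    {u : ι → ℕ → E3 → ℝ} {C : ℝ} (hu : ∀ i k, MemLp (u i k) 2 μ) (hC : ∀ i k, ∫ x, u i k x ^ 2 ∂μ ≤ C) :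
    ∃ (φ : ℕ → ℕ) (v : ι → E3 → ℝ), StrictMono φ ∧ ∀ i, MemLp (v i) 2 μ ∧ ∀ g, MemLp g 2 μ →
      Tendsto (fun k => ∫ x, u i (φ k) x * g x ∂μ) atTop (𝓝 (∫ x, v i x * g x ∂μ)) := by
  classical
  have := Fintype.ofFinite ι
  have key : ∀ s : Finset ι, ∃ φ : ℕ → ℕ, StrictMono φ ∧ ∀ i ∈ s, ∃ v, MemLp v 2 μ ∧ ∀ g, MemLp g 2 μ →
      Tendsto (fun k => ∫ x, u i (φ k) x * g x ∂μ) atTop (𝓝 (∫ x, v x * g x ∂μ)) := by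
    intro s
    induction s using Finset.induction_on with
    | empty => exact ⟨id, strictMono_id, by simp⟩
    | insert i s _ ih =>
      obtain ⟨φ, hφ, h⟩ := ih
      obtain ⟨φ', v, hφ', hv, hlim⟩ := exists_subseq_weak_limit (fun k => hu i (φ k)) (fun k => hC i (φ k))
      refine ⟨φ ∘ φ', hφ.comp hφ', fun j hj => ?_⟩
      rcases Finset.mem_insert.mp hj with rfl | hj
      · exact ⟨v, hv, hlim⟩
      · obtain ⟨v', hv', hlim'⟩ := h j hj
        exact ⟨v', hv', fun g hg => (hlim' g hg).comp hφ'.tendsto_atTop⟩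
  obtain ⟨φ, hφ, h⟩ := key Finset.univ
  choose v hv using fun i => h i (Finset.mem_univ i)
  exact ⟨φ, v, hφ, hv⟩

/-! ### The sphere constraint in the limit -/

theorem abs_one_sub_sum_sq_le {a b : Fin 3 → ℝ} (ha : ∀ j, |a j| ≤ 1) (hb : ∀ j, |b j| ≤ 1)
    (h : ∑ j, a j ^ 2 = 1) : |1 - ∑ j, b j ^ 2| ≤ 2 * ∑ j, |a j - b j| := by
  rw [← h, ← Finset.sum_sub_distrib, Finset.mul_sum]
  refine (Finset.abs_sum_le_sum_abs _ _).trans (Finset.sum_le_sum fun j _ => ?_)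
  rw [sq_sub_sq, abs_mul]
  refine mul_le_mul_of_nonneg_right ?_ (abs_nonneg _)
  exact (abs_add_le _ _).trans (by linarith [ha j, hb j])

theorem abs_one_sub_sum_sq_le_four {b : Fin 3 → ℝ} (hb : ∀ j, |b j| ≤ 1) :
    |1 - ∑ j, b j ^ 2| ≤ 4 := by
  have h : ∀ j, b j ^ 2 ≤ 1 := fun j => by rw [sq_le_one_iff_abs_le_one]; exact hb j
  rw [abs_le, Fin.sum_univ_three]
  constructor <;> linarith [h 0, h 1, h 2, sq_nonneg (b 0), sq_nonneg (b 1), sq_nonneg (b 2)]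

/-- The constraint is quadratic and does not pass to weak limits directly. For a fixed radius the
mollifications converge pointwise in k, so their squares do pass to the limit. The defect 1 - Σ(moll
uₖ)² is of order `rad n` in L¹(K), uniformly in k. Letting first k and then n tend to infinity gives
the constraint for U. -/
theorem sum_sq_eq_one_of_tendsto_moll {Ω : Set E3} (hΩ : IsOpen Ω)
    {u : ℕ → Fin 3 → E3 → ℝ} {v : ℕ → Fin 3 → Fin 3 → E3 → ℝ} {U : Fin 3 → E3 → ℝ} {C : ℝ}
    (h : ∀ k i j, HasWeakPartial Ω i (u k j) (v k i j)) (hu : ∀ k j, IntegrableOn (u k j) Ω)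
    (hv : ∀ k i j, IntegrableOn (v k i j) Ω) (hC : ∀ k i j, ∫ x in Ω, |v k i j x| ≤ C)
    (hu1 : ∀ k j, ∀ᵐ x ∂volume.restrict Ω, |u k j x| ≤ 1)
    (hs : ∀ k, ∀ᵐ x ∂volume.restrict Ω, ∑ j, u k j x ^ 2 = 1) (hU : ∀ j, IntegrableOn (U j) Ω)
    (hlim : ∀ j n x, Tendsto (fun k => moll n (Ω.indicator (u k j)) x) atTop
      (𝓝 (moll n (Ω.indicator (U j)) x))) {K : Set E3} (hK : IsCompact K) (hKΩ : K ⊆ Ω) :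
    ∀ᵐ x ∂volume.restrict K, ∑ j, U j x ^ 2 = 1 := by
  have hUi : ∀ j, Integrable (Ω.indicator (U j)) := fun j => (hU j).integrable_indicator hΩ.measurableSet
  have hui : ∀ k j, Integrable (Ω.indicator (u k j)) :=
    fun k j => (hu k j).integrable_indicator hΩ.measurableSet
  have hu1' : ∀ k j, ∀ᵐ x, |Ω.indicator (u k j) x| ≤ 1 := by
    intro k j
    filter_upwards [(ae_restrict_iff' hΩ.measurableSet).mp (hu1 k j)] with x hx
    by_cases hxΩ : x ∈ Ω
    · simpa [hxΩ] using hx hxΩ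
    · simp [hxΩ]
  have hm1 : ∀ n k j x, |moll n (Ω.indicator (u k j)) x| ≤ 1 := fun n k j x => abs_moll_le n (hu1' k j) x
  have hM1 : ∀ n j x, |moll n (Ω.indicator (U j)) x| ≤ 1 := fun n j x =>
    le_of_tendsto (hlim j n x).abs (Eventually.of_forall fun k => hm1 n k j x)
  have hcm : ∀ n k j, Continuous (moll n (Ω.indicator (u k j))) := fun n k j =>
    (contDiff_moll n (hui k j).locallyIntegrable).continuous
  have hcM : ∀ n j, Continuous (moll n (Ω.indicator (U j))) := fun n j =>
    (contDiff_moll n (hUi j).locallyIntegrable).continuous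
  obtain ⟨δ, hδ, hδΩ⟩ := hK.exists_cthickening_subset_open hΩ hKΩ
  have hrad : ∀ᶠ n in atTop, Metric.cthickening (rad n) (Metric.cthickening (rad n) K) ⊆ Ω := by
    filter_upwards [tendsto_rad.eventually (gt_mem_nhds (half_pos hδ))] with n hn
    refine (Metric.cthickening_cthickening_subset (rad_pos n).le (rad_pos n).le K).trans
      ((Metric.cthickening_mono ?_ K).trans hδΩ)
    linarith
  have hKfin : volume K ≠ ⊤ := hK.measure_lt_top.ne
  have hconst : ∀ c : ℝ, IntegrableOn (fun _ : E3 => c) K := fun c => integrableOn_const hKfin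
  -- The bound is proved for every k from |uₖ| = 1 and the mollification error, then passed to the
  -- limit by dominated convergence with the constant majorant 4.
  have hstep : ∀ᶠ n in atTop, ∫ x in K, |1 - ∑ j, moll n (Ω.indicator (U j)) x ^ 2| ≤
      rad n * (2 * ∑ _j : Fin 3, ∑ _i : Fin 3, C) := by
    filter_upwards [hrad] with n hn
    have hk : ∀ k, ∫ x in K, |1 - ∑ j, moll n (Ω.indicator (u k j)) x ^ 2| ≤
        rad n * (2 * ∑ _j : Fin 3, ∑ _i : Fin 3, C) := by
      intro k
      have hi : ∀ j, IntegrableOn (fun x => |u k j x - moll n (Ω.indicator (u k j)) x|) K := fun j =>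
        (((hu k j).mono_set hKΩ).sub ((hcm n k j).continuousOn.integrableOn_compact hK)).abs
      calc ∫ x in K, |1 - ∑ j, moll n (Ω.indicator (u k j)) x ^ 2|
          ≤ ∫ x in K, 2 * ∑ j, |u k j x - moll n (Ω.indicator (u k j)) x| := by
            refine integral_mono_ae ?_ ((integrable_finsetSum _ fun j _ => hi j).const_mul 2) ?_
            · have := hcm n k
              exact ContinuousOn.integrableOn_compact hK (by fun_prop)
            · have h1 : ∀ᵐ x ∂volume.restrict Ω, ∀ j, |u k j x| ≤ 1 := ae_all_iff.mpr (hu1 k)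
              filter_upwards [ae_restrict_of_ae_restrict_of_subset hKΩ h1,
                ae_restrict_of_ae_restrict_of_subset hKΩ (hs k)] with x hx1 hx2
              exact abs_one_sub_sum_sq_le hx1 (fun j => hm1 n k j x) hx2
        _ = 2 * ∑ j, ∫ x in K, |u k j x - moll n (Ω.indicator (u k j)) x| := by
            rw [integral_const_mul, integral_finsetSum _ fun j _ => hi j]
        _ ≤ 2 * ∑ _j : Fin 3, rad n * ∑ _i : Fin 3, C := by
            gcongr with j
            refine (setIntegral_abs_sub_moll_le hΩ (fun i => h k i j) (hu k j) (fun i => hv k i j) hK hn).trans ?_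
            gcongr with i
            · exact (rad_pos n).le
            · exact hC k i j
        _ = _ := by rw [← Finset.mul_sum]; ring
    have ht : Tendsto (fun k => ∫ x in K, |1 - ∑ j, moll n (Ω.indicator (u k j)) x ^ 2|) atTop
        (𝓝 (∫ x in K, |1 - ∑ j, moll n (Ω.indicator (U j)) x ^ 2|)) := by
      refine tendsto_integral_of_dominated_convergence (fun _ => 4) ?_ (hconst 4) ?_ ?_
      · intro k
        have := hcm n k
        exact Continuous.aestronglyMeasurable (by fun_prop)
      · refine fun k => Eventually.of_forall fun x => ?_
        rw [Real.norm_eq_abs, abs_abs]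
        exact abs_one_sub_sum_sq_le_four fun j => hm1 n k j x
      · refine Eventually.of_forall fun x => ?_
        exact ((tendsto_finsetSum _ fun j _ => (hlim j n x).pow 2).const_sub 1).abs
    exact le_of_tendsto ht (Eventually.of_forall hk)
  have hae : ∀ᵐ x ∂volume.restrict K, ∀ j, Tendsto (fun n => moll n (Ω.indicator (U j)) x) atTop (𝓝 (U j x)) := by
    rw [ae_all_iff]
    intro j
    filter_upwards [ae_restrict_of_ae (ae_tendsto_moll (hUi j).locallyIntegrable),
      ae_restrict_mem hK.measurableSet] with x hx hxK
    rwa [indicator_of_mem (hKΩ hxK)] at hx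
  have hUm : ∀ j, AEStronglyMeasurable (U j) (volume.restrict K) := fun j =>
    ((hU j).mono_set hKΩ).aestronglyMeasurable
  have hgm : AEStronglyMeasurable (fun x => |1 - ∑ j, U j x ^ 2|) (volume.restrict K) := by
    have e : (fun x => |1 - ∑ j, U j x ^ 2|) = fun x => |1 - (U 0 x ^ 2 + U 1 x ^ 2 + U 2 x ^ 2)| := by
      funext x; rw [Fin.sum_univ_three]
    rw [e]
    exact (aestronglyMeasurable_const.sub ((((hUm 0).pow 2).add ((hUm 1).pow 2)).add ((hUm 2).pow 2))).norm
  have hae' : ∀ᵐ x ∂volume.restrict K, Tendsto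
      (fun n => |1 - ∑ j, moll n (Ω.indicator (U j)) x ^ 2|) atTop (𝓝 |1 - ∑ j, U j x ^ 2|) := by
    filter_upwards [hae] with x hx
    exact ((tendsto_finsetSum _ fun j _ => (hx j).pow 2).const_sub 1).abs
  have hbd : ∀ᵐ x ∂volume.restrict K, ‖|1 - ∑ j, U j x ^ 2|‖ ≤ 4 := by
    filter_upwards [hae'] with x hx
    rw [Real.norm_eq_abs, abs_abs]
    exact le_of_tendsto hx (Eventually.of_forall fun n => abs_one_sub_sum_sq_le_four fun j => hM1 n j x)
  have ht : Tendsto (fun n => ∫ x in K, |1 - ∑ j, moll n (Ω.indicator (U j)) x ^ 2|) atTop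
      (𝓝 (∫ x in K, |1 - ∑ j, U j x ^ 2|)) := by
    refine tendsto_integral_of_dominated_convergence (fun _ => 4) ?_ (hconst 4) ?_ hae'
    · intro n
      have := hcM n
      exact Continuous.aestronglyMeasurable (by fun_prop)
    · refine fun k => Eventually.of_forall fun x => ?_
      rw [Real.norm_eq_abs, abs_abs]
      exact abs_one_sub_sum_sq_le_four fun j => hM1 k j x
  have hr0 : Tendsto (fun n => rad n * (2 * ∑ _j : Fin 3, ∑ _i : Fin 3, C)) atTop (𝓝 0) := by
    simpa using tendsto_rad.mul_const (2 * ∑ _j : Fin 3, ∑ _i : Fin 3, C)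
  have hz := le_of_tendsto_of_tendsto ht hr0 hstep
  have hint : IntegrableOn (fun x => |1 - ∑ j, U j x ^ 2|) K :=
    (hconst 4).mono' hgm hbd
  have h0 := (integral_eq_zero_iff_of_nonneg (fun x => abs_nonneg _) hint).mp
    (le_antisymm hz (integral_nonneg fun x => abs_nonneg _))
  filter_upwards [h0] with x hx
  have := abs_eq_zero.mp hx
  linarith

/-! ### Compactness -/

/-- A weight that makes bounded functions square integrable on the cylinder. It is only needed for
the first component. -/
def weight (j : Fin 3) (x : E3) : ℝ := if j = 0 then 1 + x 0 ^ 2 else 1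

theorem one_le_weight (j : Fin 3) (x : E3) : 1 ≤ weight j x := by
  unfold weight
  split_ifs
  · nlinarith [sq_nonneg (x 0)]
  · exact le_rfl

theorem contDiff_weight (j : Fin 3) : ContDiff ℝ ∞ (weight j) := by
  unfold weight
  split_ifs
  · fun_prop
  · fun_prop

theorem memLp_inv_one_add_sq : MemLp (fun t : ℝ => (1 + t ^ 2)⁻¹) 2 := by
  have hc : Continuous fun t : ℝ => (1 + t ^ 2)⁻¹ :=
    (by fun_prop : Continuous fun t : ℝ => 1 + t ^ 2).inv₀ fun t => by positivity
  rw [memLp_two_iff_integrable_sq hc.aestronglyMeasurable]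
  refine integrable_inv_one_add_sq.mono' (hc.pow 2).aestronglyMeasurable (Eventually.of_forall fun t => ?_)
  have h1 : (1 + t ^ 2)⁻¹ ≤ 1 := inv_le_one_of_one_le₀ (by nlinarith [sq_nonneg t])
  have h0 : 0 ≤ (1 + t ^ 2)⁻¹ := by positivity
  rw [norm_pow, Real.norm_eq_abs, abs_of_nonneg h0]
  nlinarith

theorem memLp_weighted {m : E3 → E3} (hm : m ∈ FiniteMaps) (j : Fin 3) :
    MemLp (fun x => m x j * (weight j x)⁻¹) 2 (volume.restrict cyl) := by
  by_cases hj : j = 0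
  · subst hj
    have h := (memLp_cyl_comp_iff memLp_inv_one_add_sq.aestronglyMeasurable 2).mpr memLp_inv_one_add_sq
    refine (h.mul (r := 2) (FiniteMaps.memLp_top hm 0)).congr_norm ?_ ?_
    · exact (FiniteMaps.memLp_top hm 0).aestronglyMeasurable.mul h.aestronglyMeasurable
    · exact Eventually.of_forall fun x => by simp [weight]
  · simpa [weight, hj] using FiniteMaps.memLp_two hm hj

/-- Testing with the limit itself, 2∫uₖv ≤ ∫uₖ² + ∫v² becomes 2‖v‖² ≤ ‖v‖². -/
theorem ae_eq_zero_of_weak_limit {μ : Measure E3} {u : ℕ → E3 → ℝ} {v : E3 → ℝ}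
    (hu : ∀ k, MemLp (u k) 2 μ) (hv : MemLp v 2 μ) (h : Tendsto (fun k => ∫ x, u k x ^ 2 ∂μ) atTop (𝓝 0))
    (hlim : Tendsto (fun k => ∫ x, u k x * v x ∂μ) atTop (𝓝 (∫ x, v x * v x ∂μ))) : v =ᵐ[μ] 0 := by
  have hvv : Integrable (fun x => v x * v x) μ := hv.integrable_mul hv
  have h1 : ∀ k, 2 * ∫ x, u k x * v x ∂μ ≤ (∫ x, u k x ^ 2 ∂μ) + ∫ x, v x * v x ∂μ := by
    intro k
    rw [← integral_const_mul, ← integral_add (hu k).integrable_sq hvv]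
    refine integral_mono (((hu k).integrable_mul hv).const_mul 2)
      ((hu k).integrable_sq.add (hv.integrable_mul hv)) fun x => ?_
    nlinarith [sq_nonneg (u k x - v x)]
  have h2 := le_of_tendsto_of_tendsto' (hlim.const_mul 2) (h.add_const _) h1
  have h3 : ∫ x, v x * v x ∂μ = 0 :=
    le_antisymm (by linarith) (integral_nonneg fun x => mul_self_nonneg _)
  have h4 := (integral_eq_zero_iff_of_nonneg (fun x => mul_self_nonneg _) (hv.integrable_mul hv)).mp h3
  filter_upwards [h4] with x hx
  simpa using hx

theorem setIntegral_abs_le {v : E3 → ℝ} (hv : MemLp v 2 (volume.restrict cyl)) {Ω : Set E3}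
    (hΩ : Ω ⊆ cyl) (hf : volume Ω ≠ ⊤) :
    IntegrableOn v Ω ∧ ∫ x in Ω, |v x| ≤ volume.real Ω + ∫ x in cyl, v x ^ 2 := by
  have hv' : MemLp v 2 (volume.restrict Ω) := hv.mono_measure (Measure.restrict_mono_set _ hΩ)
  have : IsFiniteMeasure (volume.restrict Ω) := ⟨by simpa using hf.lt_top⟩
  have h1 : IntegrableOn v Ω := hv'.integrable (by simp)
  refine ⟨h1, ?_⟩
  have h2 : IntegrableOn (fun _ : E3 => (1 : ℝ)) Ω := integrable_const _
  calc ∫ x in Ω, |v x| ≤ ∫ x in Ω, (1 + v x ^ 2) := by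
        refine integral_mono h1.abs (h2.add hv'.integrable_sq) fun x => ?_
        simp only
        nlinarith [sq_nonneg (|v x| - 1), sq_abs (v x)]
    _ = volume.real Ω + ∫ x in Ω, v x ^ 2 := by
        rw [integral_add h2 hv'.integrable_sq]; simp
    _ ≤ _ := by
        gcongr
        · exact Eventually.of_forall fun x => sq_nonneg _
        · exact hv.integrable_sq

/-- Weak limits are extracted for the nine derivatives and the three components simultaneously. The
first component is not in L², hence the weight, which is invisible to compactly supported test
functions. Linear relations such as weak differentiability pass to the limit, the cross-sectional
derivatives vanish by the last hypothesis, and only the sphere constraint needs strong compactness.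
-/
theorem exists_weakConv_subseq {m : ℕ → E3 → E3} (hm : ∀ k, m k ∈ FiniteMaps) {C : ℝ}
    (h1 : ∀ k i j, ∫ x in cyl, dm i (m k) x j ^ 2 ≤ C)
    (h2 : ∀ k j, j ≠ 0 → ∫ x in cyl, m k x j ^ 2 ≤ C)
    (h3 : ∀ i j, i ≠ 0 → Tendsto (fun k => ∫ x in cyl, dm i (m k) x j ^ 2) atTop (𝓝 0)) :
    ∃ φ : ℕ → ℕ, StrictMono φ ∧ ∃ m₀ ∈ AdmLimit, WeakConv (fun k => m (φ k)) m₀ := by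
  let u : (Fin 3 × Fin 3) ⊕ Fin 3 → ℕ → E3 → ℝ := fun a k => match a with
    | .inl (i, j) => fun x => dm i (m k) x j
    | .inr j => fun x => m k x j * (weight j x)⁻¹
  set C₀ := ∫ x in cyl, ((1 + x 0 ^ 2)⁻¹ : ℝ) ^ 2 with hC₀
  have hu : ∀ a k, MemLp (u a k) 2 (volume.restrict cyl) := by
    rintro (⟨i, j⟩ | j) k
    · exact FiniteMaps.memLp_dm (hm k) i j
    · exact memLp_weighted (hm k) j
  have hC : ∀ a k, ∫ x in cyl, u a k x ^ 2 ≤ max C C₀ := by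
    rintro (⟨i, j⟩ | j) k
    · exact (h1 k i j).trans (le_max_left _ _)
    · by_cases hj : j = 0
      · subst hj
        refine le_trans ?_ (le_max_right _ _)
        have h := (memLp_cyl_comp_iff memLp_inv_one_add_sq.aestronglyMeasurable 2).mpr memLp_inv_one_add_sq
        refine integral_mono_ae (hu (.inr 0) k).integrable_sq h.integrable_sq ?_
        filter_upwards [FiniteMaps.abs_le_one (hm k) 0] with x hx
        simp only [u, weight, if_true, mul_pow]
        exact mul_le_of_le_one_left (by positivity) ((sq_le_one_iff_abs_le_one _).mpr hx)
      · refine le_trans (le_of_eq ?_) ((h2 k j hj).trans (le_max_left _ _))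
        simp [u, weight, hj]
  obtain ⟨φ, v, hφ, hv⟩ := exists_subseq_weak_limit_finite hu hC
  refine ⟨φ, hφ, ?_⟩
  let D : Fin 3 → Fin 3 → E3 → ℝ := fun i j => v (.inl (i, j))
  let U : Fin 3 → E3 → ℝ := fun j x => weight j x * v (.inr j) x
  have hD : ∀ i j, MemLp (D i j) 2 (volume.restrict cyl) := fun i j => (hv (.inl (i, j))).1
  have hDlim : ∀ i j g, MemLp g 2 (volume.restrict cyl) → Tendsto
      (fun k => ∫ x in cyl, dm i (m (φ k)) x j * g x) atTop (𝓝 (∫ x in cyl, D i j x * g x)) :=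
    fun i j => (hv (.inl (i, j))).2
  have hUlim : ∀ (j : Fin 3) (g : E3 → ℝ), MemLp (fun x => weight j x * g x) 2 (volume.restrict cyl) → Tendsto
      (fun k => ∫ x in cyl, m (φ k) x j * g x) atTop (𝓝 (∫ x in cyl, U j x * g x)) := by
    intro j g hg
    have h := (hv (.inr j)).2 _ hg
    have e : ∫ x in cyl, U j x * g x = ∫ x in cyl, v (.inr j) x * (weight j x * g x) :=
      integral_congr_ae (Eventually.of_forall fun x => by simp only [U]; ring)
    rw [e]
    refine h.congr fun k => integral_congr_ae (Eventually.of_forall fun x => ?_)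
    have := one_le_weight j x
    have : weight j x ≠ 0 := by positivity
    simp only [u]
    field_simp
  have hwc : ∀ j, Continuous (weight j) := fun j => (contDiff_weight j).continuous
  have hUloc : ∀ j, LocallyIntegrable (cyl.indicator (U j)) := by
    intro j
    have h := locallyIntegrable_indicator_of_memLp measurableSet_cyl (by simp) (hv (.inr j)).1
    have e : cyl.indicator (U j) = fun x => weight j x * cyl.indicator (v (.inr j)) x := by
      funext x
      by_cases hx : x ∈ cyl <;> simp [hx, U]
    rw [e]
    exact h.continuous_mul (hwc j)
  have hUon : ∀ j, LocallyIntegrableOn (U j) cyl := fun j =>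
    locallyIntegrableOn_congr_ae ((hUloc j).locallyIntegrableOn cyl)
      (indicator_ae_eq_restrict measurableSet_cyl)
  have hDon : ∀ i j, LocallyIntegrableOn (D i j) cyl := fun i j =>
    locallyIntegrableOn_congr_ae
      ((locallyIntegrable_indicator_of_memLp measurableSet_cyl (by simp) (hD i j)).locallyIntegrableOn cyl)
      (indicator_ae_eq_restrict measurableSet_cyl)
  have htest : ∀ {g : E3 → ℝ}, Continuous g → HasCompactSupport g → MemLp g 2 (volume.restrict cyl) :=
    fun hg hc => (hg.memLp_of_hasCompactSupport hc).restrict cyl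
  have hweak : ∀ i j, HasWeakPartial cyl i (U j) (D i j) := by
    intro i j
    refine ⟨hUon j, hDon i j, fun ψ hψ => ?_⟩
    have l1 := hUlim j (partialD i ψ) (htest ((hwc j).mul (hψ.continuous_partialD i))
      (hψ.hasCompactSupport_partialD i).mul_left)
    have l2 := (hDlim i j ψ (htest hψ.1.continuous hψ.2.1)).neg
    refine tendsto_nhds_unique l1 (l2.congr fun k => ?_)
    exact ((FiniteMaps.hasWeakPartial (hm (φ k)) i j).2.2 ψ hψ).symm
  have hD0 : ∀ i, i ≠ 0 → ∀ j, D i j =ᵐ[volume.restrict cyl] fun _ => 0 := by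
    intro i hi j
    exact ae_eq_zero_of_weak_limit (fun k => FiniteMaps.memLp_dm (hm (φ k)) i j) (hD i j)
      ((h3 i j hi).comp hφ.tendsto_atTop) (hDlim i j _ (hD i j))
  -- Being a null set is a local property, so it suffices to treat balls inside the cylinder. Their
  -- finite volume turns the L² bounds on the derivatives into the L¹ bounds needed for the
  -- mollification estimate.
  have hsphere : ∀ᵐ x ∂volume.restrict cyl, ∑ j, U j x ^ 2 = 1 := by
    rw [ae_restrict_iff' measurableSet_cyl, ae_iff]
    refine measure_null_of_locally_null _ fun z hz => ?_
    simp only [mem_ofPred_eq, Classical.not_imp] at hz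
    obtain ⟨R, hR, hRc⟩ := Metric.isOpen_iff.mp isOpen_cyl z hz.1
    have hfin : volume (Metric.ball z R) ≠ ⊤ := measure_ball_lt_top.ne
    have hcl : IsCompact (Metric.closedBall z R) := isCompact_closedBall z R
    have hUb : ∀ j, IntegrableOn (U j) (Metric.ball z R) := by
      intro j
      have := ((hUloc j).integrableOn_isCompact hcl).mono_set Metric.ball_subset_closedBall
      refine this.congr_fun (fun x hx => ?_) measurableSet_ball
      simp [hRc hx]
    have hres : ∀ {P : E3 → Prop}, (∀ᵐ x ∂volume.restrict cyl, P x) →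
        ∀ᵐ x ∂volume.restrict (Metric.ball z R), P x := ae_restrict_of_ae_restrict_of_subset hRc
    have key := sum_sq_eq_one_of_tendsto_moll (Ω := Metric.ball z R) Metric.isOpen_ball
      (u := fun k j x => m (φ k) x j) (v := fun k i j x => dm i (m (φ k)) x j) (U := U)
      (C := volume.real (Metric.ball z R) + C)
      (fun k i j => (FiniteMaps.hasWeakPartial (hm (φ k)) i j).mono hRc)
      (fun k j => ?_)
      (fun k i j => (setIntegral_abs_le (FiniteMaps.memLp_dm (hm (φ k)) i j) hRc hfin).1)
      (fun k i j => (setIntegral_abs_le (FiniteMaps.memLp_dm (hm (φ k)) i j) hRc hfin).2.trans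
        (by gcongr; exact h1 _ i j))
      (fun k j => hres (FiniteMaps.abs_le_one (hm (φ k)) j))
      (fun k => hres ?_) hUb ?_
      (isCompact_closedBall z (R / 2)) (Metric.closedBall_subset_ball (by linarith))
    · refine ⟨{x | ¬∑ j, U j x ^ 2 = 1} ∩ Metric.closedBall z (R / 2),
        inter_mem (mem_of_superset self_mem_nhdsWithin fun x hx => ?_)
          (mem_nhdsWithin_of_mem_nhds (Metric.closedBall_mem_nhds z (by linarith))), ?_⟩
      · simp only [mem_ofPred_eq, Classical.not_imp] at hx
        exact hx.2
      · rw [← Measure.restrict_apply' Metric.isClosed_closedBall.measurableSet]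
        exact ae_iff.mp key
    · have : MemLp (fun x => m (φ k) x j) ⊤ (volume.restrict (Metric.ball z R)) :=
        (FiniteMaps.memLp_top (hm (φ k)) j).mono_measure (Measure.restrict_mono_set _ hRc)
      have _ : IsFiniteMeasure (volume.restrict (Metric.ball z R)) := ⟨by simpa using hfin.lt_top⟩
      exact this.integrable (by simp)
    · filter_upwards [FiniteMaps.sq_sum (hm (φ k))] with x hx
      rw [Fin.sum_univ_three]; exact hx
    · intro j n x
      -- The mollification at a point is a pairing with the kernel truncated to the ball, an L²
      -- function with bounded support. Weak convergence therefore gives convergence at every point.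
      have e : ∀ w : E3 → ℝ, moll n ((Metric.ball z R).indicator w) x =
          ∫ y in cyl, w y * (Metric.ball z R).indicator (fun y => kern n (x - y)) y := by
        intro w
        rw [moll, ← integral_indicator measurableSet_cyl]
        refine integral_congr_ae (Eventually.of_forall fun y => ?_)
        by_cases hy : y ∈ Metric.ball z R
        · simp [hy, hRc hy]
        · by_cases hy' : y ∈ cyl <;> simp [hy, hy']
      simp only [e]
      refine hUlim j _ ?_
      have hk := isTest_kern_sub n x (subset_univ (Metric.closedBall x (rad n)))
      have := (htest ((hwc j).mul hk.1.continuous) hk.2.1.mul_left).indicator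
        (measurableSet_ball (x := z) (ε := R))
      refine (memLp_congr_ae (Eventually.of_forall fun y => ?_)).mp this
      by_cases hy : y ∈ Metric.ball z R <;> simp [hy]
  let m₀ : E3 → E3 := fun x => WithLp.toLp 2 fun j => U j x
  have hdm : ∀ i j, (fun x => dm i m₀ x j) =ᵐ[volume.restrict cyl] D i j := fun i j =>
    (hweak i j).weakPartial_ae_eq isOpen_cyl
  have hfm : m₀ ∈ FiniteMaps := by
    refine ⟨?_, fun i j => ⟨_, hweak i j⟩, hSeminorm_lt_top (fun i j => (hD i j).ae_eq (hdm i j).symm) ?_⟩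
    · filter_upwards [hsphere] with x hx
      rw [EuclideanSpace.norm_eq]
      simp only [m₀, Real.norm_eq_abs, sq_abs, hx, Real.sqrt_one]
    · intro j hj
      have := (hv (.inr j)).1
      simpa [m₀, U, weight, hj] using this
  have hcomp : ∀ j, ∃ f : ℝ → ℝ, Measurable f ∧ ∀ᵐ x ∂volume.restrict cyl, U j x = f (x 0) := fun j =>
    exists_measurable_comp (hUloc j) fun i hi => (hweak i j).congr EventuallyEq.rfl (hD0 i hi j)
  choose f hf using hcomp
  refine ⟨m₀, ⟨hfm, fun t => WithLp.toLp 2 fun j => f j t, ?_⟩, fun g hg => ⟨fun i j => ?_, fun j hj => ?_⟩⟩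
  · filter_upwards [ae_all_iff.mpr fun j => (hf j).2] with x hx
    simp only [m₀]
    congr 1
    funext j
    exact hx j
  · have e : ∫ x in cyl, dm i m₀ x j * g x = ∫ x in cyl, D i j x * g x := by
      refine integral_congr_ae ?_
      filter_upwards [hdm i j] with x hx
      rw [hx]
    rw [e]
    exact hDlim i j g hg
  · exact hUlim j g (by simpa [weight, hj] using hg)

/-! ### A priori bounds and compactness from bounded energy -/

theorem integral_sq_dm_zero_le {m : E3 → E3} (hm : m ∈ FiniteMaps) (j : Fin 3) :
    ∫ x in cyl, dm 0 m x j ^ 2 ≤ axialEnergy m := by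
  refine integral_mono (FiniteMaps.memLp_dm hm 0 j).integrable_sq (integrableOn_axialDensity hm) fun x => ?_
  have := Finset.single_le_sum (f := fun j => dm 0 m x j ^ 2) (fun j _ => sq_nonneg _) (Finset.mem_univ j)
  simp only [axialDensity]
  nlinarith [sq_nonneg (m x 1), sq_nonneg (m x 2)]

theorem integral_sq_le {m : E3 → E3} (hm : m ∈ FiniteMaps) {j : Fin 3} (hj : j ≠ 0) :
    ∫ x in cyl, m x j ^ 2 ≤ axialEnergy m := by
  refine integral_mono (FiniteMaps.memLp_two hm hj).integrable_sq (integrableOn_axialDensity hm) fun x => ?_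
  have h : 0 ≤ ∑ j, dm 0 m x j ^ 2 := Finset.sum_nonneg fun j _ => sq_nonneg _
  simp only [axialDensity]
  have hj' : j = 1 ∨ j = 2 := by omega
  rcases hj' with rfl | rfl <;> nlinarith [sq_nonneg (m x 1), sq_nonneg (m x 2)]

/-- The factor η² undoes the weight 1/η of the anisotropic gradient. It is what makes the limit
independent of the cross-sectional variables. -/
theorem integral_sq_dm_le {p : WireParams} (hp : p.Good) {m : E3 → E3} (hm : m ∈ FiniteMaps) {i : Fin 3}
    (hi : i ≠ 0) (j : Fin 3) : ∫ x in cyl, dm i m x j ^ 2 ≤ p.eta ^ 2 * transversalEnergy p m := by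
  rw [transversalEnergy, ← integral_const_mul]
  refine integral_mono (FiniteMaps.memLp_dm hm i j).integrable_sq
    ((integrableOn_transversalDensity p hm).const_mul _) fun x => ?_
  have h1 := (Finset.single_le_sum (f := fun j => (p.sc i * dm i m x j) ^ 2) (fun j _ => sq_nonneg _)
    (Finset.mem_univ j)).trans (sq_sc_dm_le p m hi x)
  have h2 := hp.eta_pos
  have h3 : dm i m x j ^ 2 = p.eta ^ 2 * (p.sc i * dm i m x j) ^ 2 := by
    simp only [WireParams.sc, hi, if_false]
    field_simp
  rw [h3]
  exact mul_le_mul_of_nonneg_left h1 (sq_nonneg _)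

theorem exists_weakConv_of_limsup_energy_lt_top {γ : ℝ} (hγ : |γ| < 1) {p : ℝ → WireParams}
    (hp : Regime γ p) {s : ℕ → ℝ} {m : ℕ → E3 → E3} (hs : Tendsto s atTop (𝓝[>] 0))
    (hm : ∀ k, m k ∈ Adm (p (s k)))
    (hE : limsup (fun k => ((energy (p (s k)) (m k) : ℝ) : EReal)) atTop < ⊤) :
    ∃ φ : ℕ → ℕ, StrictMono φ ∧ ∃ m₀ ∈ AdmLimit, WeakConv (fun k => m (φ k)) m₀ := by
  obtain ⟨b, hb, -⟩ := EReal.lt_iff_exists_real_btwn.mp hE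
  have hEb := eventually_lt_of_limsup_lt hb
  have hc0 : 0 < 1 - |γ| := by linarith
  have hδ : Tendsto (fun k => energyError γ (p (s k))) atTop (𝓝 0) := hp.tendsto_energyError.comp hs
  have hs0 : Tendsto s atTop (𝓝 0) := hs.mono_right nhdsWithin_le_nhds
  have hbound : ∀ᶠ k in atTop, (p (s k)).Good ∧ (p (s k)).eta = s k ∧ s k ^ 2 ≤ 1 ∧
      axialEnergy (m k) ≤ 2 * (|b| + 1) / (1 - |γ|) ∧
      transversalEnergy (p (s k)) (m k) ≤ 2 * (|b| + 1) / (1 - |γ|) := by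
    filter_upwards [hEb, hs.eventually hp.good, hs.eventually hp.eta_eq,
      hδ.eventually (gt_mem_nhds (half_pos hc0)),
      (hs0.pow 2).eventually (gt_mem_nhds (by norm_num : (0 : ℝ) ^ 2 < 1))] with k h1 h2 h3 h4 h5
    refine ⟨h2, h3, h5.le, ?_⟩
    have h1' : energy (p (s k)) (m k) < b := by exact_mod_cast h1
    have h6 := energy_lower_bound hγ h2 (hm k) h4.le
    have h7 := axialEnergy_le (γ := γ) (hm k).1
    have hN := axialEnergy_nonneg (m k)
    have hG := transversalEnergy_nonneg (p (s k)) (m k)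
    -- With this factor the energy dominates (1 - |γ|)N/2 + G/2 - δ, and δ ≤ 1. Together with energy
    -- < b this is the origin of the bound 2(|b| + 1)/(1 - |γ|), which also covers G because 1 - |γ|
    -- ≤ 1.
    have h8 : 1 / 2 ≤ 1 - energyError γ (p (s k)) / (1 - |γ|) := by
      have : energyError γ (p (s k)) / (1 - |γ|) ≤ 1 / 2 := by
        rw [div_le_iff₀ hc0]; linarith
      linarith
    have h9 : 1 / 2 * ((1 - |γ|) * axialEnergy (m k)) ≤ (1 - energyError γ (p (s k)) / (1 - |γ|)) *
        (axialEnergy (m k) - 2 * γ * chirality (m k)) :=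
      mul_le_mul h8 h7 (by positivity) (by linarith)
    have hb' := le_abs_self b
    have hγ0 := abs_nonneg γ
    constructor
    · rw [le_div_iff₀ hc0]
      nlinarith
    · rw [le_div_iff₀ hc0]
      nlinarith [mul_nonneg hc0.le hN, mul_nonneg hγ0 hG]
  obtain ⟨k₀, hk₀⟩ := eventually_atTop.mp hbound
  set C := 2 * (|b| + 1) / (1 - |γ|) with hCdef
  have hC0 : 0 ≤ C := by positivity
  -- The parameters are meaningful and the bounds hold only from `k₀` on. The sequence is shifted by
  -- `k₀`, and the shift is put back into the subsequence at the end.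
  have hk : ∀ k, _ := fun k => hk₀ (k + k₀) (by omega)
  have htr : ∀ k i j, i ≠ 0 → ∫ x in cyl, dm i (m (k + k₀)) x j ^ 2 ≤ s (k + k₀) ^ 2 * C := by
    intro k i j hi
    obtain ⟨g1, g2, g3, g4, g5⟩ := hk k
    refine (integral_sq_dm_le g1 (hm _).1 hi j).trans ?_
    rw [g2]
    exact mul_le_mul_of_nonneg_left g5 (sq_nonneg _)
  have h1 : ∀ k i j, ∫ x in cyl, dm i (m (k + k₀)) x j ^ 2 ≤ C := by
    intro k i j
    by_cases hi : i = 0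
    · subst hi
      exact (integral_sq_dm_zero_le (hm _).1 j).trans (hk k).2.2.2.1
    · refine (htr k i j hi).trans ?_
      exact mul_le_of_le_one_left hC0 (hk k).2.2.1
  have h3 : ∀ i j, i ≠ 0 → Tendsto (fun k => ∫ x in cyl, dm i (m (k + k₀)) x j ^ 2) atTop (𝓝 0) := by
    intro i j hi
    have h0 : Tendsto (fun k => s (k + k₀) ^ 2 * C) atTop (𝓝 0) := by
      have := ((hs0.comp (tendsto_add_atTop_nat k₀)).pow 2).mul_const C
      simpa using this
    exact squeeze_zero (fun k => integral_nonneg fun x => sq_nonneg _) (fun k => htr k i j hi) h0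
  obtain ⟨φ, hφ, m₀, hm₀, hw⟩ := exists_weakConv_subseq (m := fun k => m (k + k₀)) (C := C)
    (fun k => (hm _).1) h1
    (fun k j hj => (integral_sq_le (hm _).1 hj).trans (hk k).2.2.2.1) h3
  exact ⟨fun k => φ k + k₀, fun a b hab => by simpa using hφ hab, m₀, hm₀, hw⟩

/-! ### Locally absolutely continuous functions on the line -/

/-- Absolute continuity on every bounded interval. -/
def LocAC (f : ℝ → ℝ) : Prop := ∀ a b, AbsolutelyContinuousOnInterval f a b

theorem LocAC.mul {f g : ℝ → ℝ} (hf : LocAC f) (hg : LocAC g) : LocAC (fun t => f t * g t) :=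
  fun a b => (hf a b).mul (hg a b)

theorem LocAC.add {f g : ℝ → ℝ} (hf : LocAC f) (hg : LocAC g) : LocAC (fun t => f t + g t) :=
  fun a b => (hf a b).add (hg a b)

theorem locAC_of_lipschitzWith {f : ℝ → ℝ} {K : NNReal} (h : LipschitzWith K f) : LocAC f :=
  fun _ _ => h.lipschitzOnWith.absolutelyContinuousOnInterval

/-- Serves for compositions whose outer function is Lipschitz only on the range of f, here u ↦
u^(-1/2) on u ≥ 1/4. -/
theorem LocAC.of_dist_le {f g : ℝ → ℝ} (hf : LocAC f) {K : ℝ} (hK : 0 < K)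
    (h : ∀ x y, dist (g x) (g y) ≤ K * dist (f x) (f y)) : LocAC g := by
  intro a b
  rw [absolutelyContinuousOnInterval_iff]
  intro ε hε
  obtain ⟨δ, hδ, H⟩ := (absolutelyContinuousOnInterval_iff f a b).mp (hf a b) (ε / K) (by positivity)
  refine ⟨δ, hδ, fun E hE hEδ => ?_⟩
  calc _ ≤ ∑ i ∈ Finset.range E.1, K * dist (f (E.2 i).1) (f (E.2 i).2) :=
        Finset.sum_le_sum fun i _ => h _ _
    _ = K * ∑ i ∈ Finset.range E.1, dist (f (E.2 i).1) (f (E.2 i).2) := (Finset.mul_sum _ _ _).symm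
    _ < K * (ε / K) := by gcongr; exact H E hE hEδ
    _ = ε := by field_simp

theorem LocAC.ae_differentiableAt {f : ℝ → ℝ} (hf : LocAC f) : ∀ᵐ t, DifferentiableAt ℝ f t := by
  have h : ∀ᵐ t, ∀ n : ℕ, t ∈ uIcc (-(n : ℝ)) n → DifferentiableAt ℝ f t :=
    ae_all_iff.mpr fun n => (hf _ _).ae_differentiableAt
  filter_upwards [h] with t ht
  obtain ⟨n, hn⟩ := exists_nat_ge |t|
  refine ht n ?_
  rw [uIcc_of_le (by linarith [abs_nonneg t])]
  exact abs_le.mp hn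

theorem LocAC.eq_add_integral {f : ℝ → ℝ} (hf : LocAC f) (t : ℝ) :
    f t = f 0 + ∫ s in (0 : ℝ)..t, deriv f s := by
  rw [(hf 0 t).integral_deriv_eq_sub]; ring

theorem locAC_primitive {h : ℝ → ℝ} (hh : LocallyIntegrable h) (c : ℝ) :
    LocAC (fun t => c + ∫ s in (0 : ℝ)..t, h s) := by
  refine LocAC.add (locAC_of_lipschitzWith (LipschitzWith.const c)) fun a b => ?_
  have hi : ∀ a b, IntervalIntegrable h volume a b := fun a b =>
    (hh.integrableOn_isCompact isCompact_uIcc).intervalIntegrable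
  -- The interval is enlarged to contain the base point 0 of the primitive and restricted to the
  -- given one afterwards.
  have h2 := (hi (min (min a b) 0) (max (max a b) 0)).absolutelyContinuousOnInterval_intervalIntegral (c := 0)
    (by rw [uIcc_of_le (by simp)]; simp)
  refine h2.mono ?_
  rw [uIcc_of_le (a := min (min a b) 0) (by simp)]
  exact Icc_subset_Icc (by simp) (by simp)

theorem ae_hasDerivAt_primitive {h : ℝ → ℝ} (hh : LocallyIntegrable h) (c : ℝ) :
    ∀ᵐ t, HasDerivAt (fun t => c + ∫ s in (0 : ℝ)..t, h s) (h t) t := by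
  filter_upwards [LocallyIntegrable.ae_hasDerivAt_integral hh] with t ht
  exact (ht 0).const_add c

/-! ### Decay at infinity -/

/-- Averaging f(t)² ≤ f(s)² + ∫|(f²)'| over s in a unit window bounds f(t)² by the integral of 2f² +
h² there, and this tends to 0 once the windows leave every point. The hypothesis on `l` covers both
ends of the line. -/
theorem tendsto_zero_of_memLp_primitive {f h : ℝ → ℝ} {c : ℝ} (hf : ∀ t, f t = c + ∫ s in (0 : ℝ)..t, h s)
    (hf2 : MemLp f 2) (hh : MemLp h 2) {l : Filter ℝ} [l.IsCountablyGenerated]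
    (hl : ∀ s, ∀ᶠ t in l, s ∉ Icc t (t + 1)) : Tendsto (fun t => f t ^ 2) l (𝓝 0) := by
  have hhl : LocallyIntegrable h := hh.locallyIntegrable one_le_two
  have hfe : f = fun t => c + ∫ s in (0 : ℝ)..t, h s := funext hf
  have hAC : LocAC f := by rw [hfe]; exact locAC_primitive hhl c
  have hfc : Continuous f := by rw [hfe]; exact continuous_primitive hhl c
  have hder : ∀ᵐ t, deriv f t = h t := by
    filter_upwards [ae_hasDerivAt_primitive hhl c] with t ht
    rw [hfe]; exact ht.deriv
  set w : ℝ → ℝ := fun s => 2 * f s ^ 2 + h s ^ 2 with hw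
  have hwi : Integrable w := (hf2.integrable_sq.const_mul 2).add hh.integrable_sq
  have hw0 : ∀ s, 0 ≤ w s := fun s => by simp only [hw]; positivity
  set v : ℝ → ℝ := fun s => f s ^ 2 + h s ^ 2 with hv
  have hvi : Integrable v := hf2.integrable_sq.add hh.integrable_sq
  -- Uses (f²)' = 2fh almost everywhere, absolute continuity, and 2|fh| ≤ f² + h².
  have hstep : ∀ t, ∀ s ∈ Icc t (t + 1), f t ^ 2 ≤ f s ^ 2 + ∫ r in t..(t + 1), v r := by
    intro t s hs
    have e := (hAC t s).integral_deriv_mul_eq_sub (hAC t s)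
    have h1 : |∫ r in t..s, (deriv f r * f r + f r * deriv f r)| ≤ ∫ r in t..s, v r := by
      rw [← Real.norm_eq_abs]
      refine intervalIntegral.norm_integral_le_of_norm_le hs.1 ?_ hvi.intervalIntegrable
      filter_upwards [hder] with r hr _
      rw [hr, Real.norm_eq_abs, abs_le]
      simp only [hv]
      constructor <;> nlinarith [sq_nonneg (f r + h r), sq_nonneg (f r - h r)]
    have h2 : ∫ r in t..s, v r ≤ ∫ r in t..(t + 1), v r :=
      intervalIntegral.integral_mono_interval le_rfl hs.1 hs.2
        (Eventually.of_forall fun r => by simp only [hv, Pi.zero_apply]; positivity) hvi.intervalIntegrable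
    rw [e] at h1
    have := (abs_le.mp h1).1
    nlinarith
  have hbd : ∀ t, f t ^ 2 ≤ ∫ s in Icc t (t + 1), w s := by
    intro t
    have hfi : IntervalIntegrable (fun s => f s ^ 2) volume t (t + 1) := (hfc.pow 2).intervalIntegrable _ _
    have hci : IntervalIntegrable (fun _ => ∫ r in t..(t + 1), v r) volume t (t + 1) :=
      intervalIntegrable_const
    have h1 : ∫ _s in t..(t + 1), f t ^ 2 ≤ ∫ s in t..(t + 1), (f s ^ 2 + ∫ r in t..(t + 1), v r) := by
      refine intervalIntegral.integral_mono_on (by linarith) (by simp) ?_ (fun s hs => hstep t s hs)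
      exact hfi.add hci
    rw [intervalIntegral.integral_add hfi hci] at h1
    simp only [intervalIntegral.integral_const, add_sub_cancel_left, one_smul] at h1
    refine h1.trans (le_of_eq ?_)
    rw [integral_Icc_eq_integral_Ioc, ← intervalIntegral.integral_of_le (by linarith),
      ← intervalIntegral.integral_add hfi hvi.intervalIntegrable]
    refine intervalIntegral.integral_congr fun s _ => ?_
    simp only [hv, hw]; ring
  have hlim : Tendsto (fun t => ∫ s in Icc t (t + 1), w s) l (𝓝 0) := by
    have e : ∀ t, ∫ s in Icc t (t + 1), w s = ∫ s, (Icc t (t + 1)).indicator w s := fun t =>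
      (integral_indicator measurableSet_Icc).symm
    simp only [e]
    have : Tendsto (fun t => ∫ s, (Icc t (t + 1)).indicator w s) l (𝓝 (∫ _s : ℝ, (0 : ℝ))) := by
      refine tendsto_integral_filter_of_dominated_convergence w ?_ ?_ hwi ?_
      · exact Eventually.of_forall fun t => hwi.aestronglyMeasurable.indicator measurableSet_Icc
      · refine Eventually.of_forall fun t => Eventually.of_forall fun s => ?_
        rw [Real.norm_eq_abs, abs_of_nonneg (indicator_nonneg (fun s _ => hw0 s) s)]
        exact indicator_le_self' (fun s _ => hw0 s) s
      · refine Eventually.of_forall fun s => tendsto_const_nhds.congr' ?_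
        filter_upwards [hl s] with t ht
        simp [ht]
    simpa using this
  exact squeeze_zero (fun t => sq_nonneg _) hbd hlim

theorem exists_sq_le_of_memLp_primitive {f h : ℝ → ℝ} {c : ℝ} (hf : ∀ t, f t = c + ∫ s in (0 : ℝ)..t, h s)
    (hf2 : MemLp f 2) (hh : MemLp h 2) {ε : ℝ} (hε : 0 < ε) : ∃ T, ∀ t, T ≤ |t| → f t ^ 2 ≤ ε := by
  have h1 := tendsto_zero_of_memLp_primitive hf hf2 hh (l := atTop)
    (fun s => (eventually_gt_atTop s).mono fun t ht h => absurd h.1 (not_le.mpr ht))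
  have h2 := tendsto_zero_of_memLp_primitive hf hf2 hh (l := atBot)
    (fun s => (eventually_lt_atBot (s - 1)).mono fun t ht h => absurd h.2 (by linarith))
  obtain ⟨a, ha⟩ := eventually_atTop.mp (h1.eventually (ge_mem_nhds hε))
  obtain ⟨b, hb⟩ := eventually_atBot.mp (h2.eventually (ge_mem_nhds hε))
  refine ⟨max a (-b), fun t ht => ?_⟩
  rcases le_total 0 t with h0 | h0
  · rw [abs_of_nonneg h0] at ht
    exact ha t ((le_max_left _ _).trans ht)
  · rw [abs_of_nonpos h0] at ht
    exact hb t (by linarith [(le_max_right a (-b)).trans ht])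

/-! ### Truncation of profiles -/

/-- A piecewise affine cut-off function. -/
def cutoff (T t : ℝ) : ℝ := max 0 (min 1 (T - |t|))

theorem cutoff_nonneg (T t : ℝ) : 0 ≤ cutoff T t := le_max_left _ _

theorem cutoff_le_one (T t : ℝ) : cutoff T t ≤ 1 := max_le zero_le_one (min_le_left _ _)

theorem cutoff_eq_one {T t : ℝ} (h : |t| ≤ T - 1) : cutoff T t = 1 := by
  unfold cutoff
  rw [min_eq_left (by linarith), max_eq_right zero_le_one]

theorem cutoff_eq_zero {T t : ℝ} (h : T ≤ |t|) : cutoff T t = 0 :=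
  max_eq_left ((min_le_right _ _).trans (by linarith))

theorem lipschitzWith_cutoff (T : ℝ) : LipschitzWith 1 (cutoff T) := by
  have h1 : LipschitzWith 1 (fun t : ℝ => T - |t|) := by
    refine LipschitzWith.of_dist_le_mul fun x y => ?_
    rw [Real.dist_eq, Real.dist_eq, NNReal.coe_one, one_mul, sub_sub_sub_cancel_left, abs_sub_comm x y]
    exact abs_abs_sub_abs_le_abs_sub y x
  exact (h1.const_min 1).const_max 0

/-- The constant 4 is the size of the derivative of u^(-1/2) at u = 1/4. -/
theorem abs_inv_sqrt_sub_le {u v : ℝ} (hu : 1 / 4 ≤ u) (hv : 1 / 4 ≤ v) :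
    |(√u)⁻¹ - (√v)⁻¹| ≤ 4 * |u - v| := by
  have h1 : 1 / 2 ≤ √u := Real.le_sqrt_of_sq_le (by linarith)
  have h2 : 1 / 2 ≤ √v := Real.le_sqrt_of_sq_le (by linarith)
  have e1 : (√u)⁻¹ - (√v)⁻¹ = (√v - √u) / (√u * √v) := by field_simp
  have e2 : u - v = (√u - √v) * (√u + √v) := by
    nlinarith [Real.sq_sqrt (by linarith : 0 ≤ u), Real.sq_sqrt (by linarith : 0 ≤ v)]
  rw [e1, e2, abs_div, abs_mul (√u - √v), abs_sub_comm (√v), abs_of_pos (by positivity : 0 < √u * √v),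
    abs_of_pos (by positivity : 0 < √u + √v), div_le_iff₀ (by positivity)]
  have h3 : 1 ≤ 4 * (√u + √v) * (√u * √v) := by nlinarith [mul_le_mul h1 h2 (by norm_num) (by linarith)]
  nlinarith [abs_nonneg (√u - √v)]

/-- The factor damping the components orthogonal to the axis. -/
def damping (T : ℝ) (j : Fin 3) (t : ℝ) : ℝ := if j = 0 then 1 else cutoff T t

/-- The components orthogonal to the axis are damped to 0 and the result is divided by its length.
The first component is not damped, so different signs at the two ends are permitted. Far out it
satisfies f₀² ≥ 1/2, since the other two squares are at most 1/4, so the length stays away from 0.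
The majorant F does not depend on T, which is what dominated convergence needs. -/
theorem exists_truncated_profile {f h : Fin 3 → ℝ → ℝ} {c : Fin 3 → ℝ}
    (hf : ∀ j t, f j t = c j + ∫ s in (0 : ℝ)..t, h j s) (hh : ∀ j, MemLp (h j) 2)
    (hs : ∀ t, ∑ j, f j t ^ 2 = 1) (hf2 : ∀ j, j ≠ 0 → MemLp (f j) 2) :
    ∃ (F : ℝ → ℝ) (T₀ : ℝ), MemLp F 2 ∧ ∀ T ≥ T₀, ∃ g k : Fin 3 → ℝ → ℝ,
      (∀ j, AEStronglyMeasurable (k j)) ∧ (∀ j t, g j t = g j 0 + ∫ s in (0 : ℝ)..t, k j s) ∧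
      (∀ t, ∑ j, g j t ^ 2 = 1) ∧ (∀ t, T ≤ |t| → ∀ j, j ≠ 0 → g j t = 0) ∧
      (∀ᵐ t, ∀ j, |k j t| ≤ F t) ∧ (∀ t, ∀ j, j ≠ 0 → |g j t| ≤ F t) ∧
      ∀ᵐ t, |t| < T - 1 → ∀ j, g j t = f j t ∧ k j t = h j t := by
  have hhl : ∀ j, LocallyIntegrable (h j) := fun j => (hh j).locallyIntegrable one_le_two
  have hfe : ∀ j, f j = fun t => c j + ∫ s in (0 : ℝ)..t, h j s := fun j => funext (hf j)
  have hAC : ∀ j, LocAC (f j) := fun j => by rw [hfe]; exact locAC_primitive (hhl j) _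
  have hder : ∀ᵐ t, ∀ j, HasDerivAt (f j) (h j t) t := by
    rw [ae_all_iff]
    intro j
    rw [hfe]
    exact ae_hasDerivAt_primitive (hhl j) _
  have hfle : ∀ j t, |f j t| ≤ 1 := by
    intro j t
    rw [← sq_le_one_iff_abs_le_one, ← hs t]
    exact Finset.single_le_sum (f := fun j => f j t ^ 2) (fun j _ => sq_nonneg _) (Finset.mem_univ j)
  set A : ℝ → ℝ := fun t => (|h 0 t| + |h 1 t| + |h 2 t|) + (|f 1 t| + |f 2 t|) with hA
  have hA2 : MemLp A 2 :=
    (((hh 0).norm.add (hh 1).norm).add (hh 2).norm).add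
      ((hf2 1 (by simp)).norm.add (hf2 2 (by simp)).norm)
  have hA0 : ∀ t, 0 ≤ A t := fun t => by simp only [hA]; positivity
  obtain ⟨T₁, hT₁⟩ := exists_sq_le_of_memLp_primitive (hf 1) (hf2 1 (by simp)) (hh 1)
    (by norm_num : (0 : ℝ) < 1 / 4)
  obtain ⟨T₂, hT₂⟩ := exists_sq_le_of_memLp_primitive (hf 2) (hf2 2 (by simp)) (hh 2)
    (by norm_num : (0 : ℝ) < 1 / 4)
  -- With g = a·r, the term a'r contributes 2A since r ≤ 2, and a·r' contributes 24A. The summand 1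
  -- in T₀ ensures that the region of damping, |t| > T - 1, lies where the decay estimates hold.
  refine ⟨fun t => 26 * A t, max T₁ T₂ + 1, hA2.const_mul 26, fun T hT => ?_⟩
  set a : Fin 3 → ℝ → ℝ := fun j t => damping T j t * f j t with ha
  have hd0 : ∀ j t, 0 ≤ damping T j t := fun j t => by
    unfold damping; split_ifs; exacts [zero_le_one, cutoff_nonneg T t]
  have hd1 : ∀ j t, damping T j t ≤ 1 := fun j t => by
    unfold damping; split_ifs; exacts [le_rfl, cutoff_le_one T t]
  have hdone : ∀ j t, |t| ≤ T - 1 → damping T j t = 1 := fun j t ht => by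
    unfold damping; split_ifs; exacts [rfl, cutoff_eq_one ht]
  have hdAC : ∀ j, LipschitzWith 1 (damping T j) := fun j => by
    unfold damping; split_ifs
    · exact (LipschitzWith.const 1).weaken zero_le_one
    · exact lipschitzWith_cutoff T
  have haAC : ∀ j, LocAC (a j) := fun j => (locAC_of_lipschitzWith (hdAC j)).mul (hAC j)
  have hale : ∀ j t, |a j t| ≤ |f j t| := fun j t => by
    simp only [ha]
    rw [abs_mul, abs_of_nonneg (hd0 j t)]
    exact mul_le_of_le_one_left (abs_nonneg _) (hd1 j t)
  set q : ℝ → ℝ := fun t => a 0 t * a 0 t + a 1 t * a 1 t + a 2 t * a 2 t with hq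
  have hqAC : LocAC q := ((((haAC 0).mul (haAC 0)).add ((haAC 1).mul (haAC 1))).add ((haAC 2).mul (haAC 2)))
  -- Where the cut-off is 1, q is the full length 1. Elsewhere the undamped first component alone
  -- gives q ≥ 1/2.
  have hq4 : ∀ t, 1 / 4 ≤ q t := by
    intro t
    have hst := hs t
    rw [Fin.sum_univ_three] at hst
    rcases le_or_gt |t| (T - 1) with h | h
    · simp only [hq, ha, hdone _ t h]; nlinarith
    · have h1 := hT₁ t (by linarith [le_max_left T₁ T₂])
      have h2 := hT₂ t (by linarith [le_max_right T₁ T₂])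
      have h0 : a 0 t = f 0 t := by simp [ha, damping]
      simp only [hq, h0]
      nlinarith [mul_self_nonneg (a 1 t), mul_self_nonneg (a 2 t)]
  set r : ℝ → ℝ := fun t => (√(q t))⁻¹ with hr
  have hrAC : LocAC r := hqAC.of_dist_le (K := 4) (by norm_num) fun x y => by
    simp only [Real.dist_eq, hr]
    exact abs_inv_sqrt_sub_le (hq4 x) (hq4 y)
  have hsq : ∀ t, 1 / 2 ≤ √(q t) := fun t => Real.le_sqrt_of_sq_le (by linarith [hq4 t])
  have hr0 : ∀ t, 0 ≤ r t := fun t => by simp only [hr]; positivity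
  have hr2 : ∀ t, r t ≤ 2 := fun t => by
    simp only [hr]
    rw [inv_le_comm₀ (by linarith [hsq t]) (by norm_num)]
    linarith [hsq t]
  set g : Fin 3 → ℝ → ℝ := fun j t => a j t * r t with hg
  have hgAC : ∀ j, LocAC (g j) := fun j => (haAC j).mul hrAC
  have hgeq : ∀ t, |t| ≤ T - 1 → ∀ j, g j t = f j t := by
    intro t ht j
    have hst := hs t
    rw [Fin.sum_univ_three] at hst
    have : q t = 1 := by simp only [hq, ha, hdone _ t ht]; nlinarith
    simp [hg, hr, this, ha, hdone _ t ht]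
  refine ⟨g, fun j => deriv (g j), fun j => (measurable_deriv _).aestronglyMeasurable,
    fun j t => (hgAC j).eq_add_integral t, ?_, ?_, ?_, ?_, ?_⟩
  · intro t
    have h1 : √(q t) ^ 2 = q t := Real.sq_sqrt (by linarith [hq4 t])
    have h2 : √(q t) ≠ 0 := by linarith [hsq t]
    have h3 : r t ^ 2 * q t = 1 := by rw [← h1]; simp only [hr]; field_simp
    rw [Fin.sum_univ_three, ← h3]
    simp only [hg, hq]; ring
  · intro t ht j hj
    simp [hg, ha, damping, hj, cutoff_eq_zero ht]
  · have hdd : ∀ᵐ t, ∀ j, DifferentiableAt ℝ (damping T j) t := by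
      rw [ae_all_iff]
      exact fun j => (locAC_of_lipschitzWith (hdAC j)).ae_differentiableAt
    filter_upwards [hder, hdd] with t h1 h2
    have hda : ∀ j, ∃ a', HasDerivAt (a j) a' t ∧ |a'| ≤ A t := by
      intro j
      refine ⟨_, (h2 j).hasDerivAt.mul (h1 j), ?_⟩
      have hl : |deriv (damping T j) t| ≤ 1 := by
        simpa using norm_deriv_le_of_lipschitz (hdAC j) (x₀ := t)
      have h3 : |deriv (damping T j) t * f j t| ≤ |f 1 t| + |f 2 t| := by
        rw [abs_mul]
        by_cases hj : j = 0
        · subst hj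
          have : deriv (damping T 0) t = 0 := by
            have e : damping T 0 = fun _ => 1 := by funext t; simp [damping]
            rw [e]; simp
          rw [this]; simp only [abs_zero, zero_mul]; positivity
        · refine (mul_le_of_le_one_left (abs_nonneg _) hl).trans ?_
          have hj' : j = 1 ∨ j = 2 := by omega
          rcases hj' with rfl | rfl
          · linarith [abs_nonneg (f 2 t)]
          · linarith [abs_nonneg (f 1 t)]
      have h4 : |damping T j t * h j t| ≤ |h 0 t| + |h 1 t| + |h 2 t| := by
        rw [abs_mul, abs_of_nonneg (hd0 j t)]
        refine (mul_le_of_le_one_left (abs_nonneg _) (hd1 j t)).trans ?_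
        have := Finset.single_le_sum (f := fun j => |h j t|) (fun j _ => abs_nonneg _) (Finset.mem_univ j)
        rwa [Fin.sum_univ_three] at this
      simp only [hA]
      exact (abs_add_le _ _).trans (by linarith)
    choose a' ha' hab using hda
    have ha1 : ∀ j, |a j t| ≤ 1 := fun j => (hale j t).trans (hfle j t)
    have hdq := ((((ha' 0).mul (ha' 0)).add ((ha' 1).mul (ha' 1))).add ((ha' 2).mul (ha' 2)))
    set q' := a' 0 * a 0 t + a 0 t * a' 0 + (a' 1 * a 1 t + a 1 t * a' 1) +
      (a' 2 * a 2 t + a 2 t * a' 2) with hq'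
    have hdq' : HasDerivAt q q' t := hdq
    have hp : ∀ j, |a' j * a j t| ≤ A t := fun j => by
      rw [abs_mul]
      exact (mul_le_of_le_one_right (abs_nonneg _) (ha1 j)).trans (hab j)
    have hq'6 : |q'| ≤ 6 * A t := by
      rw [abs_le]
      have p0 := abs_le.mp (hp 0)
      have p1 := abs_le.mp (hp 1)
      have p2 := abs_le.mp (hp 2)
      simp only [hq']
      constructor <;> nlinarith
    have hs0 : √(q t) ≠ 0 := by linarith [hsq t]
    have hdr : HasDerivAt r (-(q' / (2 * √(q t))) / √(q t) ^ 2) t :=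
      (hdq'.sqrt (by linarith [hq4 t])).inv hs0
    set r' := -(q' / (2 * √(q t))) / √(q t) ^ 2 with hr'
    -- Here r' = -q'/(2q√q) with |q'| ≤ 6A, and 2q√q ≥ 1/4.
    have hr'24 : |r'| ≤ 24 * A t := by
      rw [hr', abs_div, abs_neg, abs_div, Real.sq_sqrt (by linarith [hq4 t]),
        abs_of_pos (by linarith [hsq t] : 0 < 2 * √(q t)), abs_of_pos (by linarith [hq4 t] : 0 < q t)]
      rw [div_le_iff₀ (by linarith [hq4 t]), div_le_iff₀ (by linarith [hsq t])]
      have h5 : 1 / 4 * 1 ≤ q t * (2 * √(q t)) :=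
        mul_le_mul (hq4 t) (by linarith [hsq t]) (by norm_num) (by linarith [hq4 t])
      nlinarith [mul_le_mul_of_nonneg_left h5 (hA0 t)]
    intro j
    have hdg : HasDerivAt (g j) (a' j * r t + a j t * r') t := (ha' j).mul hdr
    rw [hdg.deriv]
    have h6 : |a' j * r t| ≤ A t * 2 := by
      rw [abs_mul, abs_of_nonneg (hr0 t)]
      exact mul_le_mul (hab j) (hr2 t) (hr0 t) (hA0 t)
    have h7 : |a j t * r'| ≤ 1 * (24 * A t) := by
      rw [abs_mul]
      exact mul_le_mul (ha1 j) hr'24 (abs_nonneg _) zero_le_one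
    exact (abs_add_le _ _).trans (by linarith)
  · intro t j hj
    simp only [hg]
    rw [abs_mul, abs_of_nonneg (hr0 t)]
    have h1 : |f j t| ≤ A t := by
      have hj' : j = 1 ∨ j = 2 := by omega
      simp only [hA]
      rcases hj' with rfl | rfl
      · have : 0 ≤ |h 0 t| + |h 1 t| + |h 2 t| := by positivity
        linarith [abs_nonneg (f 2 t)]
      · have : 0 ≤ |h 0 t| + |h 1 t| + |h 2 t| := by positivity
        linarith [abs_nonneg (f 1 t)]
    have h2 := mul_le_mul ((hale j t).trans h1) (hr2 t) (hr0 t) (hA0 t)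
    linarith [hA0 t]
  · filter_upwards [hder] with t h1 ht j
    refine ⟨hgeq t ht.le j, ?_⟩
    -- The inequality |t| < T - 1 is strict so that g and f agree in a neighbourhood and have the
    -- same derivative.
    have : g j =ᶠ[𝓝 t] f j := by
      have ho : {s : ℝ | |s| < T - 1} ∈ 𝓝 t := (isOpen_lt continuous_abs continuous_const).mem_nhds ht
      filter_upwards [ho] with s hs'
      exact hgeq s (le_of_lt hs') j
    rw [this.deriv_eq, (h1 j).deriv]

/-! ### Maps depending on the axial variable -/

/-- The map on the cylinder with a given axial profile. -/
def axialMap (g : Fin 3 → ℝ → ℝ) (x : E3) : E3 := WithLp.toLp 2 fun j => g j (x 0)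

/-- An absolutely continuous profile `g` with values in the sphere, with derivative `k`, and with
finite energy. -/
structure IsProfile (g k : Fin 3 → ℝ → ℝ) : Prop where
  eq_add_integral : ∀ j t, g j t = g j 0 + ∫ s in (0 : ℝ)..t, k j s
  sphere : ∀ t, ∑ j, g j t ^ 2 = 1
  memLp_deriv : ∀ j, MemLp (k j) 2
  memLp : ∀ j, j ≠ 0 → MemLp (g j) 2

/-- The energy density of a profile. -/
def profileDensity (g k : Fin 3 → ℝ → ℝ) (t : ℝ) : ℝ := (∑ j, k j t ^ 2) + (g 1 t ^ 2 + g 2 t ^ 2)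

/-- The chirality density of a profile. -/
def profileChirality (g k : Fin 3 → ℝ → ℝ) (t : ℝ) : ℝ := k 1 t * g 2 t - k 2 t * g 1 t

theorem IsProfile.integrable_profileDensity {g k : Fin 3 → ℝ → ℝ} (h : IsProfile g k) :
    Integrable (profileDensity g k) :=
  (integrable_finsetSum _ fun j _ => (h.memLp_deriv j).integrable_sq).add
    ((h.memLp 1 (by simp)).integrable_sq.add (h.memLp 2 (by simp)).integrable_sq)

theorem IsProfile.integrable_profileChirality {g k : Fin 3 → ℝ → ℝ} (h : IsProfile g k) :
    Integrable (profileChirality g k) :=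
  ((h.memLp_deriv 1).integrable_mul (h.memLp 2 (by simp))).sub
    ((h.memLp_deriv 2).integrable_mul (h.memLp 1 (by simp)))

theorem IsProfile.hasWeakPartial {g k : Fin 3 → ℝ → ℝ} (h : IsProfile g k) (i j : Fin 3) :
    HasWeakPartial cyl i (fun x => axialMap g x j) (fun x => if i = 0 then k j (x 0) else 0) := by
  have := hasWeakPartial_primitive ((h.memLp_deriv j).locallyIntegrable one_le_two) (g j 0) i
  simpa only [axialMap, ← h.eq_add_integral j] using this

theorem IsProfile.dm_axialMap {g k : Fin 3 → ℝ → ℝ} (h : IsProfile g k) (i j : Fin 3) :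
    ∀ᵐ x ∂volume.restrict cyl, dm i (axialMap g) x j = if i = 0 then k j (x 0) else 0 :=
  (h.hasWeakPartial i j).weakPartial_ae_eq isOpen_cyl

theorem IsProfile.axialMap_mem {g k : Fin 3 → ℝ → ℝ} (h : IsProfile g k) : axialMap g ∈ FiniteMaps := by
  refine ⟨Eventually.of_forall fun x => ?_, fun i j => ⟨_, h.hasWeakPartial i j⟩,
    hSeminorm_lt_top (fun i j => ?_) fun j hj => ?_⟩
  · rw [EuclideanSpace.norm_eq]
    simp only [axialMap, Real.norm_eq_abs, sq_abs, h.sphere, Real.sqrt_one]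
  · rw [memLp_congr_ae (h.dm_axialMap i j)]
    by_cases hi : i = 0
    · simp only [hi, if_true]
      exact (memLp_cyl_comp_iff (h.memLp_deriv j).aestronglyMeasurable 2).mpr (h.memLp_deriv j)
    · simp [hi]
  · exact (memLp_cyl_comp_iff (h.memLp j hj).aestronglyMeasurable 2).mpr (h.memLp j hj)

theorem axialEnergy_eq_of_profile {m : E3 → E3} {g k : Fin 3 → ℝ → ℝ} (h : IsProfile g k)
    (hm : ∀ᵐ x ∂volume.restrict cyl, ∀ j, m x j = g j (x 0) ∧ dm 0 m x j = k j (x 0)) :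
    axialEnergy m = area * ∫ t, profileDensity g k t := by
  rw [← integral_cyl_comp h.integrable_profileDensity.aestronglyMeasurable]
  refine integral_congr_ae ?_
  filter_upwards [hm] with x hx
  simp only [axialDensity, profileDensity, (hx _).1, (hx _).2]

theorem chirality_eq_of_profile {m : E3 → E3} {g k : Fin 3 → ℝ → ℝ} (h : IsProfile g k)
    (hm : ∀ᵐ x ∂volume.restrict cyl, ∀ j, m x j = g j (x 0) ∧ dm 0 m x j = k j (x 0)) :
    chirality m = area * ∫ t, profileChirality g k t := by
  rw [← integral_cyl_comp h.integrable_profileChirality.aestronglyMeasurable]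
  refine integral_congr_ae ?_
  filter_upwards [hm] with x hx
  simp only [chiralDensity, profileChirality, (hx _).1, (hx _).2]

theorem IsProfile.transversalEnergy_axialMap {g k : Fin 3 → ℝ → ℝ} (h : IsProfile g k) (p : WireParams) :
    transversalEnergy p (axialMap g) = 0 := by
  refine integral_eq_zero_of_ae ?_
  filter_upwards [ae_all_iff.mpr fun j => h.dm_axialMap 1 j, ae_all_iff.mpr fun j => h.dm_axialMap 2 j]
    with x h1 h2
  simp [transversalDensity, h1, h2]

theorem AdmLimit.exists_isProfile {m : E3 → E3} (hm : m ∈ AdmLimit) :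
    ∃ f h : Fin 3 → ℝ → ℝ, IsProfile f h ∧
      (∀ᵐ x ∂volume.restrict cyl, ∀ j, m x j = f j (x 0) ∧ dm 0 m x j = h j (x 0)) ∧
      ∀ᵐ x ∂volume.restrict cyl, ∀ i, i ≠ 0 → ∀ j, dm i m x j = 0 := by
  obtain ⟨c, h, hh, hx⟩ := AdmLimit.exists_profile hm
  set f : Fin 3 → ℝ → ℝ := fun j t => c j + ∫ s in (0 : ℝ)..t, h j s with hf
  have hfc : ∀ j, Continuous (f j) := fun j =>
    continuous_primitive ((hh j).locallyIntegrable one_le_two) (c j)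
  refine ⟨f, h, ⟨fun j t => by simp [hf], ?_, hh, fun j hj => ?_⟩,
    hx.mono fun x hx j => ⟨hx.1 j, hx.2.1 j⟩, hx.mono fun x hx => hx.2.2⟩
  · have hc : Continuous fun t => ∑ j, f j t ^ 2 := by fun_prop
    have h0 : ∫⁻ x in cyl, ‖(∑ j, f j (x 0) ^ 2) - 1‖ₑ = 0 := by
      refine (lintegral_congr_ae ?_).trans lintegral_zero
      filter_upwards [hx, FiniteMaps.sq_sum hm.1] with x h1 h2
      have : ∑ j, f j (x 0) ^ 2 = 1 := by
        rw [← h2, Fin.sum_univ_three, h1.1 0, h1.1 1, h1.1 2]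
      simp [this]
    have hm' : Measurable fun t => ‖(∑ j, f j t ^ 2) - 1‖ₑ := (hc.sub continuous_const).measurable.enorm
    rw [lintegral_cyl_comp (f := fun t => ‖(∑ j, f j t ^ 2) - 1‖ₑ) hm'.aemeasurable, mul_eq_zero] at h0
    have h1 := h0.resolve_left (by simpa using area_pos.ne')
    rw [lintegral_eq_zero_iff hm'] at h1
    have h2 : (fun t => ∑ j, f j t ^ 2) =ᵐ[volume] fun _ => 1 := by
      filter_upwards [h1] with t ht
      simpa [sub_eq_zero] using ht
    -- The sphere constraint is known almost everywhere on the cylinder, hence for almost every t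
    -- because the area is not 0. Continuity of the profile extends it to every t.
    exact fun t => congrFun (Continuous.ae_eq_iff_eq volume hc continuous_const |>.mp h2) t
  · rw [← memLp_cyl_comp_iff (hfc j).aestronglyMeasurable]
    exact (memLp_congr_ae (hx.mono fun x hx => hx.1 j)).mp (FiniteMaps.memLp_two hm.1 hj)

/-- The integrands differ from their limit only where |t| ≥ T - 1, and the difference is dominated
by a fixed integrable function, whose tail integrals tend to 0. -/
theorem tendsto_integral_of_eq_of_abs_lt {Ψ : ℝ → ℝ → ℝ} {Ψ₀ B : ℝ → ℝ}
    (hΨ : ∀ᶠ T in atTop, Integrable (Ψ T)) (hΨ₀ : Integrable Ψ₀) (hB : Integrable B)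
    (hle : ∀ᶠ T in atTop, ∀ᵐ t, |Ψ T t| ≤ B t)
    (heq : ∀ᶠ T in atTop, ∀ᵐ t, |t| < T - 1 → Ψ T t = Ψ₀ t) :
    Tendsto (fun T => ∫ t, Ψ T t) atTop (𝓝 (∫ t, Ψ₀ t)) := by
  set W : ℝ → ℝ := fun t => |B t| + |Ψ₀ t| with hW
  have hWi : Integrable W := hB.abs.add hΨ₀.abs
  have hW0 : ∀ t, 0 ≤ W t := fun t => by simp only [hW]; positivity
  have hS : ∀ T : ℝ, MeasurableSet {t : ℝ | T - 1 ≤ |t|} := fun T =>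
    (isClosed_le continuous_const continuous_abs).measurableSet
  have hlim : Tendsto (fun T : ℝ => ∫ t, {t : ℝ | T - 1 ≤ |t|}.indicator W t) atTop (𝓝 0) := by
    have : Tendsto (fun T : ℝ => ∫ t, {t : ℝ | T - 1 ≤ |t|}.indicator W t) atTop (𝓝 (∫ _t : ℝ, (0 : ℝ))) := by
      refine tendsto_integral_filter_of_dominated_convergence W ?_ ?_ hWi ?_
      · exact Eventually.of_forall fun T => hWi.aestronglyMeasurable.indicator (hS T)
      · refine Eventually.of_forall fun T => Eventually.of_forall fun t => ?_
        rw [Real.norm_eq_abs, abs_of_nonneg (indicator_nonneg (fun s _ => hW0 s) t)]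
        exact indicator_le_self' (fun s _ => hW0 s) t
      · refine Eventually.of_forall fun t => tendsto_const_nhds.congr' ?_
        filter_upwards [eventually_gt_atTop (|t| + 1)] with T hT
        rw [indicator_of_notMem]
        simp only [mem_ofPred_eq, not_le]
        linarith
    simpa using this
  rw [tendsto_iff_norm_sub_tendsto_zero]
  refine squeeze_zero' (Eventually.of_forall fun T => norm_nonneg _) ?_ hlim
  filter_upwards [hΨ, hle, heq] with T h1 h2 h3
  rw [← integral_sub h1 hΨ₀]
  refine norm_integral_le_of_norm_le (hWi.indicator (hS T)) ?_
  filter_upwards [h2, h3] with t h4 h5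
  by_cases ht : T - 1 ≤ |t|
  · rw [indicator_of_mem (by exact ht)]
    exact (norm_sub_le _ _).trans (add_le_add (h4.trans (le_abs_self _)) le_rfl)
  · rw [h5 (not_le.mp ht), sub_self, norm_zero]
    exact indicator_nonneg (fun s _ => hW0 s) t

/-- The uniform magnetisation e₁ serves as a default for small T, where the truncation is not
available, so that the approximants exist for all T. -/
theorem isProfile_const : IsProfile (fun j _ => if j = 0 then 1 else 0) (fun _ _ => 0) where
  eq_add_integral := by simp
  sphere := by simp
  memLp_deriv := by simp
  memLp j hj := by simp [hj]

theorem IsProfile.exists_approx {f h : Fin 3 → ℝ → ℝ} (hf : IsProfile f h) :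
    ∃ (F : ℝ → ℝ) (g k : ℝ → Fin 3 → ℝ → ℝ), MemLp F 2 ∧ (∀ T, IsProfile (g T) (k T)) ∧
      (∀ T t, T ≤ |t| → ∀ j, j ≠ 0 → g T j t = 0) ∧
      ∀ᶠ T in atTop, (∀ᵐ t, ∀ j, |k T j t| ≤ F t) ∧ (∀ t, ∀ j, j ≠ 0 → |g T j t| ≤ F t) ∧
      ∀ᵐ t, |t| < T - 1 → ∀ j, g T j t = f j t ∧ k T j t = h j t := by
  obtain ⟨F, T₀, hF, H⟩ := exists_truncated_profile hf.eq_add_integral hf.memLp_deriv hf.sphere hf.memLp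
  have H' : ∀ T, ∃ g k : Fin 3 → ℝ → ℝ, IsProfile g k ∧ (∀ t, T ≤ |t| → ∀ j, j ≠ 0 → g j t = 0) ∧
      (T ≥ T₀ → (∀ᵐ t, ∀ j, |k j t| ≤ F t) ∧ (∀ t, ∀ j, j ≠ 0 → |g j t| ≤ F t) ∧
      ∀ᵐ t, |t| < T - 1 → ∀ j, g j t = f j t ∧ k j t = h j t) := by
    intro T
    by_cases hT : T ≥ T₀
    · obtain ⟨g, k, h1, h2, h3, h4, h5, h6, h7⟩ := H T hT
      have hk : ∀ j, MemLp (k j) 2 := fun j =>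
        hF.mono' (h1 j) (h5.mono fun t ht => ht j)
      have hgc : ∀ j, Continuous (g j) := fun j => by
        rw [funext (h2 j)]
        exact continuous_primitive ((hk j).locallyIntegrable one_le_two) _
      exact ⟨g, k, ⟨h2, h3, hk, fun j hj => hF.mono' (hgc j).aestronglyMeasurable
        (Eventually.of_forall fun t => h6 t j hj)⟩, h4, fun _ => ⟨h5, h6, h7⟩⟩
    · exact ⟨_, _, isProfile_const, fun t _ j hj => by simp [hj], fun h => absurd h hT⟩
  choose g k h1 h2 h3 using H'
  exact ⟨F, g, k, hF, h1, h2, (eventually_ge_atTop T₀).mono fun T hT => h3 T hT⟩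

/-- The difference of two sphere-valued maps is not in `FiniteMaps`, so its weak derivatives are
computed by linearity. The seminorm then reduces to integrals over the line. -/
theorem hSeminorm_axialMap_sub {m : E3 → E3} (hm : m ∈ FiniteMaps) {f h g k : Fin 3 → ℝ → ℝ} (hf : IsProfile f h)
    (hg : IsProfile g k) (hmf : ∀ᵐ x ∂volume.restrict cyl, ∀ j, m x j = f j (x 0) ∧ dm 0 m x j = h j (x 0))
    (hm0 : ∀ᵐ x ∂volume.restrict cyl, ∀ i, i ≠ 0 → ∀ j, dm i m x j = 0) :
    hSeminorm (axialMap g - m) =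
      ENNReal.ofReal (area * ∫ t, ∑ j, (k j t - h j t) ^ 2) ^ (1 / 2 : ℝ) +
      ENNReal.ofReal (area * ∫ t, ((g 1 t - f 1 t) ^ 2 + (g 2 t - f 2 t) ^ 2)) ^ (1 / 2 : ℝ) := by
  have hdiff : ∀ᵐ x ∂volume.restrict cyl, ∀ i j, dm i (axialMap g - m) x j =
      if i = 0 then k j (x 0) - h j (x 0) else 0 := by
    rw [ae_all_iff]; intro i
    rw [ae_all_iff]; intro j
    have h1 := ((hg.hasWeakPartial i j).sub (FiniteMaps.hasWeakPartial hm i j)).weakPartial_ae_eq isOpen_cyl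
    filter_upwards [h1, hmf, hm0] with x h1 h2 h3
    refine h1.trans ?_
    by_cases hi : i = 0
    · subst hi; simp [(h2 j).2]
    · simp [hi, h3 i hi j]
  have hi1 : Integrable fun t => ∑ j, (k j t - h j t) ^ 2 :=
    integrable_finsetSum _ fun j _ => ((hg.memLp_deriv j).sub (hf.memLp_deriv j)).integrable_sq
  have hi2 : Integrable fun t => (g 1 t - f 1 t) ^ 2 + (g 2 t - f 2 t) ^ 2 :=
    ((hg.memLp 1 (by simp)).sub (hf.memLp 1 (by simp))).integrable_sq.add
      ((hg.memLp 2 (by simp)).sub (hf.memLp 2 (by simp))).integrable_sq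
  have key : ∀ {φ : ℝ → ℝ}, Integrable φ → (∀ t, 0 ≤ φ t) →
      ∫⁻ x in cyl, ENNReal.ofReal (φ (x 0)) = ENNReal.ofReal (area * ∫ t, φ t) := by
    intro φ hφ h0
    rw [lintegral_cyl_comp (f := fun t => ENNReal.ofReal (φ t)) hφ.aestronglyMeasurable.aemeasurable.ennreal_ofReal,
      ← ofReal_integral_eq_lintegral_ofReal hφ (Eventually.of_forall h0),
      ENNReal.ofReal_mul area.coe_nonneg, ENNReal.ofReal_coe_nnreal]
  rw [← key hi1 fun t => Finset.sum_nonneg fun j _ => sq_nonneg _, ← key hi2 fun t => by positivity]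
  unfold hSeminorm
  congr 2
  · refine lintegral_congr_ae ?_
    filter_upwards [hdiff] with x hx
    simp only [hx]
    congr 1
    rw [Fin.sum_univ_three]
    simp
  · refine lintegral_congr_ae ?_
    filter_upwards [hmf] with x hx
    simp only [Pi.sub_apply, PiLp.sub_apply, (hx _).1, axialMap]

/-- The truncation parameter is T = `len`, which tends to infinity because ρ/L → 0. The truncated
profile is extended constantly over the cross-section, so G = 0, and `abs_energy_sub_le` reduces
convergence of the full energy to convergence of N and X. -/
theorem exists_recovery_family {γ : ℝ} {p : ℝ → WireParams} (hp : Regime γ p) {m₀ : E3 → E3}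
    (hm₀ : m₀ ∈ AdmLimit) : ∃ m : ℝ → E3 → E3, (∀ η > 0, m η ∈ Adm (p η)) ∧
      Tendsto (fun η => hSeminorm (m η - m₀)) (𝓝[>] 0) (𝓝 0) ∧
      Tendsto (fun η => energy (p η) (m η)) (𝓝[>] 0) (𝓝 (energyLimit γ m₀)) := by
  obtain ⟨f, h, hf, hmf, hm0⟩ := AdmLimit.exists_isProfile hm₀
  obtain ⟨F, g, k, hF, hg, hg0, hev⟩ := hf.exists_approx
  have hle : ∀ {x y : ℝ}, |x| ≤ y → x ^ 2 ≤ y ^ 2 := fun hx => sq_le_sq' (abs_le.mp hx).1 (abs_le.mp hx).2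
  have hN : Tendsto (fun T => ∫ t, profileDensity (g T) (k T) t) atTop (𝓝 (∫ t, profileDensity f h t)) := by
    refine tendsto_integral_of_eq_of_abs_lt (Eventually.of_forall fun T => (hg T).integrable_profileDensity)
      hf.integrable_profileDensity (hF.integrable_sq.const_mul 5) ?_ ?_
    · filter_upwards [hev] with T hT
      filter_upwards [hT.1] with t ht
      rw [abs_of_nonneg (by unfold profileDensity; positivity), profileDensity, Fin.sum_univ_three]
      linarith [hle (ht 0), hle (ht 1), hle (ht 2), hle (hT.2.1 t 1 (by simp)), hle (hT.2.1 t 2 (by simp))]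
    · filter_upwards [hev] with T hT
      filter_upwards [hT.2.2] with t ht hlt
      simp only [profileDensity, (ht hlt _).1, (ht hlt _).2]
  have hX : Tendsto (fun T => ∫ t, profileChirality (g T) (k T) t) atTop
      (𝓝 (∫ t, profileChirality f h t)) := by
    refine tendsto_integral_of_eq_of_abs_lt (Eventually.of_forall fun T => (hg T).integrable_profileChirality)
      hf.integrable_profileChirality (hF.integrable_sq.const_mul 2) ?_ ?_
    · filter_upwards [hev] with T hT
      filter_upwards [hT.1] with t ht
      have h1 := hle (ht 1)
      have h2 := hle (ht 2)
      have h3 := hle (hT.2.1 t 1 (by simp))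
      have h4 := hle (hT.2.1 t 2 (by simp))
      rw [profileChirality, abs_le]
      constructor <;> nlinarith [sq_nonneg (k T 1 t - g T 2 t), sq_nonneg (k T 2 t - g T 1 t),
        sq_nonneg (k T 1 t + g T 2 t), sq_nonneg (k T 2 t + g T 1 t)]
    · filter_upwards [hev] with T hT
      filter_upwards [hT.2.2] with t ht hlt
      simp only [profileChirality, (ht hlt _).1, (ht hlt _).2]
  have hsub : ∀ {x y b : ℝ}, |x| ≤ b → (x - y) ^ 2 ≤ 2 * b ^ 2 + 2 * y ^ 2 := fun {x y b} hx => by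
    nlinarith [hle hx, sq_nonneg (x + y)]
  have hD1 : Tendsto (fun T => ∫ t, ∑ j, (k T j t - h j t) ^ 2) atTop (𝓝 0) := by
    have : Tendsto (fun T => ∫ t, ∑ j, (k T j t - h j t) ^ 2) atTop (𝓝 (∫ _t : ℝ, (0 : ℝ))) := by
      refine tendsto_integral_of_eq_of_abs_lt (B := fun t => ∑ j, (2 * F t ^ 2 + 2 * h j t ^ 2)) ?_
        (integrable_zero _ _ _) ?_ ?_ ?_
      · exact Eventually.of_forall fun T =>
          integrable_finsetSum _ fun j _ => (((hg T).memLp_deriv j).sub (hf.memLp_deriv j)).integrable_sq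
      · exact integrable_finsetSum _ fun j _ =>
          (hF.integrable_sq.const_mul 2).add ((hf.memLp_deriv j).integrable_sq.const_mul 2)
      · filter_upwards [hev] with T hT
        filter_upwards [hT.1] with t ht
        rw [abs_of_nonneg (by positivity)]
        exact Finset.sum_le_sum fun j _ => hsub (ht j)
      · filter_upwards [hev] with T hT
        filter_upwards [hT.2.2] with t ht hlt
        simp [(ht hlt _).2]
    simpa using this
  have hD2 : Tendsto (fun T => ∫ t, ((g T 1 t - f 1 t) ^ 2 + (g T 2 t - f 2 t) ^ 2)) atTop (𝓝 0) := by
    have : Tendsto (fun T => ∫ t, ((g T 1 t - f 1 t) ^ 2 + (g T 2 t - f 2 t) ^ 2)) atTop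
        (𝓝 (∫ _t : ℝ, (0 : ℝ))) := by
      refine tendsto_integral_of_eq_of_abs_lt
        (B := fun t => (2 * F t ^ 2 + 2 * f 1 t ^ 2) + (2 * F t ^ 2 + 2 * f 2 t ^ 2)) ?_
        (integrable_zero _ _ _) ?_ ?_ ?_
      · exact Eventually.of_forall fun T =>
          (((hg T).memLp 1 (by simp)).sub (hf.memLp 1 (by simp))).integrable_sq.add
            (((hg T).memLp 2 (by simp)).sub (hf.memLp 2 (by simp))).integrable_sq
      · exact ((hF.integrable_sq.const_mul 2).add ((hf.memLp 1 (by simp)).integrable_sq.const_mul 2)).add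
          ((hF.integrable_sq.const_mul 2).add ((hf.memLp 2 (by simp)).integrable_sq.const_mul 2))
      · filter_upwards [hev] with T hT
        refine Eventually.of_forall fun t => ?_
        rw [abs_of_nonneg (by positivity)]
        exact add_le_add (hsub (hT.2.1 t 1 (by simp))) (hsub (hT.2.1 t 2 (by simp)))
      · filter_upwards [hev] with T hT
        filter_upwards [hT.2.2] with t ht hlt
        simp [(ht hlt _).1]
    simpa using this
  -- Truncation at exactly T = `len` makes m' vanish where admissibility demands it. The
  -- approximants exist for every real T, so this holds for all η, not only small ones.
  have hadm : ∀ η, axialMap (g (p η).len) ∈ Adm (p η) := fun η =>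
    ⟨(hg _).axialMap_mem, Eventually.of_forall fun x hx =>
      ⟨hg0 _ _ hx 1 (by simp), hg0 _ _ hx 2 (by simp)⟩⟩
  refine ⟨fun η => axialMap (g (p η).len), fun η _ => hadm η, ?_, ?_⟩
  · simp only [hSeminorm_axialMap_sub hm₀.1 hf (hg _) hmf hm0]
    have hz : ∀ {Θ : ℝ → ℝ}, Tendsto Θ atTop (𝓝 0) →
        Tendsto (fun η => ENNReal.ofReal (area * Θ (p η).len) ^ (1 / 2 : ℝ)) (𝓝[>] 0) (𝓝 0) := by
      intro Θ hΘ
      have h1 := (hΘ.comp hp.tendsto_len).const_mul (area : ℝ)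
      have h2 := (ENNReal.continuous_rpow_const (y := 1 / 2)).tendsto _ |>.comp (ENNReal.tendsto_ofReal h1)
      simpa [Function.comp_def] using h2
    simpa using (hz hD1).add (hz hD2)
  · have hmT : ∀ T, ∀ᵐ x ∂volume.restrict cyl, ∀ j, axialMap (g T) x j = g T j (x 0) ∧
        dm 0 (axialMap (g T)) x j = k T j (x 0) := by
      intro T
      filter_upwards [ae_all_iff.mpr fun j => (hg T).dm_axialMap 0 j] with x hx j
      exact ⟨rfl, by simpa using hx j⟩
    have hN' : Tendsto (fun η => axialEnergy (axialMap (g (p η).len))) (𝓝[>] 0) (𝓝 (axialEnergy m₀)) := by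
      simp only [axialEnergy_eq_of_profile (hg _) (hmT _), axialEnergy_eq_of_profile hf hmf]
      exact (hN.comp hp.tendsto_len).const_mul _
    have hX' : Tendsto (fun η => chirality (axialMap (g (p η).len))) (𝓝[>] 0) (𝓝 (chirality m₀)) := by
      simp only [chirality_eq_of_profile (hg _) (hmT _), chirality_eq_of_profile hf hmf]
      exact (hX.comp hp.tendsto_len).const_mul _
    have hq : Tendsto (fun η => axialEnergy (axialMap (g (p η).len)) -
        2 * γ * chirality (axialMap (g (p η).len))) (𝓝[>] 0) (𝓝 (energyLimit γ m₀)) := by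
      rw [energyLimit_eq hm₀.1]
      exact hN'.sub (hX'.const_mul _)
    have herr : Tendsto (fun η => energyError γ (p η) * (1 + axialEnergy (axialMap (g (p η).len))))
        (𝓝[>] 0) (𝓝 0) := by
      simpa using hp.tendsto_energyError.mul (hN'.const_add 1)
    have hdist : Tendsto (fun η => energy (p η) (axialMap (g (p η).len)) -
        (axialEnergy (axialMap (g (p η).len)) - 2 * γ * chirality (axialMap (g (p η).len))))
        (𝓝[>] 0) (𝓝 0) := by
      refine squeeze_zero_norm' ?_ herr
      filter_upwards [hp.good] with η hη
      have := abs_energy_sub_le γ hη (hadm η)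
      rw [(hg _).transversalEnergy_axialMap] at this
      simpa using this
    simpa using hdist.add hq

end Nanowire

end

theorem theorem2p1 (γ : ℝ) (hγ : -1 < γ ∧ γ < 1) (p : ℝ → WireParams) (hp : Regime γ p) :
    -- well-posedness of the energies
    (∀ᶠ η in 𝓝[>] (0 : ℝ), ∀ m ∈ Adm (p η),
      IntegrableOn (density (p η) m) cyl ∧
      ∃ U, IsStrayPotential (p η) m U ∧
        ∀ V, IsStrayPotential (p η) m V → V =ᵐ[volume] U) ∧
    (∀ m ∈ AdmLimit, IntegrableOn (densityLimit γ m) cyl) ∧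
    -- compactness
    (∀ (s : ℕ → ℝ) (m : ℕ → E3 → E3), Tendsto s atTop (𝓝[>] 0) →
      (∀ k, m k ∈ Adm (p (s k))) →
      limsup (fun k => ((energy (p (s k)) (m k) : ℝ) : EReal)) atTop < ⊤ →
      ∃ φ : ℕ → ℕ, StrictMono φ ∧ ∃ m₀ ∈ AdmLimit, WeakConv (fun k => m (φ k)) m₀) ∧
    -- lower bound
    (∀ (s : ℕ → ℝ) (m : ℕ → E3 → E3) (m₀ : E3 → E3), Tendsto s atTop (𝓝[>] 0) →
      (∀ k, m k ∈ Adm (p (s k))) → m₀ ∈ AdmLimit → WeakConv m m₀ →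
      ((energyLimit γ m₀ : ℝ) : EReal) ≤
        liminf (fun k => ((energy (p (s k)) (m k) : ℝ) : EReal)) atTop) ∧
    -- upper bound
    (∀ m₀ ∈ AdmLimit, ∃ m : ℝ → E3 → E3, (∀ η > 0, m η ∈ Adm (p η)) ∧
      Tendsto (fun η => hSeminorm (m η - m₀)) (𝓝[>] 0) (𝓝 0) ∧
      Tendsto (fun η => energy (p η) (m η)) (𝓝[>] 0) (𝓝 (energyLimit γ m₀))) ∧
    -- the stray-field energy vanishes, uniformly over the admissible maps
    (∀ ε > 0, ∀ᶠ η in 𝓝[>] (0 : ℝ), ∀ m ∈ Adm (p η), strayEnergy (p η) m ≤ ε) := by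
  have hγ' : |γ| < 1 := abs_lt.mpr hγ
  refine ⟨?_, fun m hm => integrableOn_densityLimit hm.1,
    fun s m hs hm hE => exists_weakConv_of_limsup_energy_lt_top hγ' hp hs hm hE,
    fun s m m₀ hs hm hm₀ hw => energyLimit_le_liminf hγ' hp hs hm hm₀ hw,
    fun m₀ hm₀ => exists_recovery_family hp hm₀, fun ε hε => ?_⟩
  · filter_upwards [hp.good] with η hη m hm
    obtain ⟨U, hU, hV, -⟩ := exists_isStrayPotential hη hm.1
    exact ⟨integrableOn_density hm, U, hU, hV⟩
  · have h0 : Tendsto (fun η => 2 * area * ((p η).rho * (p η).L / (p η).d ^ 2)) (𝓝[>] 0) (𝓝 0) := by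
      simpa using hp.rhoL_d.const_mul (2 * (area : ℝ))
    filter_upwards [hp.good, h0.eventually (ge_mem_nhds hε)] with η hη h1 m hm
    exact (strayEnergy_le hη hm.1).trans h1
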